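/- **Setting.** Let $C,D\ge 0$ be integers and $A_0\subseteq\mathbb{R}^D$ the region of integration; $\int dx$ means $\int_{A_0}dx$. For each component $c=1,\dots,C$ let $\phi_{c,n}$, $n\in\mathbb{M}_c$, be finitely many functions that are orthonormal in $L^2(A_0)$. Put $M=\sum_c|\mathbb{M}_c|$ and $\delta_{\mathbb{M}_c}(x',x)=\sum_n\phi_{c,n}^*(x')\phi_{c,n}(x)$. Let $a_{c,n}$ be the annihilation operators on the bosonic Fock space of the $M$ modes, and $\tilde\Psi_c(x)=\sum_n\phi_{c,n}(x)a_{c,n}$. Let $\boldsymbol l=(l_1,\dots,l_C)$ be non-negative integers, $\hat O_{\boldsymbol l}(x)=\prod_c\tilde\Psi_c(x)^{l_c}$ and $$\mathcal{L}_{\boldsymbol l}[\hat A]=2\hat O_{\boldsymbol l}\hat A\hat O_{\boldsymbol l}^\dagger-\hat O_{\boldsymbol l}^\dagger\hat O_{\boldsymbol l}\hat A-\hat A\hat O_{\boldsymbol l}^\dagger\hat O_{\boldsymbol l}.$$ If $\boldsymbol l\ne 0$, assume $\int\prod_c\delta_{\mathbb{M}_c}(x,x)^{l_c}\,dx<\infty$,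 so that $\int dx\,\mathcal{L}_{\boldsymbol l}$ exists. Identify a restricted function $\Psi_c=\sum_n\phi_{c,n}\alpha_{c,n}$ with its amplitudes, so that phase space is $\mathbb{C}^M$. With Wirtinger derivatives put $$\frac{\delta}{\delta\Psi_c(x)}=\sum_n\phi_{c,n}^*(x)\frac{\partial}{\partial\alpha_{c,n}},\qquad \frac{\delta}{\delta\Psi_c^*(x)}=\sum_n\phi_{c,n}(x)\frac{\partial}{\partial\alpha_{c,n}^*}.$$ The Wigner transform of $\hat A$ is $$\mathcal{W}[\hat A](\Psi)=\frac1{\pi^{2M}}\int d^{2}\boldsymbol\Lambda\Big(\prod_c e^{\int dx(-\Lambda_c\Psi_c^*+\Lambda_c^*\Psi_c)}\Big)\,\mathrm{Tr}\Big\{\hat A\prod_c e^{\int dx(\Lambda_c\tilde\Psi_c^\dagger-\Lambda_c^*\tilde\Psi_c)}\Big\},$$ the integral being over $\mathbb{C}^M$. In general $\mathcal{W}[\hat A]$ is understood as a tempered distribution on $\mathbb{C}^M$: it is paired with a Schwartz function of $\Psi$ by carrying out the integrals over $\Psi$ and $\boldsymbol\Lambda$ for each matrix element of $\prod_c e^{\int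 dx(\Lambda_c\tilde\Psi_c^\dagger-\Lambda_c^*\tilde\Psi_c)}$ in the number basis and then summing (absolutely convergently) against the matrix elements of $\hat A$. Products of $\hat A$ with field operators, and their integrals over $x$, are understood through matrix elements in the number basis. **Theorem.** For every bounded operator $\hat A$ (in particular every Hilbert–Schmidt operator, every density operator), $\int dx\,\mathcal{L}_{\boldsymbol l}[\hat A]$ is well defined, the Wigner transforms of it and of $\hat A$ exist as tempered distributions, and $$\mathcal{W}\Big[\int dx\,\mathcal{L}_{\boldsymbol l}[\hat A]\Big]=\int dx\sum_{j_1=0}^{l_1}\sum_{k_1=0}^{l_1}\cdots\sum_{j_C=0}^{l_C}\sum_{k_C=0}^{l_C}\Big(\prod_{c=1}^C\Big(\frac{\delta}{\delta\Psi_c^*(x)}\Big)^{j_c}\Big(\frac{\delta}{\delta\Psi_c(x)}\Big)^{k_c}\Big)L_{\boldsymbol l,\boldsymbol j,\boldsymbol k}(x)\,\mathcal{W}[\hat A],$$ where $$L_{\boldsymbol l,\boldsymbol j,\boldsymbol k}(x)=\big(2-(-1)^{\sum_cj_c}-(-1)^{\sum_ck_c}\big)\prod_{c=1}^C\sum_{m=0}^{l_c-\max(j_c,k_c)}Q(l_c,j_c,k_c,m)\,\delta_{\mathbb{M}_c}(x,x)^m\,\Psi_c(x)^{l_c-j_c-m}\,\Psi_c^*(x)^{l_c-k_c-m},$$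 $$Q(l,j,k,m)=\frac{(-1)^m}{2^{j+k+m}}\,\frac{(l!)^2}{m!\,j!\,k!\,(l-k-m)!\,(l-j-m)!}.$$ The integral on the right converges absolutely when paired with any Schwartz function. If moreover the matrix elements of $\hat A$ in the number basis decay faster than every power of the total occupation, then the traces and integrals that define $\mathcal{W}[\hat A]$ and $\mathcal{W}[\int dx\,\mathcal{L}_{\boldsymbol l}[\hat A]]$ converge absolutely, $\mathcal{W}[\hat A]$ is a smooth function, and the identity holds pointwise on $\mathbb{C}^M$, the integral over $x$ converging absolutely at each point. -/

import Mathlib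

open MeasureTheory Matrix SchwartzMap LineDeriv
open scoped ComplexConjugate ContDiff

noncomputable section

namespace BoseWigner

variable {D C : ℕ} {ι : Fin C → Type*}

/-- Coordinate space `ℝ^D`. -/
abbrev Space (D : ℕ) : Type := EuclideanSpace ℝ (Fin D)

/-- The modes `(c, n)`: a component `c` together with a mode `n` of its restricted basis. -/
abbrev Mode {C : ℕ} (ι : Fin C → Type*) : Type _ := Σ c : Fin C, ι c

/-- Occupation numbers of the modes. -/
abbrev Occ {C : ℕ} (ι : Fin C → Type*) : Type _ := Mode ι → ℕ

/-- Phase space: mode amplitudes `α_{c,n}`, one complex number for each mode. The vector `α`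
stands for the tuple of restricted functions `∑ n, φ_{c,n} α_{c,n}`, see `field`. -/
abbrev Phase {C : ℕ} (ι : Fin C → Type*) : Type _ := Mode ι → ℂ

/-- For each component the mode functions are square integrable and orthonormal over the
integration region. -/
def IsOrthonormalModes (region : Set (Space D)) (φ : (c : Fin C) → ι c → Space D → ℂ) : Prop :=
  (∀ c n, MemLp (φ c n) 2 (volume.restrict region)) ∧
  (∀ c n, ∫ x in region, conj (φ c n x) * φ c n x = 1) ∧
  (∀ c n n', n ≠ n' → ∫ x in region, conj (φ c n x) * φ c n' x = 0)

/-! ### Restricted functions and the restricted delta function -/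

section Fields

variable [∀ c, Fintype (ι c)] (φ : (c : Fin C) → ι c → Space D → ℂ)

/-- The restricted function `Ψ_c(x) = ∑ n, φ_{c,n}(x) α_{c,n}` of component `c`. -/
def field (c : Fin C) (α : Phase ι) (x : Space D) : ℂ := ∑ n, φ c n x * α ⟨c, n⟩

/-- The restricted delta function `δ_{M_c}(x', x) = ∑ n, φ_{c,n}(x')^* φ_{c,n}(x)`. -/
def restrictedDelta (c : Fin C) (x' x : Space D) : ℂ := ∑ n, conj (φ c n x') * φ c n x

/-- The displacement functional `∏_c exp ∫ (-Λ_c Ψ_c^* + Λ_c^* Ψ_c) dx`. -/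
def displacementFunctional (region : Set (Space D)) (Λ Ψ : Phase ι) : ℂ :=
  ∏ c, Complex.exp (∫ x in region,
    (-(field φ c Λ x) * conj (field φ c Ψ x) + conj (field φ c Λ x) * field φ c Ψ x))

end Fields

/-! ### The Fock space and operators given by their matrix elements in the number basis -/

/-- The bosonic Fock space of the restricted modes, with the number states as orthonormal basis. -/
abbrev Fock {C : ℕ} (ι : Fin C → Type*) : Type _ := lp (fun _ : Occ ι => ℂ) 2

open Classical in
/-- The number state `|n⟩`. -/
def numberState (n : Occ ι) : Fock ι := lp.single 2 n (1 : ℂ)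

/-- Possibly unbounded operators, given by their matrix elements `⟨m|A|n⟩`. -/
abbrev FockMatrix {C : ℕ} (ι : Fin C → Type*) : Type _ := Matrix (Occ ι) (Occ ι) ℂ

/-- Matrix elements of a bounded operator. -/
def toMatrix (A : Fock ι →L[ℂ] Fock ι) : FockMatrix ι :=
  fun m n => inner ℂ (numberState m) (A (numberState n))

/-- Product of operators in terms of matrix elements. The sum has finitely many nonzero terms if
one of the factors is a polynomial in the ladder operators. -/
def opMul (A B : FockMatrix ι) : FockMatrix ι := fun m n => ∑' k, A m k * B k n

open Classical in
/-- Ordered product of a list of operators. -/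
def opProd (L : List (FockMatrix ι)) : FockMatrix ι := L.foldr opMul 1

/-- Powers of an operator. -/
def opPow (A : FockMatrix ι) (k : ℕ) : FockMatrix ι := opProd (List.replicate k A)

/-- Exponential of an operator by its power series. -/
def opExp (A : FockMatrix ι) : FockMatrix ι :=
  fun m n => ∑' k : ℕ, (k.factorial : ℂ)⁻¹ * opPow A k m n

/-- Trace of an operator. -/
def opTrace (A : FockMatrix ι) : ℂ := ∑' n, A n n

/-- Weak integral over the integration region of a coordinate-dependent operator. -/
def opIntegral (region : Set (Space D)) (A : Space D → FockMatrix ι) : FockMatrix ι :=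
  fun m n => ∫ x in region, A x m n

open Classical in
/-- The annihilation operator of mode `i`: `a_i |n⟩ = √(n_i) |n - e_i⟩`. -/
def annihilation (i : Mode ι) : FockMatrix ι :=
  fun m n => if n = m + Pi.single i 1 then ((Real.sqrt (n i) : ℝ) : ℂ) else 0

section Operators

variable [∀ c, Fintype (ι c)] (φ : (c : Fin C) → ι c → Space D → ℂ)

/-- The restricted field operator `Ψ̃_c(x) = ∑ n, φ_{c,n}(x) a_{c,n}`. -/
def fieldOp (c : Fin C) (x : Space D) : FockMatrix ι := ∑ n, φ c n x • annihilation ⟨c, n⟩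

/-- The displacement operator `exp ∫ (Λ_c Ψ̃_c† - Λ_c^* Ψ̃_c) dx` of component `c`. -/
def displacementOp (region : Set (Space D)) (c : Fin C) (Λ : Phase ι) : FockMatrix ι :=
  opExp (opIntegral region fun x =>
    field φ c Λ x • (fieldOp φ c x)ᴴ - conj (field φ c Λ x) • fieldOp φ c x)

/-- The product of the displacement operators of all components. -/
def totalDisplacementOp (region : Set (Space D)) (Λ : Phase ι) : FockMatrix ι :=
  opProd (List.ofFn fun c => displacementOp φ region c Λ)

/-- The coupling operator `O_l(x) = ∏_c Ψ̃_c(x)^{l_c}`. -/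
def couplingOp (l : Fin C → ℕ) (x : Space D) : FockMatrix ι :=
  opProd (List.ofFn fun c => opPow (fieldOp φ c x) (l c))

/-- The local loss term `L_l[A] = 2 O A O† - O† O A - A O† O` at the point `x`. -/
def lossTerm (l : Fin C → ℕ) (A : FockMatrix ι) (x : Space D) : FockMatrix ι :=
  (2 : ℂ) • opMul (opMul (couplingOp φ l x) A) (couplingOp φ l x)ᴴ
    - opMul (opMul (couplingOp φ l x)ᴴ (couplingOp φ l x)) A
    - opMul A (opMul (couplingOp φ l x)ᴴ (couplingOp φ l x))

/-! ### The Wigner transformation -/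

/-- The characteristic functional `Tr{A ∏_c D_c[Λ_c]}`. -/
def charFunctional (region : Set (Space D)) (A : FockMatrix ι) (Λ : Phase ι) : ℂ :=
  opTrace (opMul A (totalDisplacementOp φ region Λ))

/-- The Wigner transform of `A` as a function on phase space:
`π^{-2M} ∫ d²Λ D[Λ, Ψ] Tr{A ∏_c D_c[Λ_c]}`, where `M` is the total number of modes. -/
def wigner (region : Set (Space D)) (A : FockMatrix ι) (Ψ : Phase ι) : ℂ :=
  1 / (Real.pi : ℂ) ^ (2 * Fintype.card (Mode ι)) *
    ∫ Λ : Phase ι, displacementFunctional φ region Λ Ψ * charFunctional φ region A Λ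

/-- The traces and the phase-space integral in the definition of `wigner` converge absolutely. -/
def WignerConverges (region : Set (Space D)) (A : FockMatrix ι) : Prop :=
  (∀ Λ : Phase ι, Summable fun p : Occ ι × Occ ι =>
    A p.1 p.2 * totalDisplacementOp φ region Λ p.2 p.1) ∧
  Integrable (charFunctional φ region A)

/-- `T` is the Wigner transform of `A` as a tempered distribution on phase space: `∫ d²Ψ f W[A]` is
the absolutely convergent sum over the matrix elements of `A` that results when the integral
against the test function `f` is carried out before the trace. -/
def IsWignerDistribution (region : Set (Space D)) (A : FockMatrix ι) (T : 𝓢'(Phase ι, ℂ)) : Prop :=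
  ∀ f : 𝓢(Phase ι, ℂ), HasSum (fun p : Occ ι × Occ ι =>
    A p.1 p.2 * (1 / (Real.pi : ℂ) ^ (2 * Fintype.card (Mode ι)) *
      ∫ Λ : Phase ι, (∫ Ψ : Phase ι, f Ψ * displacementFunctional φ region Λ Ψ) *
        totalDisplacementOp φ region Λ p.2 p.1)) (T f)

/-- The matrix elements of `A` in the number basis decay faster than any power of the total
occupation. -/
def RapidlyDecreasing (A : FockMatrix ι) : Prop :=
  ∀ K : ℕ, ∃ R : ℝ, ∀ m n : Occ ι, (1 + ∑ i, (m i : ℝ) + ∑ i, (n i : ℝ)) ^ K * ‖A m n‖ ≤ R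

end Operators

/-! ### Functional derivatives of functions on phase space -/

open Classical in
/-- The Wirtinger derivative `∂/∂α_i`. -/
def wirtinger (i : Mode ι) (F : Phase ι → ℂ) (α : Phase ι) : ℂ :=
  (1 / 2) * (lineDeriv ℝ F α (Pi.single i 1) - Complex.I * lineDeriv ℝ F α (Pi.single i Complex.I))

open Classical in
/-- The Wirtinger derivative `∂/∂α_i^*`. -/
def wirtingerStar (i : Mode ι) (F : Phase ι → ℂ) (α : Phase ι) : ℂ :=
  (1 / 2) * (lineDeriv ℝ F α (Pi.single i 1) + Complex.I * lineDeriv ℝ F α (Pi.single i Complex.I))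

section FunctionalDerivatives

variable [∀ c, Fintype (ι c)] (φ : (c : Fin C) → ι c → Space D → ℂ)

/-- The functional derivative `δ/δΨ_c(x) = ∑ n, φ_{c,n}(x)^* ∂/∂α_{c,n}`. -/
def funcDeriv (c : Fin C) (x : Space D) (F : Phase ι → ℂ) : Phase ι → ℂ :=
  fun α => ∑ n, conj (φ c n x) * wirtinger ⟨c, n⟩ F α

/-- The functional derivative `δ/δΨ_c^*(x) = ∑ n, φ_{c,n}(x) ∂/∂α_{c,n}^*`. -/
def funcDerivStar (c : Fin C) (x : Space D) (F : Phase ι → ℂ) : Phase ι → ℂ :=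
  fun α => ∑ n, φ c n x * wirtingerStar ⟨c, n⟩ F α

/-- `∏_c (δ/δΨ_c^*(x))^{j_c} (δ/δΨ_c(x))^{k_c}` acting on functions. -/
def mixedDeriv (j k : Fin C → ℕ) (x : Space D) : (Phase ι → ℂ) → (Phase ι → ℂ) :=
  (List.ofFn fun c => (funcDerivStar φ c x)^[j c] ∘ (funcDeriv φ c x)^[k c]).foldr (· ∘ ·) id

end FunctionalDerivatives

/-! ### Functional derivatives of tempered distributions on phase space -/

section Distributions

variable [∀ c, Fintype (ι c)] (φ : (c : Fin C) → ι c → Space D → ℂ)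

open Classical in
/-- The Wirtinger derivative `∂/∂α_i` of tempered distributions. -/
def wirtingerDist (i : Mode ι) : 𝓢'(Phase ι, ℂ) →L[ℂ] 𝓢'(Phase ι, ℂ) :=
  (1 / 2 : ℂ) • (lineDerivOpCLM ℂ 𝓢'(Phase ι, ℂ) (Pi.single i 1 : Phase ι)
    - Complex.I • lineDerivOpCLM ℂ 𝓢'(Phase ι, ℂ) (Pi.single i Complex.I : Phase ι))

open Classical in
/-- The Wirtinger derivative `∂/∂α_i^*` of tempered distributions. -/
def wirtingerStarDist (i : Mode ι) : 𝓢'(Phase ι, ℂ) →L[ℂ] 𝓢'(Phase ι, ℂ) :=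
  (1 / 2 : ℂ) • (lineDerivOpCLM ℂ 𝓢'(Phase ι, ℂ) (Pi.single i 1 : Phase ι)
    + Complex.I • lineDerivOpCLM ℂ 𝓢'(Phase ι, ℂ) (Pi.single i Complex.I : Phase ι))

/-- The functional derivative `δ/δΨ_c(x)` of tempered distributions. -/
def funcDerivDist (c : Fin C) (x : Space D) : 𝓢'(Phase ι, ℂ) →L[ℂ] 𝓢'(Phase ι, ℂ) :=
  ∑ n, conj (φ c n x) • wirtingerDist ⟨c, n⟩

/-- The functional derivative `δ/δΨ_c^*(x)` of tempered distributions. -/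
def funcDerivStarDist (c : Fin C) (x : Space D) : 𝓢'(Phase ι, ℂ) →L[ℂ] 𝓢'(Phase ι, ℂ) :=
  ∑ n, φ c n x • wirtingerStarDist ⟨c, n⟩

/-- `∏_c (δ/δΨ_c^*(x))^{j_c} (δ/δΨ_c(x))^{k_c}` acting on tempered distributions. -/
def mixedDerivDist (j k : Fin C → ℕ) (x : Space D) : 𝓢'(Phase ι, ℂ) →L[ℂ] 𝓢'(Phase ι, ℂ) :=
  (List.ofFn fun c => funcDerivStarDist φ c x ^ j c * funcDerivDist φ c x ^ k c).prod

end Distributions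

/-! ### The nonlinear loss coefficient -/

/-- The factor `Q(l,j,k,m) = (-1)^m / 2^(j+k+m) * (l!)^2 / (m! j! k! (l-k-m)! (l-j-m)!)`; it is used
for `j + m ≤ l` and `k + m ≤ l` only. -/
def lossQ (l j k m : ℕ) : ℂ :=
  (-1) ^ m / 2 ^ (j + k + m) *
    ((l.factorial : ℂ) ^ 2 / ((m.factorial : ℂ) * (j.factorial : ℂ) * (k.factorial : ℂ) *
      ((l - k - m).factorial : ℂ) * ((l - j - m).factorial : ℂ)))

/-- The nonlinear loss coefficient `L_{l,j,k}` at the point `x`, a function on phase space. -/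
def lossCoeff [∀ c, Fintype (ι c)] (φ : (c : Fin C) → ι c → Space D → ℂ)
    (l j k : Fin C → ℕ) (x : Space D) (Ψ : Phase ι) : ℂ :=
  (2 - (-1) ^ (∑ c, j c) - (-1) ^ (∑ c, k c)) *
    ∏ c, ∑ m ∈ Finset.range (l c - max (j c) (k c) + 1),
      lossQ (l c) (j c) (k c) m * restrictedDelta φ c x x ^ m *
        field φ c Ψ x ^ (l c - j c - m) * conj (field φ c Ψ x) ^ (l c - k c - m)

/-- The multi-indices `j` with `0 ≤ j_c ≤ l_c` for all `c`. -/
def indexBox (l : Fin C → ℕ) : Finset (Fin C → ℕ) :=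
  Fintype.piFinset fun c => Finset.range (l c + 1)

end BoseWigner

end

/-!
# Wigner transform of the multi-mode loss operator

Let `D_Λ` be the product of the displacement operators. Orthonormality of the mode functions turns
`D_Λ` into a tensor product over the modes, and the number-basis matrix elements of one factor are
the explicit function `dispAmp` (`IsOrthonormalModes.totalDisplacementOp_eq`; both sides are values
at `1` of entire functions with the same Taylor coefficients). These elements are bounded by one and,
for fixed occupation numbers, decay in `Λ` fast enough to be integrated, with constants polynomial in
the occupation numbers. Hence every transition operator `|m⟩⟨n|` has a bounded Wigner function
`wignerMatrix`, and the ladder relations for `D_Λ` become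
`Ψ_i W[A] = ½ W[a_i A + A a_i]`, `∂W[A]/∂α_i^* = W[a_i A - A a_i]` and their conjugates. In other
words, `W` intertwines multiplication by `a_i` and `a_i†` from the left and from the right with
`α_i ± ½ ∂/∂α_i^*` and `α_i^* ∓ ½ ∂/∂α_i`.

This is used for two spaces. Matrices with rapidly decreasing entries have smooth Wigner functions
(`wignerFun`), defined by absolutely convergent integrals. For matrices of polynomial growth, such as
those of bounded operators, the transform is defined by duality: integrating a Schwartz function
against `wignerMatrix` yields a rapidly decreasing matrix (`testMatrix_mem`, since the total
occupation number acts on test functions as a differential operator with polynomial coefficients), and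
its pairing with the given matrix is a tempered distribution (`wignerDist`).

The theorem is then algebra plus an interchange of integrals. Algebraically, the loss term at a
point `x` is a polynomial in the field operators acting from both sides (`lossTerm_eq`), so its
counterpart on phase space is the same polynomial in `Ψ_c ± ½ δ/δΨ_c^*` and `Ψ_c^* ∓ ½ δ/δΨ_c`.
Moving all derivatives to the left with the canonical commutation relations, where
`[δ/δΨ_c, Ψ_c] = δ_c(x,x)`, gives the coefficients `lossCoeff` (`IsWeylFamily.lossAction_eq`); the
powers of `δ_c(x,x)` count contractions. For the integral over `x`, the loss term is a finite sum of
coefficients depending on `x` times fixed products of ladder operators. A field operator has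
coefficients `φ_{c,n}(x)`, of modulus at most `√δ_c(x,x)`, so all coefficients of the loss term are
bounded by multiples of `∏_c δ_c(x,x)^{l_c}`, which is integrable (`IsWignerMap.integral_lossTerm`). For `l = 0`
the three terms cancel.
-/

noncomputable section

namespace BoseWigner

variable {D C : ℕ} {ι : Fin C → Type*}

/-! ### Matrix elements of the displacement operator of one mode -/

/-- The polynomial part `⟨m| exp(z a†) exp(-w a) |n⟩` of the matrix elements of a one-mode
displacement operator, with the amplitude `z` and its conjugate replaced by independent complex
variables `z` and `w`. It is defined by the recursion in `m` that `[a, D] = z D` imposes; the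
truncated `n - 1` only occurs with the factor `√n`. -/
def dispPoly (z w : ℂ) : ℕ → ℕ → ℂ
  | 0, n => (-w) ^ n / (√(n.factorial : ℝ) : ℝ)
  | m + 1, n => (z * dispPoly z w m n + (√(n : ℝ) : ℝ) * dispPoly z w m (n - 1)) / (√(m + 1 : ℝ) : ℝ)

lemma sqrt_succ_ne_zero (m : ℕ) : ((√(m + 1 : ℝ) : ℝ) : ℂ) ≠ 0 := by
  have : (0 : ℝ) < √(m + 1 : ℝ) := Real.sqrt_pos.2 (by positivity)
  exact_mod_cast this.ne'

lemma sqrt_mul_self_complex {x : ℝ} (hx : 0 ≤ x) : ((√x : ℝ) : ℂ) * (√x : ℝ) = x := by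
  rw [← Complex.ofReal_mul, Real.mul_self_sqrt hx]

lemma sqrt_factorial_succ (n : ℕ) :
    ((√((n + 1).factorial : ℝ) : ℝ) : ℂ) = (√(n + 1 : ℝ) : ℝ) * (√(n.factorial : ℝ) : ℝ) := by
  rw [← Complex.ofReal_mul, ← Real.sqrt_mul (by positivity), Nat.factorial_succ]
  push_cast
  rfl

lemma sqrt_factorial_ne_zero (n : ℕ) : ((√(n.factorial : ℝ) : ℝ) : ℂ) ≠ 0 := by
  have : (0 : ℝ) < √(n.factorial : ℝ) := Real.sqrt_pos.2 (by positivity)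
  exact_mod_cast this.ne'

lemma dispPoly_mul_left (z w : ℂ) (m n : ℕ) :
    z * dispPoly z w m n =
      (√(m + 1 : ℝ) : ℝ) * dispPoly z w (m + 1) n - (√(n : ℝ) : ℝ) * dispPoly z w m (n - 1) := by
  rw [dispPoly, mul_div_cancel₀ _ (sqrt_succ_ne_zero m)]
  ring

lemma dispPoly_lower_lower (z w : ℂ) (m n : ℕ) :
    ((√(m : ℝ) : ℝ) : ℂ) * (z * dispPoly z w (m - 1) n
      + (√(n : ℝ) : ℝ) * dispPoly z w (m - 1) (n - 1)) = m * dispPoly z w m n := by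
  rcases m with _ | m
  · simp
  · have := dispPoly_mul_left z w m n
    have hm1 := sqrt_mul_self_complex (x := (m : ℝ) + 1) (by positivity)
    simp only [Nat.add_sub_cancel]
    push_cast at hm1 ⊢
    linear_combination (√(m + 1 : ℝ) : ℝ) * this + dispPoly z w (m + 1) n * hm1

lemma dispPoly_mul_right (z w : ℂ) (m n : ℕ) :
    w * dispPoly z w m n =
      (√(m : ℝ) : ℝ) * dispPoly z w (m - 1) n - (√(n + 1 : ℝ) : ℝ) * dispPoly z w m (n + 1) := by
  induction m generalizing n with
  | zero =>
    have h1 := sqrt_succ_ne_zero n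
    have h2 := sqrt_factorial_ne_zero n
    simp only [dispPoly, sqrt_factorial_succ, Nat.cast_zero, Real.sqrt_zero, Complex.ofReal_zero]
    field_simp
    ring
  | succ m ih =>
    apply mul_left_cancel₀ (sqrt_succ_ne_zero m)
    have e1 : ((√(m + 1 : ℝ) : ℝ) : ℂ) * (w * dispPoly z w (m + 1) n)
        = z * (w * dispPoly z w m n) + (√(n : ℝ) : ℝ) * (w * dispPoly z w m (n - 1)) := by
      linear_combination (-w) * dispPoly_mul_left z w m n
    have e2 := dispPoly_mul_left z w m (n + 1)
    have hm := sqrt_mul_self_complex (x := (m : ℝ) + 1) (by positivity)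
    have hn := sqrt_mul_self_complex (x := (n : ℝ) + 1) (by positivity)
    have hm0 := sqrt_mul_self_complex (x := (m : ℝ)) (by positivity)
    have hn0 := sqrt_mul_self_complex (x := (n : ℝ)) (by positivity)
    have e3 := dispPoly_lower_lower z w m n
    have e4 : ((√(n : ℝ) : ℝ) : ℂ) * (w * dispPoly z w m (n - 1))
        = (√(n : ℝ) : ℝ) * ((√(m : ℝ) : ℝ) * dispPoly z w (m - 1) (n - 1)
          - (√(n : ℝ) : ℝ) * dispPoly z w m n) := by
      rcases n with _ | n
      · simp
      · rw [ih]
        simp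
    rw [e1, ih, e4]
    simp only [Nat.add_sub_cancel] at e2 ⊢
    push_cast at *
    linear_combination e3 - (√(n + 1 : ℝ) : ℝ) * e2 - dispPoly z w m n * hm
      + dispPoly z w m n * hn - dispPoly z w m n * hn0

section Deriv

variable {𝕜 : Type*} [NontriviallyNormedField 𝕜] [NormedAlgebra 𝕜 ℂ]
  {E : Type*} [NormedAddCommGroup E] [NormedSpace 𝕜 E]

lemma hasFDerivAt_dispPoly {z w : E → ℂ} {z' w' : E →L[𝕜] ℂ} {x : E}
    (hz : HasFDerivAt z z' x) (hw : HasFDerivAt w w' x) (m n : ℕ) :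
    HasFDerivAt (fun y => dispPoly (z y) (w y) m n)
      (((√(m : ℝ) : ℝ) * dispPoly (z x) (w x) (m - 1) n) • z'
        - ((√(n : ℝ) : ℝ) * dispPoly (z x) (w x) m (n - 1)) • w') x := by
  induction m generalizing n with
  | zero =>
    have h := (hw.neg.pow n).mul_const (((√(n.factorial : ℝ) : ℝ) : ℂ)⁻¹)
    refine (h.congr_of_eventuallyEq (.of_forall fun y => ?_)).congr_fderiv ?_
    · simp [dispPoly, div_eq_mul_inv]
    · ext v
      rcases n with _ | n
      · simp
      · have h1 := sqrt_succ_ne_zero n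
        have h2 := sqrt_factorial_ne_zero n
        have hn := sqrt_mul_self_complex (x := (n : ℝ) + 1) (by positivity)
        simp [dispPoly, sqrt_factorial_succ] at hn ⊢
        field_simp
        linear_combination (-(w' v) * (-w x) ^ n) * hn
  | succ m ih =>
    have h := ((hz.mul (ih n)).add ((ih (n - 1)).const_mul ((√(n : ℝ) : ℝ) : ℂ))).mul_const
      (((√(m + 1 : ℝ) : ℝ) : ℂ)⁻¹)
    refine (h.congr_of_eventuallyEq (.of_forall fun y => ?_)).congr_fderiv ?_
    · simp [dispPoly, div_eq_mul_inv]
    · ext v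
      have h1 := sqrt_succ_ne_zero m
      have hm := sqrt_mul_self_complex (x := (m : ℝ) + 1) (by positivity)
      have e3 := dispPoly_lower_lower (z x) (w x) m n
      have e5 := dispPoly_mul_left (z x) (w x) m (n - 1)
      simp at hm ⊢
      field_simp
      linear_combination (z' v) * e3 - (√(n : ℝ) : ℝ) * (w' v) * e5 - (z' v) * dispPoly (z x) (w x) m n * hm

end Deriv

/-- The matrix elements `⟨m| exp(z a† - w a) |n⟩` of a one-mode displacement operator. -/
def dispAmp (z w : ℂ) (m n : ℕ) : ℂ := Complex.exp (-(z * w) / 2) * dispPoly z w m n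

lemma dispAmp_mul_left (z w : ℂ) (m n : ℕ) :
    z * dispAmp z w m n =
      (√(m + 1 : ℝ) : ℝ) * dispAmp z w (m + 1) n - (√(n : ℝ) : ℝ) * dispAmp z w m (n - 1) := by
  simp only [dispAmp]
  linear_combination Complex.exp (-(z * w) / 2) * dispPoly_mul_left z w m n

lemma dispAmp_mul_right (z w : ℂ) (m n : ℕ) :
    w * dispAmp z w m n =
      (√(m : ℝ) : ℝ) * dispAmp z w (m - 1) n - (√(n + 1 : ℝ) : ℝ) * dispAmp z w m (n + 1) := by
  simp only [dispAmp]
  linear_combination Complex.exp (-(z * w) / 2) * dispPoly_mul_right z w m n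

lemma dispAmp_zero (m n : ℕ) : dispAmp 0 0 m n = if m = n then 1 else 0 := by
  have key : ∀ m n, dispPoly 0 0 m n = if m = n then 1 else 0 := by
    intro m
    induction m with
    | zero =>
      intro n
      rcases n with _ | n
      · simp [dispPoly]
      · simp [dispPoly]
    | succ m ih =>
      intro n
      rcases n with _ | n
      · simp [dispPoly]
      · have h1 := sqrt_succ_ne_zero m
        simp only [dispPoly, zero_mul, zero_add, Nat.add_sub_cancel, ih, add_left_inj]
        split_ifs with h
        · subst h
          push_cast
          field_simp
        · simp
  simp [dispAmp, key]

/-- The total derivative of the displacement amplitudes,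
`dD = (a† D + D a†) dz / 2 - (a D + D a) dw / 2`. -/
lemma hasFDerivAt_dispAmp {𝕜 : Type*} [NontriviallyNormedField 𝕜] [NormedAlgebra 𝕜 ℂ]
    {E : Type*} [NormedAddCommGroup E] [NormedSpace 𝕜 E]
    {z w : E → ℂ} {z' w' : E →L[𝕜] ℂ} {x : E}
    (hz : HasFDerivAt z z' x) (hw : HasFDerivAt w w' x) (m n : ℕ) :
    HasFDerivAt (fun y => dispAmp (z y) (w y) m n)
      (((1 / 2 : ℂ) * ((√(m : ℝ) : ℝ) * dispAmp (z x) (w x) (m - 1) n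
          + (√(n + 1 : ℝ) : ℝ) * dispAmp (z x) (w x) m (n + 1))) • z'
        - ((1 / 2 : ℂ) * ((√(m + 1 : ℝ) : ℝ) * dispAmp (z x) (w x) (m + 1) n
          + (√(n : ℝ) : ℝ) * dispAmp (z x) (w x) m (n - 1))) • w') x := by
  have hexp : HasFDerivAt (fun y => Complex.exp (-(z y * w y) / 2))
      (Complex.exp (-(z x * w x) / 2) • ((-(1 / 2) : ℂ) • (z x • w' + w x • z'))) x := by
    have h1 : HasFDerivAt (fun y => -(z y * w y) / 2)
        ((-(1 / 2) : ℂ) • (z x • w' + w x • z')) x := by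
      refine (((hz.mul hw).const_mul (-(1 / 2) : ℂ)).congr_of_eventuallyEq
        (.of_forall fun y => ?_))
      simp only [Pi.mul_apply]
      ring
    have h2 := ((Complex.hasDerivAt_exp (-(z x * w x) / 2)).hasFDerivAt.restrictScalars 𝕜).comp x h1
    refine h2.congr_fderiv ?_
    ext v
    simp
    ring
  refine (hexp.mul (hasFDerivAt_dispPoly hz hw m n)).congr_fderiv ?_
  ext v
  have e1 := dispPoly_mul_left (z x) (w x) m n
  have e2 := dispPoly_mul_right (z x) (w x) m n
  simp [dispAmp] at e1 e2 ⊢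
  linear_combination (-(1 / 2) * Complex.exp (-(z x * w x) / 2) * w' v) * e1
    - (1 / 2) * Complex.exp (-(z x * w x) / 2) * z' v * e2

/-! ### Bounds for the displacement matrix elements of one mode -/

lemma dispPoly_zero_right (z w : ℂ) (m : ℕ) :
    dispPoly z w m 0 = z ^ m / (√(m.factorial : ℝ) : ℝ) := by
  induction m with
  | zero => simp [dispPoly]
  | succ m ih =>
    have h1 := sqrt_succ_ne_zero m
    have h2 := sqrt_factorial_ne_zero m
    simp only [dispPoly, ih, sqrt_factorial_succ, Nat.cast_zero, Real.sqrt_zero,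
      Complex.ofReal_zero, zero_mul, add_zero]
    field_simp
    ring

lemma sum_normSq_dispAmp_vacuum_le (z : ℂ) (N : ℕ) :
    ∑ m ∈ Finset.range N, Complex.normSq (dispAmp z (conj z) m 0) ≤ 1 := by
  have hterm : ∀ m, Complex.normSq (dispAmp z (conj z) m 0)
      = Real.exp (-(Complex.normSq z)) * ((Complex.normSq z) ^ m / m.factorial) := by
    intro m
    have h1 : (0 : ℝ) ≤ m.factorial := by positivity
    rw [dispAmp, dispPoly_zero_right, map_mul, map_div₀, map_pow, Complex.normSq_ofReal,
      Real.mul_self_sqrt h1]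
    congr 1
    rw [Complex.normSq_eq_norm_sq, Complex.norm_exp, ← Real.exp_nat_mul, Complex.mul_conj]
    congr 1
    simp
    ring
  simp only [hterm]
  rw [← Finset.mul_sum]
  calc _ ≤ Real.exp (-(Complex.normSq z)) * Real.exp (Complex.normSq z) := by
        gcongr
        exact Real.sum_le_exp_of_nonneg (Complex.normSq_nonneg z) N
    _ = 1 := by rw [← Real.exp_add]; simp

/-- The partial column norms of the displacement operator. Commuting `D` with `a` and `a†` gives
an exact recursion in the column index `n` up to a boundary term at row `N`, which is nonpositive
as soon as `N ≥ |z|²`. -/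
lemma partial_column_norm_succ_le (z : ℂ) (N n : ℕ) (hN : Complex.normSq z ≤ N) :
    (n + 1) * ∑ m ∈ Finset.range N, Complex.normSq (dispAmp z (conj z) m (n + 1)) ≤
      n * ∑ m ∈ Finset.range N, Complex.normSq (dispAmp z (conj z) m (n - 1))
        + ∑ m ∈ Finset.range N, Complex.normSq (dispAmp z (conj z) m n) := by
  set v : ℕ → ℕ → ℂ := fun m n => dispAmp z (conj z) m n with hv
  set c : ℕ → ℝ := fun m => 2 * √(m : ℝ) * (v (m - 1) n * z * conj (v m n)).re with hc
  have hterm : ∀ m, (n + 1) * Complex.normSq (v m (n + 1)) - n * Complex.normSq (v m (n - 1))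
      = m * Complex.normSq (v (m - 1) n) - (m + 1) * Complex.normSq (v (m + 1) n)
        + (c (m + 1) - c m) := by
    intro m
    have h1 : Complex.normSq (((√(n + 1 : ℝ) : ℝ) : ℂ) * v m (n + 1))
        = Complex.normSq (((√(m : ℝ) : ℝ) : ℂ) * v (m - 1) n - conj z * v m n) := by
      congr 1
      simp only [hv]
      linear_combination dispAmp_mul_right z (conj z) m n
    have h2 : Complex.normSq (((√(n : ℝ) : ℝ) : ℂ) * v m (n - 1))
        = Complex.normSq (((√(m + 1 : ℝ) : ℝ) : ℂ) * v (m + 1) n - z * v m n) := by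
      congr 1
      simp only [hv]
      linear_combination dispAmp_mul_left z (conj z) m n
    rw [Complex.normSq_sub] at h1 h2
    have s1 := Real.mul_self_sqrt (show (0 : ℝ) ≤ n + 1 by positivity)
    have s2 := Real.mul_self_sqrt (show (0 : ℝ) ≤ n by positivity)
    have s3 := Real.mul_self_sqrt (show (0 : ℝ) ≤ m + 1 by positivity)
    have s4 := Real.mul_self_sqrt (show (0 : ℝ) ≤ m by positivity)
    simp only [map_mul, Complex.normSq_ofReal, s1, s2, s3, s4, Complex.normSq_conj] at h1 h2
    rw [h1, h2]
    simp only [hc, Nat.add_sub_cancel]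
    push_cast
    simp only [Complex.mul_re, Complex.mul_im, Complex.conj_re, Complex.conj_im,
      Complex.ofReal_re, Complex.ofReal_im, neg_neg, zero_mul, sub_zero, add_zero]
    ring
  have hsum : ∀ N : ℕ, ∑ m ∈ Finset.range N,
      ((n + 1) * Complex.normSq (v m (n + 1)) - n * Complex.normSq (v m (n - 1)))
      = ∑ m ∈ Finset.range N, Complex.normSq (v m n) - N * Complex.normSq (v N n)
        - N * Complex.normSq (v (N - 1) n) + c N := by
    intro N
    induction N with
    | zero => simp [hc]
    | succ N ih =>
      rw [Finset.sum_range_succ, ih, hterm, Finset.sum_range_succ]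
      simp only [Nat.add_sub_cancel]
      push_cast
      ring
  have hbdry : c N ≤ N * Complex.normSq (v N n) + N * Complex.normSq (v (N - 1) n) := by
    have hre : (v (N - 1) n * z * conj (v N n)).re ≤ ‖v (N - 1) n‖ * ‖z‖ * ‖v N n‖ := by
      refine (Complex.re_le_norm _).trans_eq ?_
      simp
    have hz : ‖z‖ ≤ √(N : ℝ) := by
      apply Real.le_sqrt_of_sq_le
      rwa [← Complex.normSq_eq_norm_sq]
    have hs := Real.mul_self_sqrt (show (0 : ℝ) ≤ N by positivity)
    simp only [Complex.normSq_eq_norm_sq, hc]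
    have hs0 := Real.sqrt_nonneg (N : ℝ)
    calc 2 * √(N : ℝ) * (v (N - 1) n * z * conj (v N n)).re
        ≤ 2 * √(N : ℝ) * (‖v (N - 1) n‖ * √(N : ℝ) * ‖v N n‖) := by
          gcongr
          exact hre.trans (by gcongr)
      _ = N * (2 * ‖v (N - 1) n‖ * ‖v N n‖) := by linear_combination (2 * ‖v (N - 1) n‖ * ‖v N n‖) * hs
      _ ≤ N * (‖v (N - 1) n‖ ^ 2 + ‖v N n‖ ^ 2) := by
          gcongr
          exact two_mul_le_add_sq _ _
      _ = _ := by ring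
  have := hsum N
  rw [Finset.sum_sub_distrib, ← Finset.mul_sum, ← Finset.mul_sum] at this
  linarith

/-- Matrix elements of the one-mode displacement operator are bounded by one. -/
lemma norm_dispAmp_le_one (z : ℂ) (m n : ℕ) : ‖dispAmp z (conj z) m n‖ ≤ 1 := by
  obtain ⟨N₀, hN₀⟩ := exists_nat_ge (Complex.normSq z)
  set N := max N₀ (m + 1) with hN
  have hzN : Complex.normSq z ≤ N := hN₀.trans (by exact_mod_cast le_max_left _ _)
  have key : ∀ n, ∑ m ∈ Finset.range N, Complex.normSq (dispAmp z (conj z) m n) ≤ 1 := by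
    intro n
    induction n using Nat.strong_induction_on with
    | _ n ih =>
      rcases n with _ | n
      · exact sum_normSq_dispAmp_vacuum_le z N
      · have h := partial_column_norm_succ_le z N n hzN
        have h1 := ih n (Nat.lt_succ_self n)
        have h2 := ih (n - 1) (by omega)
        have hn : (0 : ℝ) ≤ n := by positivity
        have h3 := mul_le_mul_of_nonneg_left h2 hn
        have h4 : ((n : ℝ) + 1) * ∑ m ∈ Finset.range N,
            Complex.normSq (dispAmp z (conj z) m (n + 1)) ≤ (n + 1) * 1 := by linarith
        exact le_of_mul_le_mul_left h4 (by positivity)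
  have h := (Finset.single_le_sum (f := fun m => Complex.normSq (dispAmp z (conj z) m n))
    (fun i _ => Complex.normSq_nonneg _)
    (Finset.mem_range.2 (lt_of_lt_of_le (Nat.lt_succ_self m) (le_max_right N₀ (m + 1))))).trans
    (key n)
  rw [Complex.normSq_eq_norm_sq] at h
  exact (sq_le_one_iff₀ (norm_nonneg _)).1 h

/-- Each factor of the amplitude costs one power of the occupation numbers. -/
lemma norm_pow_mul_dispAmp_le (z : ℂ) (k m n : ℕ) :
    ‖z‖ ^ k * ‖dispAmp z (conj z) m n‖ ≤ (2 * (m + n + k + 1 : ℝ)) ^ k := by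
  induction k generalizing m n with
  | zero => simpa using norm_dispAmp_le_one z m n
  | succ k ih =>
    have hs : ∀ a : ℝ, 0 ≤ a → a ≤ m + n + 1 → √a ≤ (m + n + (k + 1 : ℕ) + 1 : ℝ) := by
      intro a ha hb
      have hm : (0 : ℝ) ≤ m := by positivity
      have hn : (0 : ℝ) ≤ n := by positivity
      have hk : (0 : ℝ) ≤ k := by positivity
      rw [Real.sqrt_le_left (by positivity)]
      push_cast
      nlinarith
    have h1 := ih (m + 1) n
    have h2 := ih m (n - 1)
    have hn1 : ((n - 1 : ℕ) : ℝ) ≤ n := by exact_mod_cast Nat.sub_le n 1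
    set B : ℝ := m + n + (k + 1 : ℕ) + 1 with hB
    have hB0 : 0 ≤ B := by positivity
    calc ‖z‖ ^ (k + 1) * ‖dispAmp z (conj z) m n‖
        = ‖z‖ ^ k * ‖z * dispAmp z (conj z) m n‖ := by rw [norm_mul]; ring
      _ ≤ ‖z‖ ^ k * (√(m + 1 : ℝ) * ‖dispAmp z (conj z) (m + 1) n‖
            + √(n : ℝ) * ‖dispAmp z (conj z) m (n - 1)‖) := by
          rw [dispAmp_mul_left]
          gcongr
          refine (norm_sub_le _ _).trans_eq ?_
          simp [abs_of_nonneg (Real.sqrt_nonneg _)]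
      _ = √(m + 1 : ℝ) * (‖z‖ ^ k * ‖dispAmp z (conj z) (m + 1) n‖)
            + √(n : ℝ) * (‖z‖ ^ k * ‖dispAmp z (conj z) m (n - 1)‖) := by ring
      _ ≤ B * (2 * B) ^ k + B * (2 * B) ^ k := by
          gcongr
          · exact hs _ (by positivity) (by linarith [show (0 : ℝ) ≤ n by positivity])
          · refine h1.trans ?_
            gcongr
            rw [hB]; push_cast; linarith
          · exact hs _ (by positivity) (by linarith [show (0 : ℝ) ≤ m by positivity])
          · refine h2.trans ?_
            gcongr
            rw [hB]; push_cast; linarith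
      _ = (2 * B) ^ (k + 1) := by ring

/-! ### Wigner functions of the transition operators of one mode -/

lemma hasFDerivAt_conj (x : ℂ) :
    HasFDerivAt (fun y : ℂ => conj y) (Complex.conjCLE : ℂ →L[ℝ] ℂ) x :=
  Complex.conjCLE.toContinuousLinearMap.hasFDerivAt

lemma continuous_dispAmp (m n : ℕ) : Continuous fun z : ℂ => dispAmp z (conj z) m n :=
  continuous_iff_continuousAt.2 fun x =>
    (hasFDerivAt_dispAmp (hasFDerivAt_id (𝕜 := ℝ) x) (hasFDerivAt_conj x) m n).continuousAt

lemma norm_dispAmp_le (z : ℂ) (m n : ℕ) :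
    ‖dispAmp z (conj z) m n‖ ≤ 4096 * (m + n + 1 : ℝ) ^ 3 * (1 + ‖z‖) ^ (-3 : ℝ) := by
  have hz : 0 < 1 + ‖z‖ := by positivity
  have h0 := norm_dispAmp_le_one z m n
  have h3 := norm_pow_mul_dispAmp_le z 3 m n
  rw [Real.rpow_neg hz.le, ← div_eq_mul_inv, le_div_iff₀ (by positivity)]
  have hm : (0 : ℝ) ≤ m := by positivity
  have hn : (0 : ℝ) ≤ n := by positivity
  have h4 : (1 + ‖z‖) ^ 3 ≤ 2 ^ (3 - 1) * (1 ^ 3 + ‖z‖ ^ 3) := add_pow_le zero_le_one (norm_nonneg z) 3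
  have hS : (1 : ℝ) ≤ (m + n + 1 : ℝ) ^ 3 := one_le_pow₀ (by linarith)
  have h5 : (2 * (m + n + (3 : ℕ) + 1) : ℝ) ^ 3 ≤ (8 * (m + n + 1)) ^ 3 := by
    apply pow_le_pow_left₀ (by positivity)
    push_cast
    linarith
  norm_num at h4 ⊢
  calc ‖dispAmp z (conj z) m n‖ * (1 + ‖z‖) ^ 3
      ≤ ‖dispAmp z (conj z) m n‖ * (4 * (1 + ‖z‖ ^ 3)) := by gcongr
    _ = 4 * (‖dispAmp z (conj z) m n‖ + ‖z‖ ^ 3 * ‖dispAmp z (conj z) m n‖) := by ring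
    _ ≤ 4 * (1 + (8 * (m + n + 1)) ^ 3) := by
        gcongr
        exact h3.trans h5
    _ ≤ 4096 * (m + n + 1) ^ 3 := by nlinarith

lemma integrable_one_add_norm_complex : Integrable fun z : ℂ => (1 + ‖z‖) ^ (-3 : ℝ) :=
  integrable_one_add_norm (by rw [Complex.finrank_real_complex]; norm_num)

lemma integrable_dispAmp (m n : ℕ) : Integrable fun z : ℂ => dispAmp z (conj z) m n :=
  (integrable_one_add_norm_complex.const_mul _).mono'
    (continuous_dispAmp m n).aestronglyMeasurable (.of_forall fun z => norm_dispAmp_le z m n)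

/-- The phase factor `exp(-λ α^* + λ^* α)` of one mode. -/
def phaseFactor (z α : ℂ) : ℂ := Complex.exp (-z * conj α + conj z * α)

lemma norm_phaseFactor (z α : ℂ) : ‖phaseFactor z α‖ = 1 := by
  rw [phaseFactor, Complex.norm_exp]
  simp [mul_comm]

lemma continuous_phaseFactor : Continuous fun p : ℂ × ℂ => phaseFactor p.1 p.2 := by
  unfold phaseFactor
  fun_prop

lemma hasFDerivAt_phaseFactor_right (z α : ℂ) :
    HasFDerivAt (fun α => phaseFactor z α)
      ((phaseFactor z α * conj z) • (1 : ℂ →L[ℝ] ℂ)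
        + (-(phaseFactor z α * z)) • (Complex.conjCLE : ℂ →L[ℝ] ℂ)) α := by
  have h1 : HasFDerivAt (fun α : ℂ => -z * conj α + conj z * α)
      ((-z) • (Complex.conjCLE : ℂ →L[ℝ] ℂ) + conj z • (1 : ℂ →L[ℝ] ℂ)) α :=
    ((hasFDerivAt_conj α).const_mul (-z)).add ((hasFDerivAt_id (𝕜 := ℝ) α).const_mul (conj z))
  have h2 := ((Complex.hasDerivAt_exp (-z * conj α + conj z * α)).hasFDerivAt.restrictScalars
    ℝ).comp α h1
  refine h2.congr_fderiv ?_
  ext v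
  simp [phaseFactor]
  ring

lemma hasFDerivAt_phaseFactor_left (z α : ℂ) :
    HasFDerivAt (fun z => phaseFactor z α)
      ((-(phaseFactor z α * conj α)) • (1 : ℂ →L[ℝ] ℂ)
        + (phaseFactor z α * α) • (Complex.conjCLE : ℂ →L[ℝ] ℂ)) z := by
  have h1 : HasFDerivAt (fun z : ℂ => -z * conj α + conj z * α)
      ((-(conj α)) • (1 : ℂ →L[ℝ] ℂ) + α • (Complex.conjCLE : ℂ →L[ℝ] ℂ)) z := by
    refine (((hasFDerivAt_id (𝕜 := ℝ) z).const_mul (-conj α)).add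
      ((hasFDerivAt_conj z).const_mul α)).congr_of_eventuallyEq (.of_forall fun y => ?_)
    simp
    ring
  have h2 := ((Complex.hasDerivAt_exp (-z * conj α + conj z * α)).hasFDerivAt.restrictScalars
    ℝ).comp z h1
  refine h2.congr_fderiv ?_
  ext v
  simp [phaseFactor]
  ring

lemma integrable_phaseFactor_mul {g : ℂ → ℂ} (hg : Integrable g) (α : ℂ) :
    Integrable fun z => phaseFactor z α * g z := by
  refine hg.mono ?_ (.of_forall fun z => by simp [norm_phaseFactor])
  exact (continuous_phaseFactor.comp (by fun_prop : Continuous fun z : ℂ => (z, α))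
    |>.aestronglyMeasurable).mul hg.aestronglyMeasurable

/-- The Wigner function of the transition operator `|n⟩⟨m|` of one mode. -/
def modeWigner (α : ℂ) (m n : ℕ) : ℂ :=
  1 / (Real.pi : ℂ) ^ 2 * ∫ z : ℂ, phaseFactor z α * dispAmp z (conj z) m n

/-- The Fourier integral `∫ exp(-λ α^* + λ^* α) g(λ) d²λ / π²`, normalized as the Wigner
transform. -/
def phaseTransform (g : ℂ → ℂ) (α : ℂ) : ℂ :=
  1 / (Real.pi : ℂ) ^ 2 * ∫ z : ℂ, phaseFactor z α * g z

lemma phaseTransform_comb {g h : ℂ → ℂ} (hg : Integrable g) (hh : Integrable h) (a b α : ℂ) :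
    phaseTransform (fun z => a * g z + b * h z) α
      = a * phaseTransform g α + b * phaseTransform h α := by
  have h1 := (integrable_phaseFactor_mul hg α).const_mul a
  have h2 := (integrable_phaseFactor_mul hh α).const_mul b
  simp only [phaseTransform]
  have : (fun z => phaseFactor z α * (a * g z + b * h z))
      = fun z => a * (phaseFactor z α * g z) + b * (phaseFactor z α * h z) := by
    ext z; ring
  rw [this, integral_add h1 h2, integral_const_mul, integral_const_mul]
  ring

lemma exists_norm_modeWigner_le : ∃ K : ℝ, 0 ≤ K ∧ ∀ (α : ℂ) (m n : ℕ),
    ‖modeWigner α m n‖ ≤ K * (m + n + 1 : ℝ) ^ 3 := by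
  refine ⟨‖(1 / (Real.pi : ℂ) ^ 2)‖ * (4096 * ∫ z : ℂ, (1 + ‖z‖) ^ (-3 : ℝ)), ?_, ?_⟩
  · have : 0 ≤ ∫ z : ℂ, (1 + ‖z‖) ^ (-3 : ℝ) := integral_nonneg fun z => by positivity
    positivity
  · intro α m n
    rw [modeWigner, norm_mul, mul_assoc]
    gcongr
    calc ‖∫ z : ℂ, phaseFactor z α * dispAmp z (conj z) m n‖
        ≤ ∫ z : ℂ, 4096 * (m + n + 1 : ℝ) ^ 3 * (1 + ‖z‖) ^ (-3 : ℝ) := by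
          refine norm_integral_le_of_norm_le (integrable_one_add_norm_complex.const_mul _)
            (.of_forall fun z => ?_)
          rw [norm_mul, norm_phaseFactor, one_mul]
          exact norm_dispAmp_le z m n
      _ = _ := by rw [integral_const_mul]; ring

/-- Differentiating a one-mode Wigner function amounts to a commutator with a ladder operator. -/
lemma hasFDerivAt_modeWigner (α : ℂ) (m n : ℕ) :
    HasFDerivAt (fun α => modeWigner α m n)
      (((√(m : ℝ) : ℝ) * modeWigner α (m - 1) n
          - (√(n + 1 : ℝ) : ℝ) * modeWigner α m (n + 1)) • (1 : ℂ →L[ℝ] ℂ)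
        + ((√(n : ℝ) : ℝ) * modeWigner α m (n - 1)
          - (√(m + 1 : ℝ) : ℝ) * modeWigner α (m + 1) n) • (Complex.conjCLE : ℂ →L[ℝ] ℂ)) α := by
  set p : ℂ → ℂ := fun z => (√(m : ℝ) : ℝ) * dispAmp z (conj z) (m - 1) n
    + (-(√(n + 1 : ℝ) : ℝ)) * dispAmp z (conj z) m (n + 1) with hp
  set q : ℂ → ℂ := fun z => (√(n : ℝ) : ℝ) * dispAmp z (conj z) m (n - 1)
    + (-(√(m + 1 : ℝ) : ℝ)) * dispAmp z (conj z) (m + 1) n with hq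
  have hpi : Integrable p :=
    ((integrable_dispAmp _ _).const_mul _).add ((integrable_dispAmp _ _).const_mul _)
  have hqi : Integrable q :=
    ((integrable_dispAmp _ _).const_mul _).add ((integrable_dispAmp _ _).const_mul _)
  have hpz : ∀ z, conj z * dispAmp z (conj z) m n = p z := fun z => by
    rw [dispAmp_mul_right]; simp only [hp]; ring
  have hqz : ∀ z, -(z * dispAmp z (conj z) m n) = q z := fun z => by
    rw [dispAmp_mul_left]; simp only [hq]; ring
  have hp' := fun β : ℂ => integrable_phaseFactor_mul hpi β
  have hq' := fun β : ℂ => integrable_phaseFactor_mul hqi β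
  have key := hasFDerivAt_integral_of_dominated_of_fderiv_le (𝕜 := ℝ) (μ := (volume : Measure ℂ))
    (F := fun β z => phaseFactor z β * dispAmp z (conj z) m n)
    (F' := fun β z => (phaseFactor z β * p z) • (1 : ℂ →L[ℝ] ℂ)
      + (phaseFactor z β * q z) • (Complex.conjCLE : ℂ →L[ℝ] ℂ))
    (x₀ := α) (s := Set.univ)
    (bound := fun z => ‖p z‖ * ‖(1 : ℂ →L[ℝ] ℂ)‖ + ‖q z‖ * ‖(Complex.conjCLE : ℂ →L[ℝ] ℂ)‖)
    Filter.univ_mem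
    (.of_forall fun β => (integrable_phaseFactor_mul (integrable_dispAmp m n) β).1)
    (integrable_phaseFactor_mul (integrable_dispAmp m n) α)
    (((hp' α).smul_const _).1.add ((hq' α).smul_const _).1)
    (.of_forall fun z β _ => by
      refine (norm_add_le _ _).trans_eq ?_
      simp only [norm_smul, norm_mul, norm_phaseFactor, one_mul])
    ((hpi.norm.mul_const _).add (hqi.norm.mul_const _))
    (.of_forall fun z β _ => by
      refine ((hasFDerivAt_phaseFactor_right z β).mul_const (dispAmp z (conj z) m n)).congr_fderiv ?_
      rw [← hpz, ← hqz]
      ext v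
      simp
      ring)
  refine (key.const_mul (1 / (Real.pi : ℂ) ^ 2)).congr_fderiv ?_
  rw [integral_add ((hp' α).smul_const _) ((hq' α).smul_const _), integral_smul_const,
    integral_smul_const]
  have e1 := phaseTransform_comb (integrable_dispAmp (m - 1) n) (integrable_dispAmp m (n + 1))
    (√(m : ℝ) : ℝ) (-(√(n + 1 : ℝ) : ℝ)) α
  have e2 := phaseTransform_comb (integrable_dispAmp m (n - 1)) (integrable_dispAmp (m + 1) n)
    (√(n : ℝ) : ℝ) (-(√(m + 1 : ℝ) : ℝ)) α
  simp only [phaseTransform] at e1 e2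
  rw [smul_add, smul_smul, smul_smul, hp, hq, e1, e2]
  simp only [modeWigner, neg_mul, sub_eq_add_neg]

/-- Multiplying a one-mode Wigner function by the amplitude or its conjugate amounts to half an
anticommutator with a ladder operator; this is integration by parts over phase space. -/
lemma mul_modeWigner (α : ℂ) (m n : ℕ) :
    α * modeWigner α m n = (1 / 2 : ℂ) * ((√(m + 1 : ℝ) : ℝ) * modeWigner α (m + 1) n
        + (√(n : ℝ) : ℝ) * modeWigner α m (n - 1)) ∧
    conj α * modeWigner α m n = (1 / 2 : ℂ) * ((√(m : ℝ) : ℝ) * modeWigner α (m - 1) n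
        + (√(n + 1 : ℝ) : ℝ) * modeWigner α m (n + 1)) := by
  set P : ℂ → ℂ := fun z => (√(m : ℝ) : ℝ) * dispAmp z (conj z) (m - 1) n
    + (√(n + 1 : ℝ) : ℝ) * dispAmp z (conj z) m (n + 1) with hP
  set Q : ℂ → ℂ := fun z => (√(m + 1 : ℝ) : ℝ) * dispAmp z (conj z) (m + 1) n
    + (√(n : ℝ) : ℝ) * dispAmp z (conj z) m (n - 1) with hQ
  have hPi : Integrable P :=
    ((integrable_dispAmp _ _).const_mul _).add ((integrable_dispAmp _ _).const_mul _)
  have hQi : Integrable Q :=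
    ((integrable_dispAmp _ _).const_mul _).add ((integrable_dispAmp _ _).const_mul _)
  have hd := integrable_phaseFactor_mul (integrable_dispAmp m n) α
  have hP' := integrable_phaseFactor_mul hPi α
  have hQ' := integrable_phaseFactor_mul hQi α
  have hD : ∀ z v : ℂ, (((1 / 2 : ℂ) * P z) • (1 : ℂ →L[ℝ] ℂ)
      - ((1 / 2 : ℂ) * Q z) • (Complex.conjCLE : ℂ →L[ℝ] ℂ)) v
      = (1 / 2 : ℂ) * (v * P z - conj v * Q z) := by
    intro z v; simp; ring
  have hE : ∀ z v : ℂ, ((-(phaseFactor z α * conj α)) • (1 : ℂ →L[ℝ] ℂ)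
        + (phaseFactor z α * α) • (Complex.conjCLE : ℂ →L[ℝ] ℂ)) v
      = (conj v * α - v * conj α) * phaseFactor z α := by
    intro z v; simp; ring
  have key : ∀ v : ℂ, (1 / 2 : ℂ) * (v * phaseTransform P α - conj v * phaseTransform Q α)
      = -((conj v * α - v * conj α) * modeWigner α m n) := by
    intro v
    have h := integral_bilinear_hasFDerivAt_right_eq_neg_left_of_integrable
      (μ := (volume : Measure ℂ)) (B := ContinuousLinearMap.mul ℝ ℂ) (v := v)
      (f := fun z => phaseFactor z α) (g := fun z => dispAmp z (conj z) m n)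
      (f' := fun z => (-(phaseFactor z α * conj α)) • (1 : ℂ →L[ℝ] ℂ)
        + (phaseFactor z α * α) • (Complex.conjCLE : ℂ →L[ℝ] ℂ))
      (g' := fun z => ((1 / 2 : ℂ) * P z) • (1 : ℂ →L[ℝ] ℂ)
        - ((1 / 2 : ℂ) * Q z) • (Complex.conjCLE : ℂ →L[ℝ] ℂ))
      (by
        simp only [hE, ContinuousLinearMap.mul_apply']
        simpa only [mul_assoc] using hd.const_mul (conj v * α - v * conj α))
      (by
        simp only [hD, ContinuousLinearMap.mul_apply']
        refine ((hP'.const_mul (1 / 2 * v)).sub (hQ'.const_mul (1 / 2 * conj v))).congr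
          (.of_forall fun z => ?_)
        simp only [Pi.sub_apply]
        ring)
      hd (fun z _ => hasFDerivAt_phaseFactor_left z α)
      (fun z _ => hasFDerivAt_dispAmp (hasFDerivAt_id (𝕜 := ℝ) z) (hasFDerivAt_conj z) m n)
    simp only [hE, hD, ContinuousLinearMap.mul_apply', mul_assoc] at h
    rw [integral_const_mul] at h
    have h2 : ∫ z, phaseFactor z α * ((1 / 2 : ℂ) * (v * P z - conj v * Q z))
        = (1 / 2 : ℂ) * (v * (∫ z, phaseFactor z α * P z)
          - conj v * ∫ z, phaseFactor z α * Q z) := by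
      rw [← integral_const_mul, ← integral_const_mul,
        ← integral_sub (hP'.const_mul _) (hQ'.const_mul _), ← integral_const_mul]
      congr 1
      ext z
      ring
    rw [h2] at h
    simp only [phaseTransform, modeWigner]
    linear_combination (1 / (Real.pi : ℂ) ^ 2) * h
  have k1 := key 1
  have k2 := key Complex.I
  have eP : phaseTransform P α = (√(m : ℝ) : ℝ) * modeWigner α (m - 1) n
        + (√(n + 1 : ℝ) : ℝ) * modeWigner α m (n + 1) :=
    phaseTransform_comb (integrable_dispAmp _ _) (integrable_dispAmp _ _) _ _ α
  have eQ : phaseTransform Q α = (√(m + 1 : ℝ) : ℝ) * modeWigner α (m + 1) n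
        + (√(n : ℝ) : ℝ) * modeWigner α m (n - 1) :=
    phaseTransform_comb (integrable_dispAmp _ _) (integrable_dispAmp _ _) _ _ α
  rw [← eP, ← eQ]
  have hI := Complex.I_mul_I
  simp only [map_one, Complex.conj_I, one_mul] at k1 k2
  -- the directions `1` and `I` together determine both Wirtinger derivatives
  constructor
  · linear_combination (1 / 2 : ℂ) * k1 + (Complex.I / 2) * k2
      + (α * modeWigner α m n / 2 + conj α * modeWigner α m n / 2 - phaseTransform P α / 4
        - phaseTransform Q α / 4) * hI
  · linear_combination (-1 / 2 : ℂ) * k1 + (Complex.I / 2) * k2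
      + (α * modeWigner α m n / 2 + conj α * modeWigner α m n / 2 - phaseTransform P α / 4
        - phaseTransform Q α / 4) * hI

/-! ### Ladder operators acting on matrices -/

section Ladder

open Classical in
/-- Multiplication by the annihilation operator `a_i` from the left. -/
def leftAnnihil (i : Mode ι) : Module.End ℂ (FockMatrix ι) where
  toFun B m n := (√(m i + 1 : ℝ) : ℝ) * B (m + Pi.single i 1) n
  map_add' A B := by ext m n; exact mul_add _ _ _
  map_smul' c B := by ext m n; exact mul_left_comm _ _ _

open Classical in
/-- Multiplication by the creation operator `a_i†` from the left. -/
def leftCreate (i : Mode ι) : Module.End ℂ (FockMatrix ι) where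
  toFun B m n := (√(m i : ℝ) : ℝ) * B (m - Pi.single i 1) n
  map_add' A B := by ext m n; exact mul_add _ _ _
  map_smul' c B := by ext m n; exact mul_left_comm _ _ _

open Classical in
/-- Multiplication by the annihilation operator `a_i` from the right. -/
def rightAnnihil (i : Mode ι) : Module.End ℂ (FockMatrix ι) where
  toFun B m n := (√(n i : ℝ) : ℝ) * B m (n - Pi.single i 1)
  map_add' A B := by ext m n; exact mul_add _ _ _
  map_smul' c B := by ext m n; exact mul_left_comm _ _ _

open Classical in
/-- Multiplication by the creation operator `a_i†` from the right. -/
def rightCreate (i : Mode ι) : Module.End ℂ (FockMatrix ι) where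
  toFun B m n := (√(n i + 1 : ℝ) : ℝ) * B m (n + Pi.single i 1)
  map_add' A B := by ext m n; exact mul_add _ _ _
  map_smul' c B := by ext m n; exact mul_left_comm _ _ _

open Classical in
lemma leftAnnihil_apply (i : Mode ι) (B : FockMatrix ι) (m n : Occ ι) :
    leftAnnihil i B m n = (√(m i + 1 : ℝ) : ℝ) * B (m + Pi.single i 1) n := rfl

open Classical in
lemma leftCreate_apply (i : Mode ι) (B : FockMatrix ι) (m n : Occ ι) :
    leftCreate i B m n = (√(m i : ℝ) : ℝ) * B (m - Pi.single i 1) n := rfl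

open Classical in
lemma rightAnnihil_apply (i : Mode ι) (B : FockMatrix ι) (m n : Occ ι) :
    rightAnnihil i B m n = (√(n i : ℝ) : ℝ) * B m (n - Pi.single i 1) := rfl

open Classical in
lemma rightCreate_apply (i : Mode ι) (B : FockMatrix ι) (m n : Occ ι) :
    rightCreate i B m n = (√(n i + 1 : ℝ) : ℝ) * B m (n + Pi.single i 1) := rfl

/-- The trace of a product of two matrices, as a double sum. -/
def pairing (A B : FockMatrix ι) : ℂ := ∑' p : Occ ι × Occ ι, A p.1 p.2 * B p.2 p.1

lemma pairing_comm (A B : FockMatrix ι) : pairing A B = pairing B A := by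
  rw [pairing, pairing, ← (Equiv.prodComm (Occ ι) (Occ ι)).tsum_eq]
  simp [mul_comm]

open Classical in
/-- A sum over occupation numbers whose terms vanish for `m_i = 0` may be shifted. -/
lemma tsum_shift (i : Mode ι) (F : Occ ι × Occ ι → ℂ) (hF : ∀ m n : Occ ι, m i = 0 → F (m, n) = 0) :
    ∑' p : Occ ι × Occ ι, F (p.1 + Pi.single i 1, p.2) = ∑' p, F p := by
  refine Function.Injective.tsum_eq (g := fun p : Occ ι × Occ ι => (p.1 + Pi.single i 1, p.2))
    (f := F) ?_ ?_
  · rintro ⟨a, b⟩ ⟨c, d⟩ h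
    simp only [Prod.mk.injEq, add_left_inj] at h
    exact Prod.ext h.1 h.2
  · rintro ⟨m, n⟩ h
    have hi : m i ≠ 0 := fun h0 => h (hF m n h0)
    refine ⟨(m - Pi.single i 1, n), Prod.ext ?_ rfl⟩
    funext j
    rcases eq_or_ne j i with rfl | hj
    · simp; omega
    · simp [hj]

lemma pairing_leftAnnihil (i : Mode ι) (A B : FockMatrix ι) :
    pairing (leftAnnihil i A) B = pairing A (rightAnnihil i B) := by
  classical
  rw [pairing, pairing, ← tsum_shift i (fun p => A p.1 p.2 * rightAnnihil i B p.2 p.1)]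
  · refine tsum_congr fun p => ?_
    simp [leftAnnihil_apply, rightAnnihil_apply]
    ring
  · intro m n h
    simp [rightAnnihil_apply, h]

lemma pairing_leftCreate (i : Mode ι) (A B : FockMatrix ι) :
    pairing (leftCreate i A) B = pairing A (rightCreate i B) := by
  classical
  rw [pairing, pairing, ← tsum_shift i (fun p => leftCreate i A p.1 p.2 * B p.2 p.1)]
  · refine tsum_congr fun p => ?_
    simp [leftCreate_apply, rightCreate_apply]
    ring
  · intro m n h
    simp [leftCreate_apply, h]

lemma pairing_rightAnnihil (i : Mode ι) (A B : FockMatrix ι) :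
    pairing (rightAnnihil i A) B = pairing A (leftAnnihil i B) := by
  rw [pairing_comm, ← pairing_leftAnnihil, pairing_comm]

lemma pairing_rightCreate (i : Mode ι) (A B : FockMatrix ι) :
    pairing (rightCreate i A) B = pairing A (leftCreate i B) := by
  rw [pairing_comm, ← pairing_leftCreate, pairing_comm]

/-- The real-linear form `α ↦ α_i` on phase space. -/
def coordCLM (i : Mode ι) : Phase ι →L[ℝ] ℂ := ContinuousLinearMap.proj i

/-- The real-linear form `α ↦ α_i^*` on phase space. -/
def conjCoordCLM (i : Mode ι) : Phase ι →L[ℝ] ℂ :=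
  (Complex.conjCLE : ℂ →L[ℝ] ℂ).comp (ContinuousLinearMap.proj i)

@[simp] lemma coordCLM_apply (i : Mode ι) (v : Phase ι) : coordCLM i v = v i := rfl

@[simp] lemma conjCoordCLM_apply (i : Mode ι) (v : Phase ι) : conjCoordCLM i v = conj (v i) := rfl

end Ladder

/-! ### Tensor products of one-mode matrices -/

section Tensor

variable [∀ c, Fintype (ι c)]

/-- The tensor product of one-mode matrices. -/
def tensorMatrix (G : Mode ι → ℕ → ℕ → ℂ) : FockMatrix ι := fun m n => ∏ i, G i (m i) (n i)

open Classical in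
lemma tensorMatrix_eq (G : Mode ι → ℕ → ℕ → ℂ) (i : Mode ι) (m n : Occ ι) :
    tensorMatrix G m n = G i (m i) (n i) * ∏ j ∈ Finset.univ.erase i, G j (m j) (n j) :=
  (Finset.mul_prod_erase _ _ (Finset.mem_univ i)).symm

open Classical in
lemma tensorMatrix_update (G : Mode ι → ℕ → ℕ → ℂ) (i : Mode ι) {m n m' n' : Occ ι}
    (hm : ∀ j ≠ i, m' j = m j) (hn : ∀ j ≠ i, n' j = n j) :
    tensorMatrix G m' n' = G i (m' i) (n' i) * ∏ j ∈ Finset.univ.erase i, G j (m j) (n j) := by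
  rw [tensorMatrix_eq G i]
  congr 1
  exact Finset.prod_congr rfl fun j hj => by
    rw [hm j (Finset.ne_of_mem_erase hj), hn j (Finset.ne_of_mem_erase hj)]

open Classical in
lemma leftAnnihil_tensorMatrix (G : Mode ι → ℕ → ℕ → ℂ) (i : Mode ι) (m n : Occ ι) :
    leftAnnihil i (tensorMatrix G) m n = ((√(m i + 1 : ℝ) : ℝ) * G i (m i + 1) (n i))
      * ∏ j ∈ Finset.univ.erase i, G j (m j) (n j) := by
  rw [leftAnnihil_apply, tensorMatrix_update G i (m := m) (n := n)
    (fun j hj => by simp [hj]) (fun _ _ => rfl)]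
  simp [mul_assoc]

open Classical in
lemma leftCreate_tensorMatrix (G : Mode ι → ℕ → ℕ → ℂ) (i : Mode ι) (m n : Occ ι) :
    leftCreate i (tensorMatrix G) m n = ((√(m i : ℝ) : ℝ) * G i (m i - 1) (n i))
      * ∏ j ∈ Finset.univ.erase i, G j (m j) (n j) := by
  rw [leftCreate_apply, tensorMatrix_update G i (m := m) (n := n)
    (fun j hj => by simp [hj]) (fun _ _ => rfl)]
  simp [mul_assoc]

open Classical in
lemma rightAnnihil_tensorMatrix (G : Mode ι → ℕ → ℕ → ℂ) (i : Mode ι) (m n : Occ ι) :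
    rightAnnihil i (tensorMatrix G) m n = ((√(n i : ℝ) : ℝ) * G i (m i) (n i - 1))
      * ∏ j ∈ Finset.univ.erase i, G j (m j) (n j) := by
  rw [rightAnnihil_apply, tensorMatrix_update G i (m := m) (n := n)
    (fun _ _ => rfl) (fun j hj => by simp [hj])]
  simp [mul_assoc]

open Classical in
lemma rightCreate_tensorMatrix (G : Mode ι → ℕ → ℕ → ℂ) (i : Mode ι) (m n : Occ ι) :
    rightCreate i (tensorMatrix G) m n = ((√(n i + 1 : ℝ) : ℝ) * G i (m i) (n i + 1))
      * ∏ j ∈ Finset.univ.erase i, G j (m j) (n j) := by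
  rw [rightCreate_apply, tensorMatrix_update G i (m := m) (n := n)
    (fun _ _ => rfl) (fun j hj => by simp [hj])]
  simp [mul_assoc]

/-- Matrix elements of the displacement operator of all modes. -/
def dispMatrix (Λ : Phase ι) : FockMatrix ι :=
  tensorMatrix fun i => dispAmp (Λ i) (conj (Λ i))

/-- The matrix of Wigner functions: its entry `(m, n)` at `Ψ` is the Wigner transform of the
transition operator `|n⟩⟨m|`, so that `pairing A (wignerMatrix Ψ)` is the Wigner transform of
`A` at `Ψ`. -/
def wignerMatrix (Ψ : Phase ι) : FockMatrix ι := tensorMatrix fun i => modeWigner (Ψ i)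

lemma coord_mul_wignerMatrix (Ψ : Phase ι) (i : Mode ι) :
    Ψ i • wignerMatrix Ψ
      = (1 / 2 : ℂ) • (leftAnnihil i (wignerMatrix Ψ) + rightAnnihil i (wignerMatrix Ψ)) := by
  classical
  ext m n
  simp only [Matrix.smul_apply, Matrix.add_apply, smul_eq_mul, wignerMatrix,
    leftAnnihil_tensorMatrix, rightAnnihil_tensorMatrix, tensorMatrix_eq _ i]
  linear_combination (∏ j ∈ Finset.univ.erase i, modeWigner (Ψ j) (m j) (n j))
    * (mul_modeWigner (Ψ i) (m i) (n i)).1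

lemma conj_coord_mul_wignerMatrix (Ψ : Phase ι) (i : Mode ι) :
    conj (Ψ i) • wignerMatrix Ψ
      = (1 / 2 : ℂ) • (leftCreate i (wignerMatrix Ψ) + rightCreate i (wignerMatrix Ψ)) := by
  classical
  ext m n
  simp only [Matrix.smul_apply, Matrix.add_apply, smul_eq_mul, wignerMatrix,
    leftCreate_tensorMatrix, rightCreate_tensorMatrix, tensorMatrix_eq _ i]
  linear_combination (∏ j ∈ Finset.univ.erase i, modeWigner (Ψ j) (m j) (n j))
    * (mul_modeWigner (Ψ i) (m i) (n i)).2

lemma hasFDerivAt_wignerMatrix (Ψ : Phase ι) (m n : Occ ι) :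
    HasFDerivAt (fun Ψ => wignerMatrix Ψ m n)
      (∑ i, ((leftCreate i (wignerMatrix Ψ) m n - rightCreate i (wignerMatrix Ψ) m n) • coordCLM i
        + (rightAnnihil i (wignerMatrix Ψ) m n - leftAnnihil i (wignerMatrix Ψ) m n)
          • conjCoordCLM i)) Ψ := by
  classical
  have hi : ∀ i, HasFDerivAt (fun Ψ : Phase ι => modeWigner (Ψ i) (m i) (n i)) _ Ψ := fun i =>
    HasFDerivAt.comp (g := fun α => modeWigner α (m i) (n i)) Ψ
      (hasFDerivAt_modeWigner (Ψ i) (m i) (n i)) (coordCLM i).hasFDerivAt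
  have h := HasFDerivAt.finsetProd (u := Finset.univ) (x := Ψ)
    (g := fun i (Ψ : Phase ι) => modeWigner (Ψ i) (m i) (n i))
    (fun i _ => hi i)
  refine (h.congr_of_eventuallyEq (.of_forall fun y => ?_)).congr_fderiv ?_
  · simp [wignerMatrix, tensorMatrix]
  · refine Finset.sum_congr rfl fun i _ => ?_
    ext v
    simp only [wignerMatrix, leftCreate_tensorMatrix, rightCreate_tensorMatrix,
      rightAnnihil_tensorMatrix, leftAnnihil_tensorMatrix]
    simp
    ring

end Tensor

/-! ### Overlap integrals of restricted functions -/

section Overlap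

lemma IsOrthonormalModes.integrable_mul {region : Set (Space D)}
    {φ : (c : Fin C) → ι c → Space D → ℂ} (hφ : IsOrthonormalModes region φ) (c : Fin C)
    (n n' : ι c) : IntegrableOn (fun x => conj (φ c n x) * φ c n' x) region :=
  MemLp.integrable_mul (p := 2) (q := 2) (hφ.1 c n).star (hφ.1 c n')

variable [∀ c, Fintype (ι c)] {region : Set (Space D)} {φ : (c : Fin C) → ι c → Space D → ℂ}

lemma IsOrthonormalModes.integrable_conj_mul_field (hφ : IsOrthonormalModes region φ) (c : Fin C)
    (n : ι c) (α : Phase ι) :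
    IntegrableOn (fun x => conj (φ c n x) * field φ c α x) region := by
  simp only [field, Finset.mul_sum, ← mul_assoc]
  exact integrable_finsetSum _ fun n' _ => (hφ.integrable_mul c n n').mul_const _

/-- The amplitude of a restricted function is its overlap with the mode function. -/
lemma IsOrthonormalModes.integral_conj_mul_field (hφ : IsOrthonormalModes region φ) (c : Fin C)
    (n : ι c) (α : Phase ι) :
    ∫ x in region, conj (φ c n x) * field φ c α x = α ⟨c, n⟩ := by
  classical
  simp only [field, Finset.mul_sum, ← mul_assoc]
  rw [integral_finsetSum _ fun n' _ => (hφ.integrable_mul c n n').mul_const _]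
  simp only [integral_mul_const]
  rw [Finset.sum_eq_single n, hφ.2.1, one_mul]
  · intro n' _ h
    rw [hφ.2.2 c n n' h.symm, zero_mul]
  · simp

lemma IsOrthonormalModes.integrable_mul_conj_field (hφ : IsOrthonormalModes region φ) (c : Fin C)
    (n : ι c) (α : Phase ι) :
    IntegrableOn (fun x => φ c n x * conj (field φ c α x)) region := by
  have h : ∀ x, φ c n x * conj (field φ c α x)
      = ∑ n', conj (φ c n' x) * φ c n x * conj (α ⟨c, n'⟩) := fun x => by
    rw [field, map_sum, Finset.mul_sum]
    exact Finset.sum_congr rfl fun n' _ => by rw [map_mul]; ring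
  simp only [h]
  exact integrable_finsetSum _ fun n' _ => (hφ.integrable_mul c n' n).mul_const _

lemma IsOrthonormalModes.integral_mul_conj_field (hφ : IsOrthonormalModes region φ) (c : Fin C)
    (n : ι c) (α : Phase ι) :
    ∫ x in region, φ c n x * conj (field φ c α x) = conj (α ⟨c, n⟩) := by
  rw [← hφ.integral_conj_mul_field c n α, ← integral_conj]
  simp [mul_comm]

lemma IsOrthonormalModes.displacementFunctional_eq (hφ : IsOrthonormalModes region φ)
    (Λ Ψ : Phase ι) :
    displacementFunctional φ region Λ Ψ = ∏ i, phaseFactor (Λ i) (Ψ i) := by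
  rw [Fintype.prod_sigma, displacementFunctional]
  refine Finset.prod_congr rfl fun c _ => ?_
  simp only [phaseFactor]
  rw [← Complex.exp_sum]
  congr 1
  have e : ∀ x, -(field φ c Λ x) * conj (field φ c Ψ x) + conj (field φ c Λ x) * field φ c Ψ x
      = ∑ n, ((-conj (Ψ ⟨c, n⟩)) * (conj (φ c n x) * field φ c Λ x)
        + Ψ ⟨c, n⟩ * (φ c n x * conj (field φ c Λ x))) := by
    intro x
    rw [Finset.sum_add_distrib, field.eq_1 φ c Ψ, map_sum, Finset.mul_sum, Finset.mul_sum]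
    congr 1
    · exact Finset.sum_congr rfl fun n _ => by rw [map_mul]; ring
    · exact Finset.sum_congr rfl fun n _ => by ring
  simp only [e]
  rw [integral_finsetSum]
  · refine Finset.sum_congr rfl fun n _ => ?_
    rw [integral_add ((hφ.integrable_conj_mul_field c n Λ).const_mul _)
      ((hφ.integrable_mul_conj_field c n Λ).const_mul _), integral_const_mul,
      integral_const_mul, hφ.integral_conj_mul_field, hφ.integral_mul_conj_field]
    ring
  · exact fun n _ => ((hφ.integrable_conj_mul_field c n Λ).const_mul _).add
      ((hφ.integrable_mul_conj_field c n Λ).const_mul _)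

end Overlap

/-! ### Products with row-finite matrices -/

/-- Matrices with finitely many nonzero entries in each row. -/
def RowFinite (A : FockMatrix ι) : Prop := ∀ m, (Function.support (A m)).Finite

lemma RowFinite.summable_mul {A : FockMatrix ι} (hA : RowFinite A) (B : FockMatrix ι)
    (m n : Occ ι) : Summable fun k => A m k * B k n :=
  summable_of_hasFiniteSupport ((hA m).subset fun k hk h => hk (by simp [h]))

lemma RowFinite.smul {A : FockMatrix ι} (hA : RowFinite A) (c : ℂ) : RowFinite (c • A) := fun m =>
  (hA m).subset fun k hk h => hk (by simp [h])

lemma RowFinite.add {A B : FockMatrix ι} (hA : RowFinite A) (hB : RowFinite B) :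
    RowFinite (A + B) := fun m =>
  ((hA m).union (hB m)).subset fun k hk => by
    by_contra h
    simp only [Set.mem_union, Function.mem_support, not_or, not_not] at h
    exact hk (by simp [h.1, h.2])

lemma opMul_smul_left (c : ℂ) (A B : FockMatrix ι) : opMul (c • A) B = c • opMul A B := by
  ext m n
  simp only [opMul, Matrix.smul_apply, smul_eq_mul, mul_assoc, tsum_mul_left]

lemma RowFinite.opMul_sum {α : Type*} {s : Finset α} {A : α → FockMatrix ι}
    (hA : ∀ a ∈ s, RowFinite (A a)) (B : FockMatrix ι) :
    opMul (∑ a ∈ s, A a) B = ∑ a ∈ s, opMul (A a) B := by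
  ext m n
  simp only [opMul, Matrix.sum_apply, Finset.sum_mul]
  exact Summable.tsum_finsetSum fun a ha => (hA a ha).summable_mul B m n

lemma RowFinite.opMul_add_left {A A' : FockMatrix ι} (hA : RowFinite A) (hA' : RowFinite A')
    (B : FockMatrix ι) : opMul (A + A') B = opMul A B + opMul A' B := by
  ext m n
  simp only [opMul, Matrix.add_apply, add_mul]
  exact (hA.summable_mul B m n).tsum_add (hA'.summable_mul B m n)

lemma rowFinite_annihilation (i : Mode ι) : RowFinite (annihilation i) := by
  classical
  intro m
  refine (Set.finite_singleton (m + Pi.single i 1)).subset fun k hk => ?_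
  by_contra h
  exact hk (by simp only [annihilation]; rw [if_neg]; exact fun h' => h h')

lemma rowFinite_annihilation_conjTranspose (i : Mode ι) : RowFinite (annihilation i)ᴴ := by
  classical
  intro m
  refine (Set.finite_singleton (m - Pi.single i 1)).subset fun k hk => ?_
  by_contra h
  refine hk ?_
  simp only [annihilation, Matrix.conjTranspose_apply]
  rw [if_neg, star_zero]
  rintro rfl
  exact h (by simp)

lemma opMul_annihilation (i : Mode ι) (B : FockMatrix ι) :
    opMul (annihilation i) B = leftAnnihil i B := by
  classical
  ext m n
  rw [opMul, tsum_eq_single (m + Pi.single i 1)]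
  · simp [annihilation, leftAnnihil_apply]
  · intro k hk
    simp only [annihilation]
    rw [if_neg (by convert hk), zero_mul]

lemma opMul_annihilation_conjTranspose (i : Mode ι) (B : FockMatrix ι) :
    opMul (annihilation i)ᴴ B = leftCreate i B := by
  classical
  ext m n
  rw [opMul, tsum_eq_single (m - Pi.single i 1)]
  · rw [leftCreate_apply]
    by_cases hm : m i = 0
    · simp [annihilation, hm]
    · have : m = m - Pi.single i 1 + Pi.single i 1 := by
        funext j
        rcases eq_or_ne j i with rfl | hj
        · simp; omega
        · simp [hj]
      simp only [annihilation, Matrix.conjTranspose_apply]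
      rw [if_pos (by convert this)]
      simp
  · intro k hk
    simp only [annihilation, Matrix.conjTranspose_apply]
    rw [if_neg, star_zero, zero_mul]
    rintro rfl
    exact hk (by simp)

/-! ### The displacement operators -/

section Displacement

variable [∀ c, Fintype (ι c)]

/-- The exponent `∑ (Z_i a_i† - Z_i^* a_i)` of a displacement operator. -/
def dispGenerator (Z : Phase ι) : FockMatrix ι :=
  ∑ i, (Z i • (annihilation i)ᴴ + (-conj (Z i)) • annihilation i)

/-- Left multiplication by `dispGenerator`. -/
def dispGeneratorEnd (Z : Phase ι) : Module.End ℂ (FockMatrix ι) :=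
  ∑ i, (Z i • leftCreate i + (-conj (Z i)) • leftAnnihil i)

lemma opMul_dispGenerator (Z : Phase ι) (B : FockMatrix ι) :
    opMul (dispGenerator Z) B = dispGeneratorEnd Z B := by
  have h1 := fun i : Mode ι => (rowFinite_annihilation_conjTranspose i).smul (Z i)
  have h2 := fun i : Mode ι => (rowFinite_annihilation i).smul (-conj (Z i))
  rw [dispGenerator, RowFinite.opMul_sum fun i _ => (h1 i).add (h2 i), dispGeneratorEnd,
    LinearMap.sum_apply]
  refine Finset.sum_congr rfl fun i _ => ?_
  rw [(h1 i).opMul_add_left (h2 i), opMul_smul_left, opMul_smul_left, opMul_annihilation,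
    opMul_annihilation_conjTranspose]
  rfl

lemma opPow_dispGenerator (Z : Phase ι) (k : ℕ) :
    opPow (dispGenerator Z) k = (dispGeneratorEnd Z ^ k) (opProd []) := by
  induction k with
  | zero => rfl
  | succ k ih =>
    rw [pow_succ', Module.End.mul_apply, ← ih, ← opMul_dispGenerator]
    simp [opPow, opProd, List.replicate_succ]

/-- The displacement matrix along the complex line through `Z`; the amplitude and its conjugate
are scaled by the same complex parameter, which makes the entries entire functions of it. -/
def dispLine (Z : Phase ι) (t : ℂ) : FockMatrix ι :=
  tensorMatrix fun i => dispAmp (t * Z i) (t * conj (Z i))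

lemma hasDerivAt_dispLine (Z : Phase ι) (t : ℂ) (m n : Occ ι) :
    HasDerivAt (fun t => dispLine Z t m n) (dispGeneratorEnd Z (dispLine Z t) m n) t := by
  classical
  have hz : ∀ a : ℂ, HasFDerivAt (fun s : ℂ => s * a) (a • (1 : ℂ →L[ℂ] ℂ)) t := fun a => by
    refine ((hasFDerivAt_id (𝕜 := ℂ) t).mul_const a).congr_fderiv ?_
    ext; simp
  have hi : ∀ i, HasFDerivAt (fun s : ℂ => dispAmp (s * Z i) (s * conj (Z i)) (m i) (n i)) _ t :=
    fun i => hasFDerivAt_dispAmp (hz (Z i)) (hz (conj (Z i))) (m i) (n i)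
  have h := HasFDerivAt.finsetProd (u := Finset.univ) (x := t) (fun i _ => hi i)
  refine ((h.congr_of_eventuallyEq (.of_forall fun y => ?_)).hasDerivAt).congr_deriv ?_
  · simp [dispLine, tensorMatrix]
  · simp only [dispGeneratorEnd, LinearMap.sum_apply, Matrix.sum_apply,
      _root_.sum_apply, dispLine]
    refine Finset.sum_congr rfl fun i _ => ?_
    have e1 := dispAmp_mul_left (t * Z i) (t * conj (Z i)) (m i) (n i)
    have e2 := dispAmp_mul_right (t * Z i) (t * conj (Z i)) (m i) (n i)
    simp only [LinearMap.add_apply, LinearMap.smul_apply, Matrix.add_apply, Matrix.smul_apply,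
      leftCreate_tensorMatrix, leftAnnihil_tensorMatrix]
    simp
    linear_combination (∏ j ∈ Finset.univ.erase i, dispAmp (t * Z j) (t * conj (Z j)) (m j) (n j))
      * ((1 / 2) * Z i * e2 - (1 / 2) * conj (Z i) * e1)

lemma HasDerivAt.dispGeneratorEnd (Z : Phase ι) {B : ℂ → FockMatrix ι} {B' : FockMatrix ι} {t : ℂ}
    (hB : ∀ m n, HasDerivAt (fun t => B t m n) (B' m n) t) (m n : Occ ι) :
    HasDerivAt (fun t => dispGeneratorEnd Z (B t) m n) (dispGeneratorEnd Z B' m n) t := by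
  simp only [BoseWigner.dispGeneratorEnd, LinearMap.sum_apply, Matrix.sum_apply,
    LinearMap.add_apply, LinearMap.smul_apply, Matrix.add_apply, Matrix.smul_apply,
    leftCreate_apply, leftAnnihil_apply, smul_eq_mul]
  exact HasDerivAt.fun_sum fun i _ => (((hB _ _).const_mul _).const_mul _).add
    (((hB _ _).const_mul _).const_mul _)

lemma hasDerivAt_pow_dispGeneratorEnd (Z : Phase ι) (k : ℕ) (t : ℂ) (m n : Occ ι) :
    HasDerivAt (fun t => (dispGeneratorEnd Z ^ k) (dispLine Z t) m n)
      ((dispGeneratorEnd Z ^ (k + 1)) (dispLine Z t) m n) t := by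
  induction k generalizing m n with
  | zero => simpa using hasDerivAt_dispLine Z t m n
  | succ k ih =>
    simpa only [← Module.End.mul_apply, ← pow_succ'] using HasDerivAt.dispGeneratorEnd Z ih m n

lemma dispMatrix_zero : dispMatrix (0 : Phase ι) = opProd [] := by
  ext m n
  rw [opProd, List.foldr_nil]
  simp only [dispMatrix, tensorMatrix, Pi.zero_apply, map_zero, dispAmp_zero, Matrix.one_apply]
  rw [Finset.prod_ite_zero]
  simp [funext_iff]

/-- The matrix exponential of the generator is the product of the one-mode displacements: both
are values at `t = 1` of entire functions of `t` with the same Taylor coefficients. -/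
lemma opExp_dispGenerator (Z : Phase ι) : opExp (dispGenerator Z) = dispMatrix Z := by
  classical
  ext m n
  have hdiff : Differentiable ℂ fun t => dispLine Z t m n := fun t =>
    (hasDerivAt_dispLine Z t m n).differentiableAt
  have hiter : ∀ k, iteratedDeriv k (fun t => dispLine Z t m n)
      = fun t => (dispGeneratorEnd Z ^ k) (dispLine Z t) m n := by
    intro k
    induction k with
    | zero => simp
    | succ k ih =>
      rw [iteratedDeriv_succ, ih]
      ext t
      exact (hasDerivAt_pow_dispGeneratorEnd Z k t m n).deriv
  have h0 : dispLine Z 0 = opProd [] := by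
    rw [← dispMatrix_zero]
    simp [dispLine, dispMatrix]
  have h1 : dispLine Z 1 = dispMatrix Z := by simp [dispLine, dispMatrix]
  have := Complex.taylorSeries_eq_of_entire' 0 1 hdiff
  rw [← h1, ← this, opExp]
  refine tsum_congr fun k => ?_
  rw [opPow_dispGenerator, hiter]
  simp only [h0, sub_zero, one_pow, mul_one]

lemma IsOrthonormalModes.opIntegral_generator {region : Set (Space D)}
    {φ : (c : Fin C) → ι c → Space D → ℂ} (hφ : IsOrthonormalModes region φ) (c : Fin C)
    (Λ : Phase ι) :
    (opIntegral region fun x =>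
      field φ c Λ x • (fieldOp φ c x)ᴴ - conj (field φ c Λ x) • fieldOp φ c x)
      = dispGenerator fun i => if i.1 = c then Λ i else 0 := by
  classical
  ext m n
  have e : ∀ x, (field φ c Λ x • (fieldOp φ c x)ᴴ - conj (field φ c Λ x) • fieldOp φ c x) m n
      = ∑ a, ((conj (φ c a x) * field φ c Λ x) * (annihilation ⟨c, a⟩)ᴴ m n
        - (φ c a x * conj (field φ c Λ x)) * annihilation ⟨c, a⟩ m n) := by
    intro x
    rw [Finset.sum_sub_distrib]
    simp only [fieldOp, Matrix.sub_apply, Matrix.smul_apply, Matrix.conjTranspose_apply,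
      Matrix.sum_apply, smul_eq_mul, star_sum, star_mul', RCLike.star_def, Finset.mul_sum]
    congr 1 <;> exact Finset.sum_congr rfl fun n _ => by ring
  simp only [opIntegral, e]
  rw [integral_finsetSum _ (fun a _ => Integrable.sub' ((hφ.integrable_conj_mul_field c a Λ).mul_const _)
      ((hφ.integrable_mul_conj_field c a Λ).mul_const _)), dispGenerator, Matrix.sum_apply,
    Fintype.sum_sigma, Finset.sum_eq_single c]
  · refine Finset.sum_congr rfl fun a _ => ?_
    rw [integral_sub ((hφ.integrable_conj_mul_field c a Λ).mul_const _)
      ((hφ.integrable_mul_conj_field c a Λ).mul_const _), integral_mul_const, integral_mul_const,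
      hφ.integral_conj_mul_field, hφ.integral_mul_conj_field]
    simp [sub_eq_add_neg]
  · intro b _ hb
    simp [hb]
  · simp

lemma dispAmp_zero_ne {m n : ℕ} (h : m ≠ n) : dispAmp 0 0 m n = 0 := by
  rw [dispAmp_zero, if_neg h]

/-- Displacement operators of disjoint sets of modes act on different tensor factors. -/
lemma opMul_dispMatrix_of_disjoint {Z Z' : Phase ι} (h : ∀ i, Z i = 0 ∨ Z' i = 0) :
    opMul (dispMatrix Z) (dispMatrix Z') = dispMatrix (Z + Z') := by
  classical
  ext m n
  -- only one intermediate state contributes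
  rw [opMul, tsum_eq_single fun i => if Z i = 0 then m i else n i]
  · simp only [dispMatrix, tensorMatrix]
    rw [← Finset.prod_mul_distrib]
    refine Finset.prod_congr rfl fun i _ => ?_
    by_cases hi : Z i = 0
    · simp [hi, dispAmp_zero]
    · simp [hi, (h i).resolve_left hi, dispAmp_zero]
  · intro k hk
    obtain ⟨i, hi⟩ := Function.ne_iff.1 hk
    by_cases hZ : Z i = 0
    · have : dispMatrix Z m k = 0 := Finset.prod_eq_zero (Finset.mem_univ i) (by
        change dispAmp (Z i) (conj (Z i)) (m i) (k i) = 0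
        rw [hZ, map_zero]
        exact dispAmp_zero_ne fun h => hi (by simp [hZ, h]))
      rw [this, zero_mul]
    · have : dispMatrix Z' k n = 0 := Finset.prod_eq_zero (Finset.mem_univ i) (by
        change dispAmp (Z' i) (conj (Z' i)) (k i) (n i) = 0
        rw [(h i).resolve_left hZ, map_zero]
        exact dispAmp_zero_ne fun h => hi (by simp [hZ, h]))
      rw [this, mul_zero]

lemma IsOrthonormalModes.totalDisplacementOp_eq {region : Set (Space D)}
    {φ : (c : Fin C) → ι c → Space D → ℂ} (hφ : IsOrthonormalModes region φ) (Λ : Phase ι) :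
    totalDisplacementOp φ region Λ = dispMatrix Λ := by
  classical
  have key : ∀ L : List (Fin C), L.Nodup → opProd (ι := ι) (L.map fun c => displacementOp φ region c Λ)
      = dispMatrix fun i => if i.1 ∈ L then Λ i else 0 := by
    intro L
    induction L with
    | nil =>
      intro _
      simp only [List.map_nil, opProd, List.foldr_nil, List.not_mem_nil, if_false]
      exact dispMatrix_zero.symm
    | cons c L ih =>
      intro hL
      rw [List.nodup_cons] at hL
      have h1 : opProd (ι := ι) ((c :: L).map fun c => displacementOp φ region c Λ)
          = opMul (displacementOp φ region c Λ)
            (opProd (ι := ι) (L.map fun c => displacementOp φ region c Λ)) := rfl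
      rw [h1, ih hL.2, displacementOp, hφ.opIntegral_generator, opExp_dispGenerator,
        opMul_dispMatrix_of_disjoint]
      · congr 1
        funext i
        by_cases hi : i.1 = c
        · simp [hi, hL.1]
        · simp [hi]
      · intro i
        by_cases hi : i.1 = c
        · exact Or.inr (by simp [hi, hL.1])
        · exact Or.inl (by simp [hi])
  rw [totalDisplacementOp, List.ofFn_eq_map, key _ (List.nodup_finRange C)]
  simp

end Displacement

/-! ### Growth of matrix elements -/

section Growth

variable [∀ c, Fintype (ι c)]

/-- One plus the total occupation of a pair of occupation numbers. -/
def weight (m n : Occ ι) : ℝ := 1 + ∑ i, (m i : ℝ) + ∑ i, (n i : ℝ)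

lemma weight_comm (m n : Occ ι) : weight m n = weight n m := by
  simp only [weight]
  ring

lemma sum_occ_nonneg (m : Occ ι) : 0 ≤ ∑ i, (m i : ℝ) := Finset.sum_nonneg fun i _ => by positivity

lemma one_le_weight (m n : Occ ι) : 1 ≤ weight m n := by
  have := sum_occ_nonneg m
  have := sum_occ_nonneg n
  simp only [weight]
  linarith

lemma weight_pos (m n : Occ ι) : 0 < weight m n := zero_lt_one.trans_le (one_le_weight m n)

lemma occ_add_one_le_weight (m n : Occ ι) (i : Mode ι) : (m i : ℝ) + 1 ≤ weight m n := by
  have h := Finset.single_le_sum (f := fun i => (m i : ℝ)) (fun j _ => by positivity)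
    (Finset.mem_univ i)
  have := sum_occ_nonneg n
  simp only [weight]
  linarith

lemma sqrt_le_weight {m n : Occ ι} {a : ℝ} (h : a ≤ weight m n) : √a ≤ weight m n :=
  (Real.sqrt_le_sqrt h).trans ((Real.sqrt_le_left (weight_pos m n).le).2
    (by nlinarith [one_le_weight m n]))

open Classical in
lemma weight_add_single (m n : Occ ι) (i : Mode ι) :
    weight (m + Pi.single i 1) n = weight m n + 1 := by
  simp only [weight, Pi.add_apply, Nat.cast_add, Finset.sum_add_distrib]
  have : ∑ j, ((Pi.single (M := fun _ : Mode ι => ℕ) i 1 j : ℕ) : ℝ) = 1 := by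
    rw [← Nat.cast_sum, Finset.sum_pi_single']
    simp
  rw [this]
  ring

open Classical in
lemma weight_sub_single (m n : Occ ι) (i : Mode ι) :
    weight (m - Pi.single i 1) n ≤ weight m n ∧ weight m n ≤ 2 * weight (m - Pi.single i 1) n := by
  by_cases hm : m i = 0
  · have : m - Pi.single i 1 = m := by
      funext j
      rcases eq_or_ne j i with rfl | hj
      · simp [hm]
      · simp [hj]
    rw [this]
    have := one_le_weight m n
    constructor <;> linarith
  · have : m = m - Pi.single i 1 + Pi.single i 1 := by
      funext j
      rcases eq_or_ne j i with rfl | hj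
      · simp; omega
      · simp [hj]
    have h1 := weight_add_single (m - Pi.single i 1) n i
    have h2 := one_le_weight (m - Pi.single i 1) n
    rw [← this] at h1
    constructor <;> linarith

/-- Operations on matrices that move each entry by a bounded distance and multiply it by a factor
of at most linear growth. -/
def IsLadder (T : Module.End ℂ (FockMatrix ι)) : Prop :=
  ∀ m n, ∃ m' n', weight m' n' ≤ 2 * weight m n ∧ weight m n ≤ 2 * weight m' n' ∧
    ∀ B, ‖T B m n‖ ≤ weight m n * ‖B m' n'‖

lemma norm_sqrt_mul_le {m n : Occ ι} {a : ℝ} (h : a ≤ weight m n) (b : ℂ) :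
    ‖((√a : ℝ) : ℂ) * b‖ ≤ weight m n * ‖b‖ := by
  rw [norm_mul, Complex.norm_real, Real.norm_of_nonneg (Real.sqrt_nonneg _)]
  gcongr
  exact sqrt_le_weight h

lemma isLadder_leftAnnihil (i : Mode ι) : IsLadder (leftAnnihil i) := by
  classical
  intro m n
  have h := weight_add_single m n i
  have h1 := one_le_weight m n
  refine ⟨m + Pi.single i 1, n, by linarith, by linarith, fun B => ?_⟩
  exact norm_sqrt_mul_le (occ_add_one_le_weight m n i) _

lemma isLadder_leftCreate (i : Mode ι) : IsLadder (leftCreate i) := by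
  classical
  intro m n
  have h := weight_sub_single m n i
  have h1 := one_le_weight m n
  refine ⟨m - Pi.single i 1, n, by linarith, h.2, fun B => ?_⟩
  exact norm_sqrt_mul_le (by linarith [occ_add_one_le_weight m n i]) _

lemma isLadder_rightAnnihil (i : Mode ι) : IsLadder (rightAnnihil i) := by
  classical
  intro m n
  have h := weight_sub_single n m i
  rw [weight_comm, weight_comm n] at h
  have h1 := one_le_weight m n
  refine ⟨m, n - Pi.single i 1, by linarith, h.2, fun B => ?_⟩
  refine norm_sqrt_mul_le ?_ _
  rw [weight_comm]
  linarith [occ_add_one_le_weight n m i]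

lemma isLadder_rightCreate (i : Mode ι) : IsLadder (rightCreate i) := by
  classical
  intro m n
  have h := weight_add_single n m i
  rw [weight_comm, weight_comm n] at h
  have h1 := one_le_weight m n
  refine ⟨m, n + Pi.single i 1, by linarith, by linarith, fun B => ?_⟩
  refine norm_sqrt_mul_le ?_ _
  rw [weight_comm]
  exact occ_add_one_le_weight n m i

lemma IsLadder.norm_le {T : Module.End ℂ (FockMatrix ι)} (hT : IsLadder T) {B : FockMatrix ι}
    {K : ℕ} {R : ℝ} (hR : 0 ≤ R) (hB : ∀ m n, ‖B m n‖ ≤ R * weight m n ^ K) (m n : Occ ι) :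
    ‖T B m n‖ ≤ (R * 2 ^ K) * weight m n ^ (K + 1) := by
  obtain ⟨m', n', h1, -, h⟩ := hT m n
  have h0 := (weight_pos m n).le
  have h0' := (weight_pos m' n').le
  calc ‖T B m n‖ ≤ weight m n * ‖B m' n'‖ := h B
    _ ≤ weight m n * (R * weight m' n' ^ K) := by gcongr; exact hB _ _
    _ ≤ weight m n * (R * (2 * weight m n) ^ K) := by gcongr
    _ = _ := by ring

/-- Matrices whose entries grow at most polynomially in the occupation numbers. -/
def polyBounded : Submodule ℂ (FockMatrix ι) where
  carrier := {A | ∃ (K : ℕ) (R : ℝ), 0 ≤ R ∧ ∀ m n, ‖A m n‖ ≤ R * weight m n ^ K}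
  zero_mem' := ⟨0, 0, le_rfl, fun m n => by simp⟩
  add_mem' := by
    rintro A B ⟨K, R, hR, hA⟩ ⟨K', R', hR', hB⟩
    refine ⟨max K K', R + R', by positivity, fun m n => ?_⟩
    have h1 := one_le_weight m n
    calc ‖(A + B) m n‖ ≤ ‖A m n‖ + ‖B m n‖ := norm_add_le _ _
      _ ≤ R * weight m n ^ max K K' + R' * weight m n ^ max K K' := by
        gcongr
        · exact (hA m n).trans (by gcongr; exact le_max_left _ _)
        · exact (hB m n).trans (by gcongr; exact le_max_right _ _)
      _ = _ := by ring
  smul_mem' := by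
    rintro c A ⟨K, R, hR, hA⟩
    refine ⟨K, ‖c‖ * R, by positivity, fun m n => ?_⟩
    rw [Matrix.smul_apply, smul_eq_mul, norm_mul, mul_assoc]
    gcongr
    exact hA m n

/-- Matrices whose entries decay faster than every power of the occupation numbers. -/
def rapid : Submodule ℂ (FockMatrix ι) where
  carrier := {A | RapidlyDecreasing A}
  zero_mem' := fun K => ⟨0, fun m n => by simp⟩
  add_mem' := by
    intro A B hA hB K
    obtain ⟨R, hR⟩ := hA K
    obtain ⟨R', hR'⟩ := hB K
    refine ⟨R + R', fun m n => ?_⟩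
    have h0 : 0 ≤ weight m n ^ K := pow_nonneg (weight_pos m n).le K
    calc weight m n ^ K * ‖(A + B) m n‖ ≤ weight m n ^ K * (‖A m n‖ + ‖B m n‖) := by
          gcongr
          exact norm_add_le _ _
      _ = weight m n ^ K * ‖A m n‖ + weight m n ^ K * ‖B m n‖ := mul_add _ _ _
      _ ≤ R + R' := add_le_add (hR m n) (hR' m n)
  smul_mem' := by
    intro c A hA K
    obtain ⟨R, hR⟩ := hA K
    refine ⟨‖c‖ * R, fun m n => ?_⟩
    rw [Matrix.smul_apply, smul_eq_mul, norm_mul, mul_left_comm]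
    gcongr
    exact hR m n

lemma IsLadder.polyBounded {T : Module.End ℂ (FockMatrix ι)} (hT : IsLadder T) {A : FockMatrix ι}
    (hA : A ∈ polyBounded) : T A ∈ polyBounded := by
  obtain ⟨K, R, hR, h⟩ := hA
  exact ⟨K + 1, R * 2 ^ K, by positivity, hT.norm_le hR h⟩

lemma IsLadder.rapid {T : Module.End ℂ (FockMatrix ι)} (hT : IsLadder T) {A : FockMatrix ι}
    (hA : A ∈ rapid) : T A ∈ rapid := by
  intro K
  obtain ⟨R, hR⟩ := hA (K + 1)
  refine ⟨2 ^ (K + 1) * R, fun m n => ?_⟩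
  obtain ⟨m', n', -, h2, h⟩ := hT m n
  have h0 := (weight_pos m n).le
  have h0' := (weight_pos m' n').le
  calc weight m n ^ K * ‖T A m n‖ ≤ weight m n ^ K * (weight m n * ‖A m' n'‖) := by
        gcongr
        exact h A
    _ = weight m n ^ (K + 1) * ‖A m' n'‖ := by ring
    _ ≤ (2 * weight m' n') ^ (K + 1) * ‖A m' n'‖ := by gcongr
    _ = 2 ^ (K + 1) * (weight m' n' ^ (K + 1) * ‖A m' n'‖) := by ring
    _ ≤ 2 ^ (K + 1) * R := by
        gcongr
        exact hR m' n'

lemma summable_prod_occ {f : ℕ → ℝ} (hf0 : ∀ k, 0 ≤ f k) (hf : Summable f) :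
    Summable fun m : Occ ι => ∏ i, f (m i) := by
  classical
  refine summable_of_sum_le (c := (∑' k, f k) ^ Fintype.card (Mode ι))
    (fun m => Finset.prod_nonneg fun i _ => hf0 _) fun s => ?_
  -- a finite set of occupation numbers is contained in a box
  set N := s.sup fun m => Finset.univ.sup fun i => m i + 1 with hN
  have hs : s ⊆ Fintype.piFinset fun _ : Mode ι => Finset.range N := by
    intro m hm
    rw [Fintype.mem_piFinset]
    intro i
    rw [Finset.mem_range, ← Nat.succ_le_iff]
    exact (Finset.le_sup (f := fun i => m i + 1) (Finset.mem_univ i)).trans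
      (Finset.le_sup (f := fun m : Occ ι => Finset.univ.sup fun i => m i + 1) hm)
  calc ∑ m ∈ s, ∏ i, f (m i)
      ≤ ∑ m ∈ Fintype.piFinset fun _ : Mode ι => Finset.range N, ∏ i, f (m i) :=
        Finset.sum_le_sum_of_subset_of_nonneg hs fun m _ _ => Finset.prod_nonneg fun i _ => hf0 _
    _ = ∏ _i : Mode ι, ∑ k ∈ Finset.range N, f k := (Finset.prod_univ_sum _ _).symm
    _ ≤ ∏ _i : Mode ι, ∑' k, f k := Finset.prod_le_prod
        (fun i _ => Finset.sum_nonneg fun k _ => hf0 k)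
        (fun i _ => hf.sum_le_tsum _ fun k _ => hf0 k)
    _ = _ := by simp

/-- The exponent for which inverse powers of `weight` are summable. -/
def summableExponent (ι : Fin C → Type*) [∀ c, Fintype (ι c)] : ℕ := 4 * Fintype.card (Mode ι)

lemma summable_weight : Summable fun p : Occ ι × Occ ι =>
    (weight p.1 p.2 ^ summableExponent ι)⁻¹ := by
  have hf : Summable fun k : ℕ => ((k + 1 : ℝ) ^ 2)⁻¹ := by
    have := (summable_nat_add_iff 1).2 (Real.summable_nat_pow_inv.2 (one_lt_two))
    simpa using this
  have hS := summable_prod_occ (ι := ι) (fun k => by positivity) hf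
  refine Summable.of_nonneg_of_le (fun p => inv_nonneg.2 (pow_nonneg (weight_pos _ _).le _))
    (fun p => ?_) (hS.mul_of_nonneg hS (fun m => Finset.prod_nonneg fun i _ => by positivity)
      (fun m => Finset.prod_nonneg fun i _ => by positivity))
  have key : ∀ m n : Occ ι, ∏ i, ((m i : ℝ) + 1) ^ 2 ≤ weight m n ^ (2 * Fintype.card (Mode ι)) := by
    intro m n
    calc ∏ i, ((m i : ℝ) + 1) ^ 2 ≤ ∏ _i : Mode ι, weight m n ^ 2 :=
          Finset.prod_le_prod (fun i _ => by positivity) fun i _ => by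
            gcongr
            exact occ_add_one_le_weight m n i
      _ = _ := by rw [Finset.prod_const, ← pow_mul, Finset.card_univ]
  simp only [Finset.prod_inv_distrib]
  rw [← mul_inv]
  have h1 := key p.1 p.2
  have h2 := key p.2 p.1
  rw [weight_comm] at h2
  have h3 : ∀ m : Occ ι, 0 < ∏ i, ((m i : ℝ) + 1) ^ 2 := fun m =>
    Finset.prod_pos fun i _ => by positivity
  refine inv_anti₀ (mul_pos (h3 _) (h3 _)) ?_
  calc _ ≤ weight p.1 p.2 ^ (2 * Fintype.card (Mode ι))
        * weight p.1 p.2 ^ (2 * Fintype.card (Mode ι)) :=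
        mul_le_mul h1 h2 (h3 _).le (pow_nonneg (weight_pos _ _).le _)
    _ = _ := by rw [← pow_add, summableExponent]; congr 1; ring

/-- Pairing a rapidly decreasing matrix with matrices that obey a common polynomial bound
converges uniformly. -/
lemma exists_summable_pairing_bound {A : FockMatrix ι} (hA : A ∈ rapid) (K : ℕ) (R : ℝ) :
    ∃ u : Occ ι × Occ ι → ℝ, Summable u ∧ ∀ B : FockMatrix ι,
      (∀ m n, ‖B m n‖ ≤ R * weight m n ^ K) → ∀ p, ‖A p.1 p.2 * B p.2 p.1‖ ≤ u p := by
  obtain ⟨S, hS⟩ := hA (K + summableExponent ι)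
  refine ⟨fun p => S * |R| * (weight p.1 p.2 ^ summableExponent ι)⁻¹,
    summable_weight.mul_left _, fun B hB p => ?_⟩
  have h0 := weight_pos p.1 p.2
  beta_reduce
  rw [norm_mul, ← div_eq_mul_inv, le_div_iff₀ (pow_pos h0 _)]
  have h1 : ‖B p.2 p.1‖ ≤ |R| * weight p.1 p.2 ^ K := by
    rw [weight_comm]
    refine (hB _ _).trans ?_
    gcongr
    · exact pow_nonneg (weight_pos _ _).le _
    · exact le_abs_self R
  calc ‖A p.1 p.2‖ * ‖B p.2 p.1‖ * weight p.1 p.2 ^ summableExponent ι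
      ≤ ‖A p.1 p.2‖ * (|R| * weight p.1 p.2 ^ K) * weight p.1 p.2 ^ summableExponent ι := by
        gcongr
    _ = |R| * (weight p.1 p.2 ^ (K + summableExponent ι) * ‖A p.1 p.2‖) := by
        rw [pow_add]; ring
    _ ≤ |R| * S := by
        gcongr
        exact hS _ _
    _ = _ := mul_comm _ _

/-! ### Bounds on displacement operators and Wigner functions of all modes -/

lemma prod_occ_le (m n : Occ ι) {K : ℝ} (hK : 0 ≤ K) :
    ∏ i, K * ((m i : ℝ) + n i + 1) ^ 3
      ≤ K ^ Fintype.card (Mode ι) * weight m n ^ (3 * Fintype.card (Mode ι)) := by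
  calc ∏ i, K * ((m i : ℝ) + n i + 1) ^ 3 ≤ ∏ _i : Mode ι, K * weight m n ^ 3 := by
        refine Finset.prod_le_prod (fun i _ => by positivity) fun i _ => ?_
        gcongr
        have h1 := Finset.single_le_sum (f := fun i => (m i : ℝ)) (fun j _ => by positivity)
          (Finset.mem_univ i)
        have h2 := Finset.single_le_sum (f := fun i => (n i : ℝ)) (fun j _ => by positivity)
          (Finset.mem_univ i)
        simp only [weight]
        linarith
    _ = _ := by rw [Finset.prod_const, mul_pow, ← pow_mul, Finset.card_univ]

lemma exists_norm_wignerMatrix_le : ∃ R : ℝ, 0 ≤ R ∧ ∀ (Ψ : Phase ι) (m n : Occ ι),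
    ‖wignerMatrix Ψ m n‖ ≤ R * weight m n ^ (3 * Fintype.card (Mode ι)) := by
  obtain ⟨K, hK, h⟩ := exists_norm_modeWigner_le
  refine ⟨K ^ Fintype.card (Mode ι), by positivity, fun Ψ m n => ?_⟩
  rw [wignerMatrix, tensorMatrix, norm_prod]
  exact (Finset.prod_le_prod (fun i _ => norm_nonneg _) fun i _ => h _ _ _).trans
    (prod_occ_le m n hK)

lemma norm_dispMatrix_le_one (Λ : Phase ι) (m n : Occ ι) : ‖dispMatrix Λ m n‖ ≤ 1 := by
  rw [dispMatrix, tensorMatrix, norm_prod]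
  exact Finset.prod_le_one (fun i _ => norm_nonneg _) fun i _ => norm_dispAmp_le_one _ _ _

lemma continuous_dispMatrix (m n : Occ ι) : Continuous fun Λ : Phase ι => dispMatrix Λ m n :=
  continuous_finsetProd _ fun i _ => (continuous_dispAmp (m i) (n i)).comp (continuous_apply i)

lemma continuous_wignerMatrix (m n : Occ ι) : Continuous fun Ψ : Phase ι => wignerMatrix Ψ m n :=
  continuous_iff_continuousAt.2 fun Ψ => (hasFDerivAt_wignerMatrix Ψ m n).continuousAt

lemma integrable_dispMatrix (m n : Occ ι) : Integrable fun Λ : Phase ι => dispMatrix Λ m n :=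
  Integrable.fintype_prod (f := fun (i : Mode ι) (z : ℂ) => dispAmp z (conj z) (m i) (n i))
    fun i => integrable_dispAmp (m i) (n i)

/-- An integrable function that dominates all displacement matrix elements up to polynomial
factors in the occupation numbers. -/
def dispEnvelope (Λ : Phase ι) : ℝ := ∏ i, (1 + ‖Λ i‖) ^ (-3 : ℝ)

lemma dispEnvelope_nonneg (Λ : Phase ι) : 0 ≤ dispEnvelope Λ :=
  Finset.prod_nonneg fun i _ => by positivity

lemma integrable_dispEnvelope : Integrable (dispEnvelope (ι := ι)) :=
  Integrable.fintype_prod (f := fun (_ : Mode ι) (z : ℂ) => (1 + ‖z‖) ^ (-3 : ℝ))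
    fun _ => integrable_one_add_norm_complex

lemma norm_dispMatrix_le (Λ : Phase ι) (m n : Occ ι) :
    ‖dispMatrix Λ m n‖ ≤ 4096 ^ Fintype.card (Mode ι)
      * weight m n ^ (3 * Fintype.card (Mode ι)) * dispEnvelope Λ := by
  rw [dispMatrix, tensorMatrix, norm_prod]
  refine (Finset.prod_le_prod (fun i _ => norm_nonneg _) fun i _ =>
    norm_dispAmp_le (Λ i) (m i) (n i)).trans ?_
  rw [Finset.prod_mul_distrib, dispEnvelope]
  gcongr
  exact prod_occ_le m n (by norm_num)

end Growth

/-! ### Wigner functions of rapidly decreasing matrices -/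

section WignerFunction

lemma pairing_smul_left (c : ℂ) (A B : FockMatrix ι) : pairing (c • A) B = c * pairing A B := by
  simp only [pairing, Matrix.smul_apply, smul_eq_mul, mul_assoc, tsum_mul_left]

lemma pairing_smul_right (c : ℂ) (A B : FockMatrix ι) : pairing A (c • B) = c * pairing A B := by
  rw [pairing_comm, pairing_smul_left, pairing_comm]

variable [∀ c, Fintype (ι c)]

/-- The Wigner transform of a matrix as the trace against the matrix of Wigner functions. -/
def wignerFun (A : FockMatrix ι) (Ψ : Phase ι) : ℂ := pairing A (wignerMatrix Ψ)

lemma summable_pairing {A B : FockMatrix ι} (hA : A ∈ rapid) (hB : B ∈ polyBounded) :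
    Summable fun p : Occ ι × Occ ι => A p.1 p.2 * B p.2 p.1 := by
  obtain ⟨K, R, -, hR⟩ := hB
  obtain ⟨u, hu, h⟩ := exists_summable_pairing_bound hA K R
  exact Summable.of_norm_bounded hu (h B hR)

lemma wignerMatrix_mem (Ψ : Phase ι) : wignerMatrix Ψ ∈ polyBounded := by
  obtain ⟨R, hR, h⟩ := exists_norm_wignerMatrix_le (ι := ι)
  exact ⟨_, R, hR, h Ψ⟩

lemma pairing_add_left {A A' B : FockMatrix ι} (hA : A ∈ rapid) (hA' : A' ∈ rapid)
    (hB : B ∈ polyBounded) : pairing (A + A') B = pairing A B + pairing A' B := by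
  simp only [pairing, Matrix.add_apply, add_mul]
  exact (summable_pairing hA hB).tsum_add (summable_pairing hA' hB)

lemma pairing_add_right {A B B' : FockMatrix ι} (hA : A ∈ rapid) (hB : B ∈ polyBounded)
    (hB' : B' ∈ polyBounded) : pairing A (B + B') = pairing A B + pairing A B' := by
  simp only [pairing, Matrix.add_apply, mul_add]
  exact (summable_pairing hA hB).tsum_add (summable_pairing hA hB')

lemma coord_mul_wignerFun {A : FockMatrix ι} (hA : A ∈ rapid) (i : Mode ι) (Ψ : Phase ι) :
    Ψ i * wignerFun A Ψ
      = (1 / 2 : ℂ) * (wignerFun (leftAnnihil i A) Ψ + wignerFun (rightAnnihil i A) Ψ) := by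
  have hW := wignerMatrix_mem Ψ
  simp only [wignerFun]
  rw [← pairing_smul_right, coord_mul_wignerMatrix, pairing_smul_right,
    pairing_add_right hA ((isLadder_leftAnnihil i).polyBounded hW)
      ((isLadder_rightAnnihil i).polyBounded hW), pairing_leftAnnihil, pairing_rightAnnihil,
    add_comm]

lemma conj_coord_mul_wignerFun {A : FockMatrix ι} (hA : A ∈ rapid) (i : Mode ι) (Ψ : Phase ι) :
    conj (Ψ i) * wignerFun A Ψ
      = (1 / 2 : ℂ) * (wignerFun (leftCreate i A) Ψ + wignerFun (rightCreate i A) Ψ) := by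
  have hW := wignerMatrix_mem Ψ
  simp only [wignerFun]
  rw [← pairing_smul_right, conj_coord_mul_wignerMatrix, pairing_smul_right,
    pairing_add_right hA ((isLadder_leftCreate i).polyBounded hW)
      ((isLadder_rightCreate i).polyBounded hW), pairing_leftCreate, pairing_rightCreate,
    add_comm]

lemma exists_summable_ladder_bound {A : FockMatrix ι} (hA : A ∈ rapid)
    {T : Module.End ℂ (FockMatrix ι)} (hT : IsLadder T) :
    ∃ u : Occ ι × Occ ι → ℝ, Summable u ∧
      ∀ (Ψ : Phase ι) p, ‖A p.1 p.2 * T (wignerMatrix Ψ) p.2 p.1‖ ≤ u p := by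
  obtain ⟨R, hR, h⟩ := exists_norm_wignerMatrix_le (ι := ι)
  obtain ⟨u, hu, hb⟩ := exists_summable_pairing_bound hA (3 * Fintype.card (Mode ι) + 1)
    (R * 2 ^ (3 * Fintype.card (Mode ι)))
  exact ⟨u, hu, fun Ψ => hb _ (hT.norm_le hR (h Ψ))⟩

lemma hasFDerivAt_wignerFun {A : FockMatrix ι} (hA : A ∈ rapid) (Ψ : Phase ι) :
    HasFDerivAt (wignerFun A)
      (∑ i, ((wignerFun (rightCreate i A) Ψ - wignerFun (leftCreate i A) Ψ) • coordCLM i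
        + (wignerFun (leftAnnihil i A) Ψ - wignerFun (rightAnnihil i A) Ψ)
          • conjCoordCLM i)) Ψ := by
  have hW := wignerMatrix_mem Ψ
  choose u1 hu1 hb1 using fun i : Mode ι => exists_summable_ladder_bound hA (isLadder_leftCreate i)
  choose u2 hu2 hb2 using fun i : Mode ι => exists_summable_ladder_bound hA (isLadder_rightCreate i)
  choose u3 hu3 hb3 using fun i : Mode ι =>
    exists_summable_ladder_bound hA (isLadder_rightAnnihil i)
  choose u4 hu4 hb4 using fun i : Mode ι => exists_summable_ladder_bound hA (isLadder_leftAnnihil i)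
  set f' : Occ ι × Occ ι → Phase ι → (Phase ι →L[ℝ] ℂ) := fun p Φ =>
    ∑ i, ((A p.1 p.2 * leftCreate i (wignerMatrix Φ) p.2 p.1
        - A p.1 p.2 * rightCreate i (wignerMatrix Φ) p.2 p.1) • coordCLM i
      + (A p.1 p.2 * rightAnnihil i (wignerMatrix Φ) p.2 p.1
        - A p.1 p.2 * leftAnnihil i (wignerMatrix Φ) p.2 p.1) • conjCoordCLM i) with hf'
  have key := hasFDerivAt_tsum (𝕜 := ℝ) (x₀ := Ψ)
    (u := fun p => ∑ i, ((u1 i p + u2 i p) * ‖coordCLM i‖ + (u3 i p + u4 i p) * ‖conjCoordCLM i‖))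
    (f := fun (p : Occ ι × Occ ι) Φ => A p.1 p.2 * wignerMatrix Φ p.2 p.1) (f' := f')
    (summable_sum fun i _ => (((hu1 i).add (hu2 i)).mul_right _).add
      (((hu3 i).add (hu4 i)).mul_right _))
    (fun p Φ => by
      refine ((hasFDerivAt_wignerMatrix Φ p.2 p.1).const_mul (A p.1 p.2)).congr_fderiv ?_
      simp only [hf', Finset.smul_sum, smul_add, smul_smul, mul_sub])
    (fun p Φ => by
      refine (norm_sum_le _ _).trans (Finset.sum_le_sum fun i _ => ?_)
      refine (norm_add_le _ _).trans (add_le_add ?_ ?_)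
      · rw [norm_smul]
        gcongr
        exact (norm_sub_le _ _).trans (add_le_add (hb1 i Φ p) (hb2 i Φ p))
      · rw [norm_smul]
        gcongr
        exact (norm_sub_le _ _).trans (add_le_add (hb3 i Φ p) (hb4 i Φ p)))
    (summable_pairing hA hW) Ψ
  refine key.congr_fderiv ?_
  have s1 := fun i : Mode ι => summable_pairing hA ((isLadder_leftCreate i).polyBounded hW)
  have s2 := fun i : Mode ι => summable_pairing hA ((isLadder_rightCreate i).polyBounded hW)
  have s3 := fun i : Mode ι => summable_pairing hA ((isLadder_rightAnnihil i).polyBounded hW)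
  have s4 := fun i : Mode ι => summable_pairing hA ((isLadder_leftAnnihil i).polyBounded hW)
  rw [hf', Summable.tsum_finsetSum fun i _ => (((s1 i).sub (s2 i)).smul_const _).add
    (((s3 i).sub (s4 i)).smul_const _)]
  refine Finset.sum_congr rfl fun i _ => ?_
  rw [Summable.tsum_add (((s1 i).sub (s2 i)).smul_const _) (((s3 i).sub (s4 i)).smul_const _),
    Summable.tsum_smul_const ((s1 i).sub (s2 i)), Summable.tsum_smul_const ((s3 i).sub (s4 i)),
    (s1 i).tsum_sub (s2 i), (s3 i).tsum_sub (s4 i)]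
  simp only [wignerFun, pairing_leftAnnihil, pairing_leftCreate, pairing_rightAnnihil,
    pairing_rightCreate]
  rfl

lemma contDiff_wignerFun {A : FockMatrix ι} (hA : A ∈ rapid) : ContDiff ℝ ∞ (wignerFun A) := by
  rw [contDiff_infty]
  intro k
  induction k generalizing A with
  | zero =>
    exact contDiff_zero.2 (continuous_iff_continuousAt.2 fun Ψ =>
      (hasFDerivAt_wignerFun hA Ψ).continuousAt)
  | succ k ih =>
    rw [Nat.cast_succ, contDiff_succ_iff_hasFDerivAt]
    refine ⟨_, ?_, hasFDerivAt_wignerFun hA⟩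
    exact ContDiff.sum fun i _ =>
      (((ih ((isLadder_rightCreate i).rapid hA)).sub
        (ih ((isLadder_leftCreate i).rapid hA))).smul contDiff_const).add
      (((ih ((isLadder_leftAnnihil i).rapid hA)).sub
        (ih ((isLadder_rightAnnihil i).rapid hA))).smul contDiff_const)

/-- The Wirtinger derivatives are the coefficients of `dα_i` and `dα_i^*`. -/
lemma wirtinger_of_hasFDerivAt {F : Phase ι → ℂ} {a b : Mode ι → ℂ} {Ψ : Phase ι}
    (hF : HasFDerivAt F (∑ i, (a i • coordCLM i + b i • conjCoordCLM i)) Ψ) (i : Mode ι) :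
    wirtinger i F Ψ = a i ∧ wirtingerStar i F Ψ = b i := by
  classical
  have h : ∀ z : ℂ, lineDeriv ℝ F Ψ (Pi.single i z) = a i * z + b i * conj z := by
    intro z
    rw [(hF.hasLineDerivAt _).lineDeriv, _root_.sum_apply, Finset.sum_eq_single i]
    · simp
    · intro j _ hj
      simp [hj]
    · simp
  have hI := Complex.I_mul_I
  have h1 := h 1
  have h2 := h Complex.I
  simp only [map_one, Complex.conj_I] at h1 h2
  constructor
  · unfold wirtinger
    convert_to (1 / 2 : ℂ) * (a i * 1 + b i * 1 - Complex.I * (a i * Complex.I + b i * -Complex.I))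
      = a i
    · rw [← h1, ← h2]
    · linear_combination (-(1 / 2) * a i + 1 / 2 * b i) * hI
  · unfold wirtingerStar
    convert_to (1 / 2 : ℂ) * (a i * 1 + b i * 1 + Complex.I * (a i * Complex.I + b i * -Complex.I))
      = b i
    · rw [← h1, ← h2]
    · linear_combination ((1 / 2) * a i - 1 / 2 * b i) * hI

lemma wirtinger_wignerFun {A : FockMatrix ι} (hA : A ∈ rapid) (i : Mode ι) (Ψ : Phase ι) :
    wirtinger i (wignerFun A) Ψ = wignerFun (rightCreate i A) Ψ - wignerFun (leftCreate i A) Ψ :=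
  (wirtinger_of_hasFDerivAt (hasFDerivAt_wignerFun hA Ψ) i).1

lemma wirtingerStar_wignerFun {A : FockMatrix ι} (hA : A ∈ rapid) (i : Mode ι) (Ψ : Phase ι) :
    wirtingerStar i (wignerFun A) Ψ
      = wignerFun (leftAnnihil i A) Ψ - wignerFun (rightAnnihil i A) Ψ :=
  (wirtinger_of_hasFDerivAt (hasFDerivAt_wignerFun hA Ψ) i).2

lemma wignerMatrix_eq_integral (Ψ : Phase ι) (m n : Occ ι) :
    wignerMatrix Ψ m n = 1 / (Real.pi : ℂ) ^ (2 * Fintype.card (Mode ι)) *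
      ∫ Λ : Phase ι, (∏ i, phaseFactor (Λ i) (Ψ i)) * dispMatrix Λ m n := by
  simp only [wignerMatrix, tensorMatrix, dispMatrix, modeWigner, ← Finset.prod_mul_distrib]
  rw [integral_fintype_prod_volume_eq_prod (f := fun (i : Mode ι) (z : ℂ) =>
    phaseFactor z (Ψ i) * dispAmp z (conj z) (m i) (n i)), Finset.prod_mul_distrib]
  congr 1
  simp [pow_mul]

lemma continuous_prod_phaseFactor :
    Continuous fun p : Phase ι × Phase ι => ∏ i, phaseFactor (p.1 i) (p.2 i) :=
  continuous_finsetProd _ fun i _ => by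
    unfold phaseFactor
    fun_prop

lemma norm_prod_phaseFactor (Λ Ψ : Phase ι) : ‖∏ i, phaseFactor (Λ i) (Ψ i)‖ = 1 := by
  simp [norm_prod, norm_phaseFactor]

variable {region : Set (Space D)} {φ : (c : Fin C) → ι c → Space D → ℂ}

lemma dispMatrix_mem (Λ : Phase ι) : dispMatrix Λ ∈ polyBounded :=
  ⟨0, 1, zero_le_one, fun m n => by simpa using norm_dispMatrix_le_one Λ m n⟩

lemma IsOrthonormalModes.charFunctional_eq (hφ : IsOrthonormalModes region φ) {A : FockMatrix ι}
    (hA : A ∈ rapid) (Λ : Phase ι) :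
    charFunctional φ region A Λ = pairing A (dispMatrix Λ) := by
  rw [charFunctional, hφ.totalDisplacementOp_eq, opTrace, pairing,
    (summable_pairing hA (dispMatrix_mem Λ)).tsum_prod]
  rfl

lemma exists_summable_envelope {A : FockMatrix ι} (hA : A ∈ rapid) :
    ∃ u : Occ ι × Occ ι → ℝ, Summable u ∧
      ∀ (Λ : Phase ι) p, ‖A p.1 p.2 * dispMatrix Λ p.2 p.1‖ ≤ u p * dispEnvelope Λ := by
  obtain ⟨u, hu, h⟩ := exists_summable_pairing_bound hA (3 * Fintype.card (Mode ι))
    (4096 ^ Fintype.card (Mode ι))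
  refine ⟨u, hu, fun Λ p => ?_⟩
  -- the comparison matrix that carries exactly the polynomial bound
  have h1 := h (fun m n => ((4096 ^ Fintype.card (Mode ι)
      * weight m n ^ (3 * Fintype.card (Mode ι)) : ℝ) : ℂ))
    (fun m n => by
      have := weight_pos m n
      rw [Complex.norm_real, Real.norm_of_nonneg (by positivity)]) p
  have hw := weight_pos p.2 p.1
  rw [norm_mul, Complex.norm_real, Real.norm_of_nonneg (by positivity)] at h1
  calc ‖A p.1 p.2 * dispMatrix Λ p.2 p.1‖
      ≤ ‖A p.1 p.2‖ * (4096 ^ Fintype.card (Mode ι)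
        * weight p.2 p.1 ^ (3 * Fintype.card (Mode ι)) * dispEnvelope Λ) := by
        rw [norm_mul]
        gcongr
        exact norm_dispMatrix_le Λ _ _
    _ = ‖A p.1 p.2‖ * (4096 ^ Fintype.card (Mode ι)
        * weight p.2 p.1 ^ (3 * Fintype.card (Mode ι))) * dispEnvelope Λ := by ring
    _ ≤ _ := by
        gcongr
        exact dispEnvelope_nonneg Λ

lemma IsOrthonormalModes.wignerConverges (hφ : IsOrthonormalModes region φ) {A : FockMatrix ι}
    (hA : A ∈ rapid) : WignerConverges φ region A := by
  obtain ⟨u, hu, h⟩ := exists_summable_envelope hA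
  refine ⟨fun Λ => ?_, ?_⟩
  · rw [hφ.totalDisplacementOp_eq]
    exact summable_pairing hA (dispMatrix_mem Λ)
  · have hcont : Continuous fun Λ => pairing A (dispMatrix Λ) := by
      obtain ⟨v, hv, hb⟩ := exists_summable_pairing_bound hA 0 1
      exact continuous_tsum (fun p => continuous_const.mul (continuous_dispMatrix p.2 p.1)) hv
        fun p Λ => hb _ (by simpa using norm_dispMatrix_le_one Λ) p
    have : charFunctional φ region A = fun Λ => pairing A (dispMatrix Λ) :=
      funext fun Λ => hφ.charFunctional_eq hA Λ
    rw [this]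
    refine (integrable_dispEnvelope.const_mul (∑' p, u p)).mono' hcont.aestronglyMeasurable
      (.of_forall fun Λ => ?_)
    rw [← tsum_mul_right]
    exact tsum_of_norm_bounded (hu.mul_right _).hasSum (h Λ)

lemma IsOrthonormalModes.wigner_eq (hφ : IsOrthonormalModes region φ) {A : FockMatrix ι}
    (hA : A ∈ rapid) : wigner φ region A = wignerFun A := by
  funext Ψ
  obtain ⟨u, hu, h⟩ := exists_summable_envelope hA
  have hint : ∀ p : Occ ι × Occ ι, Integrable fun Λ : Phase ι =>
      (∏ i, phaseFactor (Λ i) (Ψ i)) * (A p.1 p.2 * dispMatrix Λ p.2 p.1) := fun p => by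
    refine ((integrable_dispMatrix p.2 p.1).const_mul (A p.1 p.2)).mono ?_
      (.of_forall fun Λ => by rw [norm_mul, norm_prod_phaseFactor, one_mul])
    exact (continuous_prod_phaseFactor.comp (by fun_prop : Continuous fun Λ : Phase ι => (Λ, Ψ))
      |>.mul (continuous_const.mul (continuous_dispMatrix p.2 p.1))).aestronglyMeasurable
  have hsum : Summable fun p : Occ ι × Occ ι => ∫ Λ : Phase ι,
      ‖(∏ i, phaseFactor (Λ i) (Ψ i)) * (A p.1 p.2 * dispMatrix Λ p.2 p.1)‖ := by
    refine Summable.of_nonneg_of_le (fun p => integral_nonneg fun Λ => norm_nonneg _) (fun p => ?_)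
      (hu.mul_right (∫ Λ : Phase ι, dispEnvelope Λ))
    rw [← integral_const_mul]
    refine integral_mono (hint p).norm (integrable_dispEnvelope.const_mul _) fun Λ => ?_
    simp only [norm_mul _ (A p.1 p.2 * _), norm_prod_phaseFactor, one_mul]
    exact h Λ p
  have key := integral_tsum_of_summable_integral_norm hint hsum
  simp only [wigner, hφ.displacementFunctional_eq, hφ.charFunctional_eq hA, pairing, wignerFun,
    ← tsum_mul_left]
  simp only [tsum_mul_left]
  simp only [tsum_mul_left] at key
  rw [← key, ← tsum_mul_left]
  refine tsum_congr fun p => ?_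
  have e : (fun Λ : Phase ι => (∏ i, phaseFactor (Λ i) (Ψ i))
      * (A p.1 p.2 * dispMatrix Λ p.2 p.1)) = fun Λ => A p.1 p.2
        * ((∏ i, phaseFactor (Λ i) (Ψ i)) * dispMatrix Λ p.2 p.1) := by
    funext Λ
    ring
  rw [wignerMatrix_eq_integral, e, integral_const_mul]
  ring

end WignerFunction

/-! ### Wigner distributions of polynomially bounded matrices -/

section WignerDistribution

lemma leftCreate_leftAnnihil_apply (i : Mode ι) (B : FockMatrix ι) (m n : Occ ι) :
    leftCreate i (leftAnnihil i B) m n = (m i : ℂ) * B m n := by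
  classical
  rw [leftCreate_apply, leftAnnihil_apply]
  rcases Nat.eq_zero_or_pos (m i) with h | h
  · simp [h]
  · have e : m - Pi.single i 1 + Pi.single i 1 = m := by
      funext j
      rcases eq_or_ne j i with rfl | hj
      · simp; omega
      · simp [hj]
    have h2 : (((m - Pi.single i 1 : Occ ι) i : ℕ) : ℝ) + 1 = m i := by
      simp only [Pi.sub_apply, Pi.single_eq_same]
      exact_mod_cast Nat.sub_add_cancel h
    rw [e, h2, ← mul_assoc, sqrt_mul_self_complex (by positivity)]
    push_cast
    rfl

lemma rightAnnihil_rightCreate_apply (i : Mode ι) (B : FockMatrix ι) (m n : Occ ι) :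
    rightAnnihil i (rightCreate i B) m n = (n i : ℂ) * B m n :=
  leftCreate_leftAnnihil_apply i (fun n m => B m n) n m

variable [∀ c, Fintype (ι c)]

lemma hasTemperateGrowth_coord (i : Mode ι) : (fun Ψ : Phase ι => Ψ i).HasTemperateGrowth :=
  (coordCLM i).hasTemperateGrowth

lemma hasTemperateGrowth_conj_coord (i : Mode ι) :
    (fun Ψ : Phase ι => conj (Ψ i)).HasTemperateGrowth :=
  (conjCoordCLM i).hasTemperateGrowth

lemma integrable_schwartz_mul_wignerMatrix (f : 𝓢(Phase ι, ℂ)) (m n : Occ ι) :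
    Integrable fun Ψ => f Ψ * wignerMatrix Ψ m n := by
  obtain ⟨R, hR, h⟩ := exists_norm_wignerMatrix_le (ι := ι)
  exact f.integrable.mul_bdd (c := R * weight m n ^ (3 * Fintype.card (Mode ι)))
    (continuous_wignerMatrix m n).aestronglyMeasurable (.of_forall fun Ψ => h Ψ m n)

/-- The Wigner functions of the transition operators integrated against a test function. This is
the matrix of the Weyl quantization of the test function, up to normalization. -/
def testMatrix : 𝓢(Phase ι, ℂ) →ₗ[ℂ] FockMatrix ι where
  toFun f m n := ∫ Ψ, f Ψ * wignerMatrix Ψ m n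
  map_add' f g := by
    ext m n
    simp only [_root_.add_apply, add_mul]
    exact integral_add (integrable_schwartz_mul_wignerMatrix f m n)
      (integrable_schwartz_mul_wignerMatrix g m n)
  map_smul' c f := by
    ext m n
    simp only [_root_.smul_apply, smul_eq_mul, mul_assoc]
    exact integral_const_mul c _

lemma testMatrix_apply (f : 𝓢(Phase ι, ℂ)) (m n : Occ ι) :
    testMatrix f m n = ∫ Ψ, f Ψ * wignerMatrix Ψ m n := rfl

/-- The Wirtinger derivative `∂/∂α_i` of Schwartz functions. -/
def schwartzWirtinger (i : Mode ι) : 𝓢(Phase ι, ℂ) →L[ℂ] 𝓢(Phase ι, ℂ) := by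
  classical exact
  (1 / 2 : ℂ) • (lineDerivOpCLM ℂ 𝓢(Phase ι, ℂ) (Pi.single i 1 : Phase ι)
    - Complex.I • lineDerivOpCLM ℂ 𝓢(Phase ι, ℂ) (Pi.single i Complex.I : Phase ι))

/-- The Wirtinger derivative `∂/∂α_i^*` of Schwartz functions. -/
def schwartzWirtingerStar (i : Mode ι) : 𝓢(Phase ι, ℂ) →L[ℂ] 𝓢(Phase ι, ℂ) := by
  classical exact
  (1 / 2 : ℂ) • (lineDerivOpCLM ℂ 𝓢(Phase ι, ℂ) (Pi.single i 1 : Phase ι)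
    + Complex.I • lineDerivOpCLM ℂ 𝓢(Phase ι, ℂ) (Pi.single i Complex.I : Phase ι))

lemma testMatrix_coord (f : 𝓢(Phase ι, ℂ)) (i : Mode ι) :
    testMatrix (SchwartzMap.smulLeftCLM ℂ (fun Ψ : Phase ι => Ψ i) f)
      = (1 / 2 : ℂ) • (leftAnnihil i (testMatrix f) + rightAnnihil i (testMatrix f)) := by
  classical
  ext m n
  have h := fun Ψ : Phase ι => congr_fun (congr_fun (coord_mul_wignerMatrix Ψ i) m) n
  simp only [Matrix.smul_apply, Matrix.add_apply, smul_eq_mul, leftAnnihil_apply,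
    rightAnnihil_apply, testMatrix_apply] at h ⊢
  rw [← integral_const_mul, ← integral_const_mul, ← integral_add
    ((integrable_schwartz_mul_wignerMatrix f _ _).const_mul _)
    ((integrable_schwartz_mul_wignerMatrix f _ _).const_mul _), ← integral_const_mul]
  congr 1
  funext Ψ
  rw [SchwartzMap.smulLeftCLM_apply_apply (hasTemperateGrowth_coord i), smul_eq_mul]
  linear_combination f Ψ * h Ψ

lemma testMatrix_conj_coord (f : 𝓢(Phase ι, ℂ)) (i : Mode ι) :
    testMatrix (SchwartzMap.smulLeftCLM ℂ (fun Ψ : Phase ι => conj (Ψ i)) f)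
      = (1 / 2 : ℂ) • (leftCreate i (testMatrix f) + rightCreate i (testMatrix f)) := by
  classical
  ext m n
  have h := fun Ψ : Phase ι => congr_fun (congr_fun (conj_coord_mul_wignerMatrix Ψ i) m) n
  simp only [Matrix.smul_apply, Matrix.add_apply, smul_eq_mul, leftCreate_apply,
    rightCreate_apply, testMatrix_apply] at h ⊢
  rw [← integral_const_mul, ← integral_const_mul, ← integral_add
    ((integrable_schwartz_mul_wignerMatrix f _ _).const_mul _)
    ((integrable_schwartz_mul_wignerMatrix f _ _).const_mul _), ← integral_const_mul]
  congr 1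
  funext Ψ
  rw [SchwartzMap.smulLeftCLM_apply_apply (hasTemperateGrowth_conj_coord i), smul_eq_mul]
  linear_combination f Ψ * h Ψ

open Classical in
lemma testMatrix_lineDeriv (f : 𝓢(Phase ι, ℂ)) (i : Mode ι) (z : ℂ) :
    testMatrix (∂_{(Pi.single i z : Phase ι)} f)
      = z • (rightCreate i (testMatrix f) - leftCreate i (testMatrix f))
        + conj z • (leftAnnihil i (testMatrix f) - rightAnnihil i (testMatrix f)) := by
  ext m n
  have hi := integrable_schwartz_mul_wignerMatrix f
  have hd : ∀ Ψ : Phase ι, (∑ j, ((leftCreate j (wignerMatrix Ψ) m n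
        - rightCreate j (wignerMatrix Ψ) m n) • coordCLM j
        + (rightAnnihil j (wignerMatrix Ψ) m n - leftAnnihil j (wignerMatrix Ψ) m n)
          • conjCoordCLM j)) (Pi.single i z : Phase ι)
      = z * leftCreate i (wignerMatrix Ψ) m n - z * rightCreate i (wignerMatrix Ψ) m n
        + (conj z * rightAnnihil i (wignerMatrix Ψ) m n
          - conj z * leftAnnihil i (wignerMatrix Ψ) m n) := by
    intro Ψ
    rw [_root_.sum_apply, Finset.sum_eq_single i]
    · simp
      ring
    · intro j _ hj
      simp [hj]
    · simp
  have e : ∀ Ψ : Phase ι, f Ψ * (z * leftCreate i (wignerMatrix Ψ) m n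
        - z * rightCreate i (wignerMatrix Ψ) m n
        + (conj z * rightAnnihil i (wignerMatrix Ψ) m n
          - conj z * leftAnnihil i (wignerMatrix Ψ) m n))
      = z * (√(m i : ℝ) : ℝ) * (f Ψ * wignerMatrix Ψ (m - Pi.single i 1) n)
        - z * (√(n i + 1 : ℝ) : ℝ) * (f Ψ * wignerMatrix Ψ m (n + Pi.single i 1))
        + (conj z * (√(n i : ℝ) : ℝ) * (f Ψ * wignerMatrix Ψ m (n - Pi.single i 1))
          - conj z * (√(m i + 1 : ℝ) : ℝ) * (f Ψ * wignerMatrix Ψ (m + Pi.single i 1) n)) := by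
    intro Ψ
    simp only [leftCreate_apply, rightCreate_apply, leftAnnihil_apply, rightAnnihil_apply]
    ring
  have i1 := (hi (m - Pi.single i 1) n).const_mul (z * (√(m i : ℝ) : ℝ))
  have i2 := (hi m (n + Pi.single i 1)).const_mul (z * (√(n i + 1 : ℝ) : ℝ))
  have i3 := (hi m (n - Pi.single i 1)).const_mul (conj z * (√(n i : ℝ) : ℝ))
  have i4 := (hi (m + Pi.single i 1) n).const_mul (conj z * (√(m i + 1 : ℝ) : ℝ))
  have key := integral_bilinear_hasFDerivAt_right_eq_neg_left_of_integrable
    (μ := (volume : Measure (Phase ι))) (B := ContinuousLinearMap.mul ℝ ℂ)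
    (v := (Pi.single i z : Phase ι)) (f := fun Ψ => f Ψ) (f' := fun Ψ => fderiv ℝ f Ψ)
    (g := fun Ψ => wignerMatrix Ψ m n) (g' := fun Ψ => ∑ j, ((leftCreate j (wignerMatrix Ψ) m n
        - rightCreate j (wignerMatrix Ψ) m n) • coordCLM j
        + (rightAnnihil j (wignerMatrix Ψ) m n - leftAnnihil j (wignerMatrix Ψ) m n)
          • conjCoordCLM j))
    (integrable_schwartz_mul_wignerMatrix (∂_{(Pi.single i z : Phase ι)} f) m n)
    (by
      simp only [hd, ContinuousLinearMap.mul_apply', e]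
      exact (i1.sub i2).add (i3.sub i4))
    (hi m n) (fun Ψ _ => f.hasFDerivAt Ψ) (fun Ψ _ => hasFDerivAt_wignerMatrix Ψ m n)
  simp only [hd, ContinuousLinearMap.mul_apply', e] at key
  rw [integral_add (i1.sub' i2) (i3.sub' i4), integral_sub i1 i2, integral_sub i3 i4] at key
  simp only [integral_const_mul] at key
  have h0 : testMatrix (∂_{(Pi.single i z : Phase ι)} f) m n
      = ∫ Ψ, fderiv ℝ f Ψ (Pi.single i z : Phase ι) * wignerMatrix Ψ m n := rfl
  rw [h0]
  simp only [Matrix.add_apply, Matrix.smul_apply, Matrix.sub_apply, smul_eq_mul, leftCreate_apply,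
    rightCreate_apply, leftAnnihil_apply, rightAnnihil_apply, testMatrix_apply]
  linear_combination key

lemma testMatrix_wirtinger (f : 𝓢(Phase ι, ℂ)) (i : Mode ι) :
    testMatrix (schwartzWirtinger i f)
      = rightCreate i (testMatrix f) - leftCreate i (testMatrix f) := by
  classical
  have h : schwartzWirtinger i f = (1 / 2 : ℂ) • (∂_{(Pi.single i 1 : Phase ι)} f
    - Complex.I • ∂_{(Pi.single i Complex.I : Phase ι)} f) := rfl
  have hI := Complex.I_mul_I
  rw [h, map_smul, map_sub, map_smul, testMatrix_lineDeriv, testMatrix_lineDeriv]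
  simp only [smul_add, smul_sub, smul_smul, map_one, Complex.conj_I, mul_neg, hI]
  module

lemma testMatrix_wirtingerStar (f : 𝓢(Phase ι, ℂ)) (i : Mode ι) :
    testMatrix (schwartzWirtingerStar i f)
      = leftAnnihil i (testMatrix f) - rightAnnihil i (testMatrix f) := by
  classical
  have h : schwartzWirtingerStar i f = (1 / 2 : ℂ) • (∂_{(Pi.single i 1 : Phase ι)} f
    + Complex.I • ∂_{(Pi.single i Complex.I : Phase ι)} f) := rfl
  have hI := Complex.I_mul_I
  rw [h, map_smul, map_add, map_smul, testMatrix_lineDeriv, testMatrix_lineDeriv]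
  simp only [smul_add, smul_sub, smul_smul, map_one, Complex.conj_I, mul_neg, hI]
  module

/-- The total number operator acting on test functions from both sides: the quantization of the
new test function is the old one multiplied entrywise by `weight`. -/
lemma exists_weight_operator : ∃ N : 𝓢(Phase ι, ℂ) →L[ℂ] 𝓢(Phase ι, ℂ), ∀ f m n,
    testMatrix (N f) m n = (weight m n : ℂ) * testMatrix f m n := by
  set X : Mode ι → 𝓢(Phase ι, ℂ) →L[ℂ] 𝓢(Phase ι, ℂ) := fun i =>
    SchwartzMap.smulLeftCLM ℂ (fun Ψ : Phase ι => Ψ i)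
  set Y : Mode ι → 𝓢(Phase ι, ℂ) →L[ℂ] 𝓢(Phase ι, ℂ) := fun i =>
    SchwartzMap.smulLeftCLM ℂ (fun Ψ : Phase ι => conj (Ψ i))
  have la : ∀ i f, testMatrix ((X i + (1 / 2 : ℂ) • schwartzWirtingerStar i) f)
      = leftAnnihil i (testMatrix f) := by
    intro i f
    rw [_root_.add_apply, map_add, _root_.smul_apply, map_smul, testMatrix_coord,
      testMatrix_wirtingerStar]
    module
  have lc : ∀ i f, testMatrix ((Y i - (1 / 2 : ℂ) • schwartzWirtinger i) f)
      = leftCreate i (testMatrix f) := by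
    intro i f
    rw [_root_.sub_apply, map_sub, _root_.smul_apply, map_smul, testMatrix_conj_coord,
      testMatrix_wirtinger]
    module
  have ra : ∀ i f, testMatrix ((X i - (1 / 2 : ℂ) • schwartzWirtingerStar i) f)
      = rightAnnihil i (testMatrix f) := by
    intro i f
    rw [_root_.sub_apply, map_sub, _root_.smul_apply, map_smul, testMatrix_coord,
      testMatrix_wirtingerStar]
    module
  have rc : ∀ i f, testMatrix ((Y i + (1 / 2 : ℂ) • schwartzWirtinger i) f)
      = rightCreate i (testMatrix f) := by
    intro i f
    rw [_root_.add_apply, map_add, _root_.smul_apply, map_smul, testMatrix_conj_coord,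
      testMatrix_wirtinger]
    module
  refine ⟨ContinuousLinearMap.id ℂ _ + ∑ i, ((Y i - (1 / 2 : ℂ) • schwartzWirtinger i).comp
      (X i + (1 / 2 : ℂ) • schwartzWirtingerStar i))
    + ∑ i, ((X i - (1 / 2 : ℂ) • schwartzWirtingerStar i).comp
      (Y i + (1 / 2 : ℂ) • schwartzWirtinger i)), fun f m n => ?_⟩
  rw [_root_.add_apply, _root_.add_apply, _root_.sum_apply, _root_.sum_apply, map_add, map_add,
    map_sum, map_sum]
  simp only [ContinuousLinearMap.comp_apply, lc, la, ra, rc, Matrix.add_apply, Matrix.sum_apply,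
    leftCreate_leftAnnihil_apply, rightAnnihil_rightCreate_apply, ← Finset.sum_mul,
    ContinuousLinearMap.id_apply, weight]
  push_cast
  ring

/-- Matrix elements of the quantization of a Schwartz function decay rapidly, with constants given
by a continuous map into `L¹`. -/
lemma exists_testMatrix_bound (K : ℕ) : ∃ (R : ℝ) (Φ : 𝓢(Phase ι, ℂ) →L[ℂ] 𝓢(Phase ι, ℂ)), 0 ≤ R ∧
    ∀ f m n, weight m n ^ K * ‖testMatrix f m n‖ ≤ R * ‖(Φ f).toLp 1 volume‖ := by
  obtain ⟨N, hN⟩ := exists_weight_operator (ι := ι)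
  obtain ⟨R, hR, hW⟩ := exists_norm_wignerMatrix_le (ι := ι)
  set d := 3 * Fintype.card (Mode ι)
  have hpow : ∀ (k : ℕ) f m n, testMatrix ((N ^ k) f) m n
      = (weight m n : ℂ) ^ k * testMatrix f m n := by
    intro k
    induction k with
    | zero => simp
    | succ k ih =>
      intro f m n
      rw [pow_succ', mul_apply_eq_comp, hN, ih]
      ring
  refine ⟨R, N ^ (K + d), hR, fun f m n => ?_⟩
  have hw := weight_pos m n
  have h1 : ‖testMatrix ((N ^ (K + d)) f) m n‖
      ≤ (R * ‖((N ^ (K + d)) f).toLp 1 volume‖) * weight m n ^ d := by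
    rw [testMatrix_apply, SchwartzMap.norm_toLp_one, mul_assoc, mul_comm (∫ _, _), ← mul_assoc,
      ← integral_const_mul]
    refine norm_integral_le_of_norm_le (((N ^ (K + d)) f).integrable.norm.const_mul _)
      (.of_forall fun Ψ => ?_)
    rw [norm_mul, mul_comm]
    gcongr
    exact hW Ψ m n
  rw [hpow, norm_mul, norm_pow, Complex.norm_real, Real.norm_of_nonneg hw.le, pow_add,
    mul_right_comm] at h1
  exact le_of_mul_le_mul_right h1 (pow_pos hw d)

lemma testMatrix_mem (f : 𝓢(Phase ι, ℂ)) : testMatrix f ∈ rapid := by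
  intro K
  obtain ⟨R, Φ, -, h⟩ := exists_testMatrix_bound (ι := ι) K
  exact ⟨_, h f⟩

/-- The Wigner distribution of a polynomially bounded matrix as a linear form on test
functions. -/
def wignerForm (A : FockMatrix ι) (hA : A ∈ polyBounded) : 𝓢(Phase ι, ℂ) →ₗ[ℂ] ℂ where
  toFun f := pairing (testMatrix f) A
  map_add' f g := by
    rw [map_add, pairing_add_left (testMatrix_mem f) (testMatrix_mem g) hA]
  map_smul' c f := by rw [map_smul, pairing_smul_left]; rfl

lemma continuous_wignerForm (A : FockMatrix ι) (hA : A ∈ polyBounded) :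
    Continuous (wignerForm A hA) := by
  obtain ⟨K, S, hS, hA'⟩ := id hA
  obtain ⟨R, Φ, hR, hΦ⟩ := exists_testMatrix_bound (ι := ι) (K + summableExponent ι)
  set S₀ := ∑' p : Occ ι × Occ ι, (weight p.1 p.2 ^ summableExponent ι)⁻¹
  have hbound : ∀ f, ‖wignerForm A hA f‖
      ≤ R * S * S₀ * ‖SchwartzMap.toLpCLM ℂ ℂ 1 volume (Φ f)‖ := by
    intro f
    have hle : ∀ p : Occ ι × Occ ι, ‖testMatrix f p.1 p.2 * A p.2 p.1‖
        ≤ (R * ‖(Φ f).toLp 1 volume‖ * S) * (weight p.1 p.2 ^ summableExponent ι)⁻¹ := by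
      intro p
      have hw := weight_pos p.1 p.2
      have h2 := hA' p.2 p.1
      rw [weight_comm] at h2
      rw [norm_mul, ← div_eq_mul_inv, le_div_iff₀ (pow_pos hw _)]
      calc ‖testMatrix f p.1 p.2‖ * ‖A p.2 p.1‖ * weight p.1 p.2 ^ summableExponent ι
          ≤ ‖testMatrix f p.1 p.2‖ * (S * weight p.1 p.2 ^ K)
            * weight p.1 p.2 ^ summableExponent ι := by gcongr
        _ = (weight p.1 p.2 ^ (K + summableExponent ι) * ‖testMatrix f p.1 p.2‖) * S := by
            rw [pow_add]; ring
        _ ≤ (R * ‖(Φ f).toLp 1 volume‖) * S := mul_le_mul_of_nonneg_right (hΦ f _ _) hS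
    refine (tsum_of_norm_bounded (summable_weight.mul_left _).hasSum hle).trans_eq ?_
    rw [tsum_mul_left, SchwartzMap.toLpCLM_apply]
    ring
  refine continuous_of_continuousAt_zero (wignerForm A hA) ?_
  rw [ContinuousAt, map_zero]
  refine squeeze_zero_norm hbound ?_
  have hc : Continuous fun f : 𝓢(Phase ι, ℂ) =>
      R * S * S₀ * ‖SchwartzMap.toLpCLM ℂ ℂ 1 volume (Φ f)‖ :=
    continuous_const.mul ((ContinuousLinearMap.continuous _).comp Φ.continuous).norm
  have h0 := hc.tendsto 0
  rwa [map_zero Φ, map_zero, norm_zero, mul_zero] at h0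

/-- The Wigner transform of polynomially bounded matrices, with values in the tempered
distributions. -/
def wignerDist : (polyBounded : Submodule ℂ (FockMatrix ι)) →ₗ[ℂ] 𝓢'(Phase ι, ℂ) where
  toFun A := ContinuousLinearMap.toPointwiseConvergenceCLM _ _ _ _
    (⟨wignerForm A.1 A.2, continuous_wignerForm A.1 A.2⟩ : 𝓢(Phase ι, ℂ) →L[ℂ] ℂ)
  map_add' A B := by
    ext f
    exact pairing_add_right (testMatrix_mem f) A.2 B.2
  map_smul' c A := by
    ext f
    exact pairing_smul_right c _ _

lemma wignerDist_apply (A : (polyBounded : Submodule ℂ (FockMatrix ι))) (f : 𝓢(Phase ι, ℂ)) :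
    wignerDist A f = pairing (testMatrix f) A.1 := rfl

end WignerDistribution

/-! ### Anti-normal ordering in a Weyl algebra -/

section WeylAlgebra

variable {R : Type*} [Ring R]

/-- The ordered product over the components. -/
def listProd (a : Fin C → R) : R := (List.ofFn a).prod

lemma listProd_succ (a : Fin (C + 1) → R) :
    listProd a = a 0 * listProd fun c : Fin C => a c.succ := by
  simp [listProd, List.ofFn_succ]

lemma commute_listProd {x : R} {a : Fin C → R} (h : ∀ c, Commute x (a c)) :
    Commute x (listProd a) :=
  Commute.list_prod_right _ _ fun y hy => by
    obtain ⟨c, rfl⟩ := (List.mem_ofFn' _ _).1 hy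
    exact h c

lemma listProd_mul {a b : Fin C → R} (h : ∀ c c', c ≠ c' → Commute (a c) (b c')) :
    listProd (fun c => a c * b c) = listProd a * listProd b := by
  induction C with
  | zero => simp [listProd]
  | succ C ih =>
    have h1 := ih (a := fun c => a c.succ) (b := fun c => b c.succ)
      fun c c' hc => h _ _ fun e => hc (Fin.succ_injective _ e)
    have h2 : Commute (b 0) (listProd fun c : Fin C => a c.succ) :=
      commute_listProd fun c => (h _ _ (Fin.succ_ne_zero c)).symm
    rw [listProd_succ, listProd_succ a, listProd_succ b, h1, mul_assoc, mul_assoc,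
      ← mul_assoc (b 0), h2.eq, mul_assoc]

variable [Algebra ℂ R]

lemma mul_pow_of_commutator {u q : R} {κ : ℂ} (h : q * u - u * q = κ • 1) (k : ℕ) :
    u * q ^ k = q ^ k * u - (k * κ : ℂ) • q ^ (k - 1) := by
  induction k with
  | zero => simp
  | succ k ih =>
    have e : u * q = q * u - κ • 1 := by rw [← h]; abel
    have e2 : (k * κ : ℂ) • (q ^ (k - 1) * q) = (k * κ : ℂ) • q ^ k := by
      rcases k with _ | k
      · simp
      · rw [← pow_succ, Nat.add_sub_cancel]
    rw [pow_succ, ← mul_assoc, ih, sub_mul, mul_assoc, e, mul_sub, mul_smul_comm, mul_one,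
      smul_mul_assoc, e2, Nat.add_sub_cancel, mul_assoc]
    push_cast
    module

/-- Moving powers of a derivation-like element `q` to the left of powers of `u`. -/
lemma pow_mul_pow_of_commutator {u q : R} {κ : ℂ} (h : q * u - u * q = κ • 1) (a k : ℕ) :
    u ^ a * q ^ k = ∑ m ∈ Finset.range (a + 1),
      (a.choose m * k.descFactorial m * (-κ) ^ m : ℂ) • (q ^ (k - m) * u ^ (a - m)) := by
  induction a with
  | zero => simp
  | succ a ih =>
    set t : ℕ → R := fun m => (k.descFactorial m * (-κ) ^ m : ℂ) • (q ^ (k - m) * u ^ (a + 1 - m))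
      with ht
    have h1 : ∀ m ∈ Finset.range (a + 1), u * ((a.choose m * k.descFactorial m * (-κ) ^ m : ℂ)
        • (q ^ (k - m) * u ^ (a - m)))
        = (a.choose m : ℂ) • t m + (a.choose m : ℂ) • t (m + 1) := by
      intro m hm
      have hma : a + 1 - m = a - m + 1 := by
        have := Finset.mem_range.1 hm
        omega
      have hd : ((k - m : ℕ) * k.descFactorial m : ℂ) = k.descFactorial (m + 1) := by
        rw [Nat.descFactorial_succ]
        push_cast
        rfl
      simp only [ht, hma, Nat.add_sub_add_right]
      rw [mul_smul_comm, ← mul_assoc, mul_pow_of_commutator h, sub_mul, smul_mul_assoc,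
        mul_assoc (q ^ (k - m)), ← pow_succ', ← hd, Nat.sub_sub, pow_succ (-κ)]
      module
    have h2 : ∑ m ∈ Finset.range (a + 1), (a.choose m : ℂ) • t m
        = t 0 + ∑ m ∈ Finset.range (a + 1), (a.choose (m + 1) : ℂ) • t (m + 1) := by
      have := Finset.sum_range_succ (fun m => (a.choose m : ℂ) • t m) (a + 1)
      rw [Finset.sum_range_succ'] at this
      simp only [Nat.choose_succ_self, Nat.cast_zero, zero_smul, add_zero, Nat.choose_zero_right,
        Nat.cast_one, one_smul] at this
      rw [← this, add_comm]
    have h3 : ∀ m, ((a + 1).choose m * k.descFactorial m * (-κ) ^ m : ℂ)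
        • (q ^ (k - m) * u ^ (a + 1 - m)) = ((a + 1).choose m : ℂ) • t m := by
      intro m
      simp only [ht, smul_smul, mul_assoc]
    rw [pow_succ', mul_assoc, ih, Finset.mul_sum, Finset.sum_congr rfl h1, Finset.sum_add_distrib,
      h2, Finset.sum_congr rfl fun m _ => h3 m, Finset.sum_range_succ' _ (a + 1)]
    simp only [Nat.choose_zero_right, Nat.cast_one, one_smul, Nat.choose_succ_succ, Nat.cast_add,
      add_smul, Finset.sum_add_distrib]
    abel

/-- The combinatorial coefficient of `lossQ`, without the sign and the powers of two. -/
lemma choose_mul_choose_eq {l j k m : ℕ} (hj : j + m ≤ l) (hk : k + m ≤ l) :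
    (l.choose j * l.choose (k + m) * ((l - j).choose m * (k + m).descFactorial m) : ℂ)
      = (l.factorial : ℂ) ^ 2 / ((m.factorial : ℂ) * (j.factorial : ℂ) * (k.factorial : ℂ) *
        ((l - k - m).factorial : ℂ) * ((l - j - m).factorial : ℂ)) := by
  have h1 : (l.choose j : ℂ) * (j.factorial * (l - j).factorial) = l.factorial := by
    exact_mod_cast (by rw [← mul_assoc]; exact Nat.choose_mul_factorial_mul_factorial (by omega) :
      l.choose j * (j.factorial * (l - j).factorial) = l.factorial)
  have h2 : (l.choose (k + m) : ℂ) * ((k + m).factorial * (l - k - m).factorial)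
      = l.factorial := by
    rw [Nat.sub_sub]
    exact_mod_cast (by rw [← mul_assoc]; exact Nat.choose_mul_factorial_mul_factorial hk :
      l.choose (k + m) * ((k + m).factorial * (l - (k + m)).factorial) = l.factorial)
  have h3 : ((l - j).choose m : ℂ) * (m.factorial * (l - j - m).factorial)
      = (l - j).factorial := by
    exact_mod_cast (by rw [← mul_assoc]; exact Nat.choose_mul_factorial_mul_factorial (by omega) :
      (l - j).choose m * (m.factorial * (l - j - m).factorial) = (l - j).factorial)
  have h4 : (k.factorial : ℂ) * (k + m).descFactorial m = (k + m).factorial := by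
    have := Nat.factorial_mul_descFactorial (Nat.le_add_left m k)
    rw [Nat.add_sub_cancel] at this
    exact_mod_cast this
  have n1 : ((l - j).factorial : ℂ) ≠ 0 := by exact_mod_cast (Nat.factorial_pos _).ne'
  have n2 : ((k + m).factorial : ℂ) ≠ 0 := by exact_mod_cast (Nat.factorial_pos _).ne'
  have n3 : (m.factorial : ℂ) ≠ 0 := by exact_mod_cast (Nat.factorial_pos _).ne'
  have n4 : (j.factorial : ℂ) ≠ 0 := by exact_mod_cast (Nat.factorial_pos _).ne'
  have n5 : (k.factorial : ℂ) ≠ 0 := by exact_mod_cast (Nat.factorial_pos _).ne'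
  have n6 : ((l - k - m).factorial : ℂ) ≠ 0 := by exact_mod_cast (Nat.factorial_pos _).ne'
  have n7 : ((l - j - m).factorial : ℂ) ≠ 0 := by exact_mod_cast (Nat.factorial_pos _).ne'
  rw [eq_div_iff (by positivity)]
  apply mul_left_cancel₀ (mul_ne_zero n1 n2)
  calc _ = ((l.choose j : ℂ) * (j.factorial * (l - j).factorial))
        * ((l.choose (k + m) : ℂ) * ((k + m).factorial * (l - k - m).factorial))
        * (((l - j).choose m : ℂ) * (m.factorial * (l - j - m).factorial))
        * ((k.factorial : ℂ) * (k + m).descFactorial m) := by ring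
    _ = _ := by rw [h1, h2, h3, h4]; ring

/-- Anti-normal ordering of `(p + u)^l (v + q)^l`, where only `q` and `u` (and possibly `p` and
`v`) fail to commute. -/
lemma pow_mul_pow_antinormal {p u v q : R} {κ : ℂ} (hpu : Commute p u) (hvq : Commute v q)
    (hqu : q * u - u * q = κ • 1) (l : ℕ) :
    (p + u) ^ l * (v + q) ^ l = ∑ j ∈ Finset.range (l + 1), ∑ k ∈ Finset.range (l + 1),
      ∑ m ∈ Finset.range (l - max j k + 1),
        ((l.factorial : ℂ) ^ 2 / ((m.factorial : ℂ) * (j.factorial : ℂ) * (k.factorial : ℂ) *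
          ((l - k - m).factorial : ℂ) * ((l - j - m).factorial : ℂ)) * (-κ) ^ m)
          • (p ^ j * q ^ k * (u ^ (l - j - m) * v ^ (l - k - m))) := by
  rw [hpu.add_pow, add_comm v q, hvq.symm.add_pow, Finset.sum_mul]
  refine Finset.sum_congr rfl fun j hj => ?_
  have hjl : j ≤ l := Nat.lt_succ_iff.1 (Finset.mem_range.1 hj)
  rw [Finset.mul_sum]
  have h1 : ∀ k ∈ Finset.range (l + 1), p ^ j * u ^ (l - j) * (l.choose j : R)
      * (q ^ k * v ^ (l - k) * (l.choose k : R))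
      = ∑ m ∈ Finset.range (l - j + 1),
        (l.choose j * l.choose k * ((l - j).choose m * k.descFactorial m) * (-κ) ^ m : ℂ)
          • (p ^ j * q ^ (k - m) * (u ^ (l - j - m) * v ^ (l - k))) := by
    intro k _
    have c1 : (l.choose j : R) = algebraMap ℂ R (l.choose j) := by simp
    have c2 : (l.choose k : R) = algebraMap ℂ R (l.choose k) := by simp
    have e : p ^ j * u ^ (l - j) * (l.choose j : R) * (q ^ k * v ^ (l - k) * (l.choose k : R))
        = (l.choose j * l.choose k : ℂ) • (p ^ j * (u ^ (l - j) * q ^ k) * v ^ (l - k)) := by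
      rw [c1, c2, ← Algebra.commutes, ← Algebra.commutes, ← Algebra.smul_def, ← Algebra.smul_def,
        smul_mul_smul_comm]
      simp only [mul_assoc]
    rw [e, pow_mul_pow_of_commutator hqu, Finset.mul_sum, Finset.sum_mul, Finset.smul_sum]
    refine Finset.sum_congr rfl fun m _ => ?_
    rw [mul_smul_comm, smul_mul_assoc, smul_smul]
    congr 1
    · ring
    · simp only [mul_assoc]
  rw [Finset.sum_congr rfl h1, Finset.sum_sigma', Finset.sum_sigma']
  -- the contraction of `m` pairs lowers the exponent `k` of `q` by `m`
  refine Finset.sum_bij_ne_zero (fun a _ _ => ⟨a.1 - a.2, a.2⟩) ?_ ?_ ?_ ?_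
  · rintro ⟨k, m⟩ ha hne
    have hm : m ≤ k := by
      by_contra hlt
      exact hne (by rw [Nat.descFactorial_of_lt (by omega : k < m)]; simp)
    simp only [Finset.mem_sigma, Finset.mem_range] at ha ⊢
    omega
  · rintro ⟨k, m⟩ ha hne ⟨k', m'⟩ ha' hne' h
    have hm : m ≤ k := by
      by_contra hlt
      exact hne (by rw [Nat.descFactorial_of_lt (by omega : k < m)]; simp)
    have hm' : m' ≤ k' := by
      by_contra hlt
      exact hne' (by rw [Nat.descFactorial_of_lt (by omega : k' < m')]; simp)
    simp only [Sigma.mk.injEq, heq_eq_eq] at h ⊢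
    omega
  · rintro ⟨k, m⟩ ha hne
    simp only [Finset.mem_sigma, Finset.mem_range] at ha
    have e : l - (k + m) = l - k - m := by omega
    have hne2 : (l.choose j * l.choose (k + m) * ((l - j).choose m * (k + m).descFactorial m)
        * (-κ) ^ m : ℂ) • (p ^ j * q ^ (k + m - m) * (u ^ (l - j - m) * v ^ (l - (k + m)))) ≠ 0 := by
      rw [choose_mul_choose_eq (by omega) (by omega), Nat.add_sub_cancel, e]
      exact hne
    refine ⟨⟨k + m, m⟩, ?_, hne2, ?_⟩
    · simp only [Finset.mem_sigma, Finset.mem_range]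
      omega
    · simp
  · rintro ⟨k, m⟩ ha hne
    have hm : m ≤ k := by
      by_contra hlt
      exact hne (by rw [Nat.descFactorial_of_lt (by omega : k < m)]; simp)
    simp only [Finset.mem_sigma, Finset.mem_range] at ha
    have e := choose_mul_choose_eq (l := l) (j := j) (k := k - m) (m := m) (by omega) (by omega)
    rw [Nat.sub_add_cancel hm] at e
    have e2 : l - k = l - (k - m) - m := by omega
    simp only
    rw [e, e2]

lemma listProd_sum {s : Fin C → Finset ℕ} (g : (c : Fin C) → ℕ → R) :
    listProd (fun c => ∑ j ∈ s c, g c j)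
      = ∑ j ∈ Fintype.piFinset s, listProd fun c => g c (j c) :=
  (MultilinearMap.mkPiAlgebraFin ℂ C R).map_sum_finset g s

lemma listProd_smul (r : Fin C → ℂ) (a : Fin C → R) :
    listProd (fun c => r c • a c) = (∏ c, r c) • listProd a :=
  (MultilinearMap.mkPiAlgebraFin ℂ C R).map_smul_univ r a

/-- Multiplication operators `X_c`, `Y_c` and derivations `d_c`, `e_c` with the commutation
relations of `Ψ_c`, `Ψ_c^*`, `δ/δΨ_c`, `δ/δΨ_c^*` at one point, where `[d_c, X_c] = [e_c, Y_c]` is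
the scalar `δ_c` and all other pairs commute. -/
structure IsWeylFamily (X Y d e : Fin C → R) (δ : Fin C → ℂ) : Prop where
  XX : ∀ c c', Commute (X c) (X c')
  XY : ∀ c c', Commute (X c) (Y c')
  YY : ∀ c c', Commute (Y c) (Y c')
  dd : ∀ c c', Commute (d c) (d c')
  de : ∀ c c', Commute (d c) (e c')
  ee : ∀ c c', Commute (e c) (e c')
  dY : ∀ c c', Commute (d c) (Y c')
  eX : ∀ c c', Commute (e c) (X c')
  dX : ∀ c c', c ≠ c' → Commute (d c) (X c')
  eY : ∀ c c', c ≠ c' → Commute (e c) (Y c')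
  dX_self : ∀ c, d c * X c - X c * d c = δ c • 1
  eY_self : ∀ c, e c * Y c - Y c * e c = δ c • 1

namespace IsWeylFamily

variable {X Y d e : Fin C → R} {δ : Fin C → ℂ}

/-- The subalgebra of one component. -/
def compAlg (X Y d e : Fin C → R) (c : Fin C) : Subalgebra ℂ R :=
  Algebra.adjoin ℂ {X c, Y c, d c, e c}

lemma X_mem (c : Fin C) : X c ∈ compAlg X Y d e c := Algebra.subset_adjoin (by simp)

lemma Y_mem (c : Fin C) : Y c ∈ compAlg X Y d e c := Algebra.subset_adjoin (by simp)

lemma d_mem (c : Fin C) : d c ∈ compAlg X Y d e c := Algebra.subset_adjoin (by simp)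

lemma e_mem (c : Fin C) : e c ∈ compAlg X Y d e c := Algebra.subset_adjoin (by simp)

lemma commute_of_mem (h : IsWeylFamily X Y d e δ) {c c' : Fin C} (hc : c ≠ c') {a b : R}
    (ha : a ∈ compAlg X Y d e c) (hb : b ∈ compAlg X Y d e c') : Commute a b := by
  have h1 : ∀ x ∈ ({X c, Y c, d c, e c} : Set R), ∀ y ∈ ({X c', Y c', d c', e c'} : Set R),
      Commute x y := by
    simp only [Set.mem_insert_iff, Set.mem_singleton_iff, forall_eq_or_imp, forall_eq]
    exact ⟨⟨h.XX _ _, h.XY _ _, (h.dX _ _ hc.symm).symm, (h.eX _ _).symm⟩,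
      ⟨(h.XY _ _).symm, h.YY _ _, (h.dY _ _).symm, (h.eY _ _ hc.symm).symm⟩,
      ⟨h.dX _ _ hc, h.dY _ _, h.dd _ _, h.de _ _⟩,
      ⟨h.eX _ _, h.eY _ _ hc, (h.de _ _).symm, h.ee _ _⟩⟩
  have h2 : ∀ x ∈ ({X c, Y c, d c, e c} : Set R), Commute x b := fun x hx =>
    Algebra.commute_of_mem_adjoin_of_forall_mem_commute hb fun y hy => h1 x hx y hy
  exact (Algebra.commute_of_mem_adjoin_of_forall_mem_commute ha fun x hx => (h2 x hx).symm).symm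

/-- The polynomial coefficient of one component. -/
def compCoeff (X Y : Fin C → R) (δ : Fin C → ℂ) (l : Fin C → ℕ) (c : Fin C) (j k : ℕ) : R :=
  ∑ m ∈ Finset.range (l c - max j k + 1),
    (lossQ (l c) j k m * δ c ^ m) • (X c ^ (l c - j - m) * Y c ^ (l c - k - m))

lemma compCoeff_mem (l : Fin C → ℕ) (c : Fin C) (j k : ℕ) :
    compCoeff X Y δ l c j k ∈ compAlg X Y d e c :=
  Subalgebra.sum_mem _ fun _ _ => Subalgebra.smul_mem _ (Subalgebra.mul_mem _
    (Subalgebra.pow_mem _ (X_mem c) _) (Subalgebra.pow_mem _ (Y_mem c) _)) _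

lemma comp_left (h : IsWeylFamily X Y d e δ) (t : ℂ) (l : Fin C → ℕ) (c : Fin C) :
    (Y c + (t / 2) • d c) ^ l c * (X c + (1 / 2 : ℂ) • e c) ^ l c
      = ∑ j ∈ Finset.range (l c + 1), ∑ k ∈ Finset.range (l c + 1),
        t ^ k • (e c ^ j * d c ^ k * compCoeff X Y δ l c j k) := by
  have hqu : ((1 / 2 : ℂ) • e c) * Y c - Y c * ((1 / 2 : ℂ) • e c) = (δ c / 2) • 1 := by
    rw [smul_mul_assoc, mul_smul_comm, ← smul_sub, h.eY_self, smul_smul]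
    congr 1
    ring
  rw [add_comm (Y c), pow_mul_pow_antinormal (((h.dY c c).smul_left _))
    ((h.eX c c).symm.smul_right _) hqu, Finset.sum_comm]
  refine Finset.sum_congr rfl fun j _ => Finset.sum_congr rfl fun k _ => ?_
  rw [compCoeff, Finset.mul_sum, Finset.smul_sum, max_comm]
  refine Finset.sum_congr rfl fun m _ => ?_
  rw [smul_pow, smul_pow, smul_mul_smul_comm, smul_mul_assoc, mul_smul_comm, smul_smul, smul_smul,
    ((h.de c c).pow_pow k j).eq, ((h.XY c c).pow_pow _ _).eq]
  congr 1
  simp only [lossQ, one_div]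
  rw [show -(δ c / 2) = (-1) * δ c * 2⁻¹ by ring, mul_pow, mul_pow, div_pow, inv_pow, inv_pow,
    pow_add, pow_add]
  ring

lemma comp_right (h : IsWeylFamily X Y d e δ) (l : Fin C → ℕ) (c : Fin C) :
    (X c - (1 / 2 : ℂ) • e c) ^ l c * (Y c + (1 / 2 : ℂ) • d c) ^ l c
      = ∑ j ∈ Finset.range (l c + 1), ∑ k ∈ Finset.range (l c + 1),
        (-1 : ℂ) ^ j • (e c ^ j * d c ^ k * compCoeff X Y δ l c j k) := by
  have hqu : ((1 / 2 : ℂ) • d c) * X c - X c * ((1 / 2 : ℂ) • d c) = (δ c / 2) • 1 := by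
    rw [smul_mul_assoc, mul_smul_comm, ← smul_sub, h.dX_self, smul_smul]
    congr 1
    ring
  have e1 : X c - (1 / 2 : ℂ) • e c = (-(1 / 2) : ℂ) • e c + X c := by
    rw [neg_smul]
    abel
  rw [e1, pow_mul_pow_antinormal (((h.eX c c).smul_left _)) ((h.dY c c).symm.smul_right _) hqu]
  refine Finset.sum_congr rfl fun j _ => Finset.sum_congr rfl fun k _ => ?_
  rw [compCoeff, Finset.mul_sum, Finset.smul_sum]
  refine Finset.sum_congr rfl fun m _ => ?_
  rw [smul_pow, smul_pow, smul_mul_smul_comm, smul_mul_assoc, mul_smul_comm, smul_smul, smul_smul]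
  congr 1
  simp only [lossQ, one_div]
  rw [show -(δ c / 2) = (-1) * δ c * 2⁻¹ by ring, show (-2⁻¹ : ℂ) = (-1) * 2⁻¹ by ring,
    mul_pow, mul_pow, mul_pow, inv_pow, inv_pow, inv_pow, pow_add, pow_add]
  ring

/-- Collecting a product over components of anti-normally ordered sums. -/
lemma listProd_comp (h : IsWeylFamily X Y d e δ) (l : Fin C → ℕ) (s t : ℂ) :
    listProd (fun c => ∑ j ∈ Finset.range (l c + 1), ∑ k ∈ Finset.range (l c + 1),
        (s ^ j * t ^ k) • (e c ^ j * d c ^ k * compCoeff X Y δ l c j k))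
      = ∑ j ∈ indexBox l, ∑ k ∈ indexBox l, (s ^ (∑ c, j c) * t ^ (∑ c, k c)) •
        (listProd (fun c => e c ^ j c * d c ^ k c)
          * listProd fun c => compCoeff X Y δ l c (j c) (k c)) := by
  rw [listProd_sum]
  refine Finset.sum_congr rfl fun j _ => ?_
  rw [listProd_sum fun c k => (s ^ (j c) * t ^ k)
    • (e c ^ (j c) * d c ^ k * compCoeff X Y δ l c (j c) k)]
  refine Finset.sum_congr rfl fun k _ => ?_
  rw [listProd_smul, listProd_mul fun c c' hc => h.commute_of_mem hc
    (mul_mem (pow_mem (e_mem c) _) (pow_mem (d_mem c) _)) (compCoeff_mem l c' _ _),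
    Finset.prod_mul_distrib, Finset.prod_pow_eq_pow_sum, Finset.prod_pow_eq_pow_sum]

end IsWeylFamily

/-- The loss operator `2 O A O† - O† O A - A O† O` in terms of the actions of the field operators
(`Lo`, `Ro`) and their adjoints (`Ld`, `Rd`) from the left and from the right. -/
def lossAction (Lo Ld Ro Rd : Fin C → R) (l : Fin C → ℕ) : R :=
  (2 : ℂ) • (listProd (fun c => Rd c ^ l c) * listProd fun c => Lo c ^ l c)
    - listProd (fun c => Ld c ^ l c) * listProd (fun c => Lo c ^ l c)
    - listProd (fun c => Ro c ^ l c) * listProd (fun c => Rd c ^ l c)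

lemma map_lossAction {R' : Type*} [Ring R'] [Algebra ℂ R'] (f : R →ₐ[ℂ] R') (Lo Ld Ro Rd : Fin C → R)
    (l : Fin C → ℕ) : f (lossAction Lo Ld Ro Rd l)
      = lossAction (fun c => f (Lo c)) (fun c => f (Ld c)) (fun c => f (Ro c)) (fun c => f (Rd c))
        l := by
  have h : ∀ a : Fin C → R, f (listProd a) = listProd fun c => f (a c) := fun a => by
    rw [listProd, map_list_prod, List.map_ofFn]
    rfl
  simp only [lossAction, map_sub, map_smul, map_mul, map_pow, h]

lemma lossAction_apply {α : Type*} (Lo Ld Ro Rd : Fin C → α → R)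
    (l : Fin C → ℕ) (x : α) :
    lossAction Lo Ld Ro Rd l x
      = lossAction (fun c => Lo c x) (fun c => Ld c x) (fun c => Ro c x) (fun c => Rd c x) l :=
  map_lossAction (Pi.evalAlgHom ℂ (fun _ : α => R) x) Lo Ld Ro Rd l

open IsWeylFamily in
/-- The differential form of the loss operator, with all derivatives to the left. -/
lemma IsWeylFamily.lossAction_eq {X Y d e : Fin C → R} {δ : Fin C → ℂ}
    (h : IsWeylFamily X Y d e δ) (l : Fin C → ℕ) :
    lossAction (fun c => X c + (1 / 2 : ℂ) • e c) (fun c => Y c - (1 / 2 : ℂ) • d c)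
        (fun c => X c - (1 / 2 : ℂ) • e c) (fun c => Y c + (1 / 2 : ℂ) • d c) l
      = ∑ j ∈ indexBox l, ∑ k ∈ indexBox l, listProd (fun c => e c ^ j c * d c ^ k c)
        * ((2 - (-1) ^ (∑ c, j c) - (-1) ^ (∑ c, k c) : ℂ)
          • listProd fun c => compCoeff X Y δ l c (j c) (k c)) := by
  have mX : ∀ (a : ℂ) c, X c + a • e c ∈ compAlg X Y d e c := fun a c =>
    add_mem (X_mem c) (Subalgebra.smul_mem _ (e_mem c) a)
  have mY : ∀ (a : ℂ) c, Y c + a • d c ∈ compAlg X Y d e c := fun a c =>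
    add_mem (Y_mem c) (Subalgebra.smul_mem _ (d_mem c) a)
  have hleft : ∀ t : ℂ, listProd (fun c => (Y c + (t / 2) • d c) ^ l c)
      * listProd (fun c => (X c + (1 / 2 : ℂ) • e c) ^ l c)
      = ∑ j ∈ indexBox l, ∑ k ∈ indexBox l, ((1 : ℂ) ^ (∑ c, j c) * t ^ (∑ c, k c)) •
        (listProd (fun c => e c ^ j c * d c ^ k c)
          * listProd fun c => compCoeff X Y δ l c (j c) (k c)) := by
    intro t
    rw [← listProd_mul fun c c' hc => h.commute_of_mem hc (pow_mem (mY _ c) _) (pow_mem (mX _ c') _),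
      ← h.listProd_comp]
    congr 1
    funext c
    rw [h.comp_left]
    simp only [one_pow, one_mul]
  have hright : listProd (fun c => (X c - (1 / 2 : ℂ) • e c) ^ l c)
      * listProd (fun c => (Y c + (1 / 2 : ℂ) • d c) ^ l c)
      = ∑ j ∈ indexBox l, ∑ k ∈ indexBox l, ((-1 : ℂ) ^ (∑ c, j c) * 1 ^ (∑ c, k c)) •
        (listProd (fun c => e c ^ j c * d c ^ k c)
          * listProd fun c => compCoeff X Y δ l c (j c) (k c)) := by
    rw [← listProd_mul fun c c' hc => h.commute_of_mem hc
        (pow_mem (by simpa [sub_eq_add_neg] using mX (-(1 / 2)) c) _) (pow_mem (mY _ c') _),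
      ← h.listProd_comp]
    congr 1
    funext c
    rw [h.comp_right]
    simp only [one_pow, mul_one]
  have h2 := hleft (-1)
  have e2 : (fun c => (Y c + (-1 / 2 : ℂ) • d c) ^ l c)
      = fun c => (Y c - (1 / 2 : ℂ) • d c) ^ l c := by
    funext c
    rw [sub_eq_add_neg, ← neg_smul]
    norm_num
  rw [e2] at h2
  rw [lossAction, hleft 1, h2, hright]
  simp only [Finset.smul_sum, ← Finset.sum_sub_distrib]
  refine Finset.sum_congr rfl fun j _ => Finset.sum_congr rfl fun k _ => ?_
  simp only [one_pow, mul_one, one_mul, one_smul, mul_smul_comm]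
  module

end WeylAlgebra

/-! ### Differential operators with polynomial coefficients on phase space -/

section DiffRep

variable {V : Type*} [AddCommGroup V] [Module ℂ V] {𝒜 : Subalgebra ℂ (Phase ι → ℂ)}

/-- An action of functions and of directional derivatives on a space `V` of (generalized) functions
on phase space: multiplication by the functions in `𝒜` and commuting derivations `𝒟 v` that obey
the product rule for the coordinates and their conjugates. -/
structure IsDiffRep (ρ : 𝒜 →ₐ[ℂ] Module.End ℂ V) (𝒟 : Phase ι → Module.End ℂ V) : Prop where
  coord_mem : ∀ i, (fun Ψ : Phase ι => Ψ i) ∈ 𝒜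
  conj_mem : ∀ i, (fun Ψ : Phase ι => conj (Ψ i)) ∈ 𝒜
  comm : ∀ v w, Commute (𝒟 v) (𝒟 w)
  coord : ∀ v i, 𝒟 v * ρ ⟨_, coord_mem i⟩ - ρ ⟨_, coord_mem i⟩ * 𝒟 v = v i • 1
  conj_coord : ∀ v i, 𝒟 v * ρ ⟨_, conj_mem i⟩ - ρ ⟨_, conj_mem i⟩ * 𝒟 v = conj (v i) • 1

open Classical in
/-- The Wirtinger derivative `∂/∂α_i` formed from directional derivatives. -/
def wirtingerOf (𝒟 : Phase ι → Module.End ℂ V) (i : Mode ι) : Module.End ℂ V :=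
  (1 / 2 : ℂ) • (𝒟 (Pi.single i 1) - Complex.I • 𝒟 (Pi.single i Complex.I))

open Classical in
/-- The Wirtinger derivative `∂/∂α_i^*` formed from directional derivatives. -/
def wirtingerStarOf (𝒟 : Phase ι → Module.End ℂ V) (i : Mode ι) : Module.End ℂ V :=
  (1 / 2 : ℂ) • (𝒟 (Pi.single i 1) + Complex.I • 𝒟 (Pi.single i Complex.I))

namespace IsDiffRep

variable {ρ : 𝒜 →ₐ[ℂ] Module.End ℂ V} {𝒟 : Phase ι → Module.End ℂ V}

/-- Multiplication by the coordinate `α_i`. -/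
def mulCoord (h : IsDiffRep ρ 𝒟) (i : Mode ι) : Module.End ℂ V := ρ ⟨_, h.coord_mem i⟩

/-- Multiplication by the conjugate coordinate `α_i^*`. -/
def mulConj (h : IsDiffRep ρ 𝒟) (i : Mode ι) : Module.End ℂ V := ρ ⟨_, h.conj_mem i⟩

lemma commutator_of_directional {A B T : Module.End ℂ V} {a b s : ℂ} (hA : A * T - T * A = a • 1)
    (hB : B * T - T * B = b • 1) :
    (1 / 2 : ℂ) • (A + s • B) * T - T * (1 / 2 : ℂ) • (A + s • B)
      = ((1 / 2) * (a + s * b)) • 1 := by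
  rw [smul_mul_assoc, mul_smul_comm, add_mul, mul_add, smul_mul_assoc, mul_smul_comm,
    eq_add_of_sub_eq hA, eq_add_of_sub_eq hB]
  module

lemma commute_coord (h : IsDiffRep ρ 𝒟) (i j : Mode ι) : Commute (h.mulCoord i) (h.mulCoord j) :=
  (Commute.all _ _).map ρ

lemma commute_coord_conj (h : IsDiffRep ρ 𝒟) (i j : Mode ι) :
    Commute (h.mulCoord i) (h.mulConj j) :=
  (Commute.all _ _).map ρ

lemma commute_conj (h : IsDiffRep ρ 𝒟) (i j : Mode ι) : Commute (h.mulConj i) (h.mulConj j) :=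
  (Commute.all _ _).map ρ

lemma commute_deriv (h : IsDiffRep ρ 𝒟) {a b : ℂ} (v w v' w' : Phase ι) :
    Commute ((1 / 2 : ℂ) • (𝒟 v + a • 𝒟 w)) ((1 / 2 : ℂ) • (𝒟 v' + b • 𝒟 w')) := by
  refine Commute.smul_left (Commute.smul_right ?_ _) _
  exact ((h.comm _ _).add_right ((h.comm _ _).smul_right _)).add_left
    (((h.comm _ _).add_right ((h.comm _ _).smul_right _)).smul_left _)

lemma wirtingerOf_eq (𝒟 : Phase ι → Module.End ℂ V) (i : Mode ι) [DecidableEq (Mode ι)] :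
    wirtingerOf 𝒟 i
      = (1 / 2 : ℂ) • (𝒟 (Pi.single i 1) + (-Complex.I) • 𝒟 (Pi.single i Complex.I)) := by
  rw [wirtingerOf, neg_smul, sub_eq_add_neg]
  congr!

lemma wirtingerStarOf_eq (𝒟 : Phase ι → Module.End ℂ V) (i : Mode ι) [DecidableEq (Mode ι)] :
    wirtingerStarOf 𝒟 i
      = (1 / 2 : ℂ) • (𝒟 (Pi.single i 1) + Complex.I • 𝒟 (Pi.single i Complex.I)) := by
  rw [wirtingerStarOf]
  congr!

open Classical in
lemma wirtinger_coord (h : IsDiffRep ρ 𝒟) (i j : Mode ι) :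
    wirtingerOf 𝒟 i * h.mulCoord j - h.mulCoord j * wirtingerOf 𝒟 i
      = (if j = i then (1 : ℂ) else 0) • 1 := by
  rw [wirtingerOf_eq, mulCoord, commutator_of_directional (h.coord _ j) (h.coord _ j)]
  congr 1
  rcases eq_or_ne j i with rfl | hj
  · simp; norm_num
  · simp [hj]

open Classical in
lemma wirtinger_conj (h : IsDiffRep ρ 𝒟) (i j : Mode ι) :
    Commute (wirtingerOf 𝒟 i) (h.mulConj j) := by
  refine sub_eq_zero.1 ?_
  rw [wirtingerOf_eq, mulConj, commutator_of_directional (h.conj_coord _ j) (h.conj_coord _ j)]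
  rcases eq_or_ne j i with rfl | hj
  · simp
  · simp [hj]

open Classical in
lemma wirtingerStar_coord (h : IsDiffRep ρ 𝒟) (i j : Mode ι) :
    Commute (wirtingerStarOf 𝒟 i) (h.mulCoord j) := by
  refine sub_eq_zero.1 ?_
  rw [wirtingerStarOf_eq, mulCoord, commutator_of_directional (h.coord _ j) (h.coord _ j)]
  rcases eq_or_ne j i with rfl | hj
  · simp
  · simp [hj]

open Classical in
lemma wirtingerStar_conj (h : IsDiffRep ρ 𝒟) (i j : Mode ι) :
    wirtingerStarOf 𝒟 i * h.mulConj j - h.mulConj j * wirtingerStarOf 𝒟 i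
      = (if j = i then (1 : ℂ) else 0) • 1 := by
  rw [wirtingerStarOf_eq, mulConj, commutator_of_directional (h.conj_coord _ j) (h.conj_coord _ j)]
  congr 1
  rcases eq_or_ne j i with rfl | hj
  · simp; norm_num
  · simp [hj]

lemma commute_wirtinger (h : IsDiffRep ρ 𝒟) (i j : Mode ι) :
    Commute (wirtingerOf 𝒟 i) (wirtingerOf 𝒟 j) := by
  classical
  rw [wirtingerOf_eq, wirtingerOf_eq]
  exact h.commute_deriv _ _ _ _

lemma commute_wirtinger_wirtingerStar (h : IsDiffRep ρ 𝒟) (i j : Mode ι) :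
    Commute (wirtingerOf 𝒟 i) (wirtingerStarOf 𝒟 j) := by
  classical
  rw [wirtingerOf_eq, wirtingerStarOf_eq]
  exact h.commute_deriv _ _ _ _

lemma commute_wirtingerStar (h : IsDiffRep ρ 𝒟) (i j : Mode ι) :
    Commute (wirtingerStarOf 𝒟 i) (wirtingerStarOf 𝒟 j) := by
  classical
  rw [wirtingerStarOf_eq, wirtingerStarOf_eq]
  exact h.commute_deriv _ _ _ _

end IsDiffRep

/-- The combination `∑ n, a_{c,n} T_{c,n}` of operators labelled by modes. -/
def modeSum {R : Type*} [AddCommMonoid R] [Module ℂ R] [∀ c, Fintype (ι c)]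
    (a : (c : Fin C) → ι c → ℂ) (T : Mode ι → R) (c : Fin C) : R := ∑ n, a c n • T ⟨c, n⟩

section ModeSum

variable [∀ c, Fintype (ι c)] {R : Type*} [Ring R] [Algebra ℂ R]

lemma map_modeSum {R' : Type*} [Ring R'] [Algebra ℂ R'] (f : R →ₐ[ℂ] R') (a : (c : Fin C) → ι c → ℂ)
    (T : Mode ι → R) (c : Fin C) : f (modeSum a T c) = modeSum a (fun i => f (T i)) c := by
  simp only [modeSum, map_sum, map_smul]

lemma commute_modeSum {S T : Mode ι → R} (a b : (c : Fin C) → ι c → ℂ) {c c' : Fin C}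
    (h : ∀ n n', Commute (S ⟨c, n⟩) (T ⟨c', n'⟩)) : Commute (modeSum a S c) (modeSum b T c') :=
  Commute.sum_left _ _ _ fun _ _ => Commute.sum_right _ _ _ fun _ _ =>
    ((h _ _).smul_left _).smul_right _

lemma commutator_modeSum {S T : Mode ι → R} (a b : (c : Fin C) → ι c → ℂ) (c : Fin C)
    [DecidableEq (Mode ι)]
    (h : ∀ i j, S i * T j - T j * S i = (if j = i then (1 : ℂ) else 0) • 1) :
    modeSum a S c * modeSum b T c - modeSum b T c * modeSum a S c
      = (∑ n, a c n * b c n) • (1 : R) := by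
  classical
  have e : modeSum a S c * modeSum b T c - modeSum b T c * modeSum a S c
      = ∑ n, ∑ n', (a c n * b c n')
        • (S ⟨c, n⟩ * T ⟨c, n'⟩ - T ⟨c, n'⟩ * S ⟨c, n⟩) := by
    simp only [smul_sub, Finset.sum_sub_distrib, modeSum]
    congr 1
    · rw [Finset.sum_mul_sum]
      simp only [smul_mul_smul_comm]
    · rw [Finset.sum_mul_sum, Finset.sum_comm]
      simp only [smul_mul_smul_comm, mul_comm]
  rw [e, Finset.sum_smul]
  refine Finset.sum_congr rfl fun n _ => ?_
  rw [Finset.sum_eq_single n]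
  · rw [h]
    simp
  · intro n' _ hn
    rw [h, if_neg (by simpa using hn), zero_smul, smul_zero]
  · simp

end ModeSum

variable [∀ c, Fintype (ι c)]

namespace IsDiffRep

variable {ρ : 𝒜 →ₐ[ℂ] Module.End ℂ V} {𝒟 : Phase ι → Module.End ℂ V}

lemma isWeylFamily (h : IsDiffRep ρ 𝒟) (a : (c : Fin C) → ι c → ℂ) :
    IsWeylFamily (modeSum a h.mulCoord) (modeSum (fun c n => conj (a c n)) h.mulConj)
      (modeSum (fun c n => conj (a c n)) (wirtingerOf 𝒟)) (modeSum a (wirtingerStarOf 𝒟))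
      (fun c => ∑ n, conj (a c n) * a c n) := by
  classical
  exact
  { XX := fun _ _ => commute_modeSum _ _ fun _ _ => h.commute_coord _ _
    XY := fun _ _ => commute_modeSum _ _ fun _ _ => h.commute_coord_conj _ _
    YY := fun _ _ => commute_modeSum _ _ fun _ _ => h.commute_conj _ _
    dd := fun _ _ => commute_modeSum _ _ fun _ _ => h.commute_wirtinger _ _
    de := fun _ _ => commute_modeSum _ _ fun _ _ => h.commute_wirtinger_wirtingerStar _ _
    ee := fun _ _ => commute_modeSum _ _ fun _ _ => h.commute_wirtingerStar _ _
    dY := fun _ _ => commute_modeSum _ _ fun _ _ => h.wirtinger_conj _ _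
    eX := fun _ _ => commute_modeSum _ _ fun _ _ => h.wirtingerStar_coord _ _
    dX := fun c c' hc => commute_modeSum _ _ fun n n' => sub_eq_zero.1 <| by
      rw [h.wirtinger_coord, if_neg fun e => hc (congrArg Sigma.fst e).symm, zero_smul]
    eY := fun c c' hc => commute_modeSum _ _ fun n n' => sub_eq_zero.1 <| by
      rw [h.wirtingerStar_conj, if_neg fun e => hc (congrArg Sigma.fst e).symm, zero_smul]
    dX_self := fun c => commutator_modeSum _ _ c h.wirtinger_coord
    eY_self := fun c => by
      rw [commutator_modeSum _ _ c h.wirtingerStar_conj]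
      simp only [mul_comm] }

open IsWeylFamily in
/-- Multiplication by the nonlinear loss coefficient in terms of multiplication by coordinates. -/
lemma exists_lossCoeff (h : IsDiffRep ρ 𝒟) (φ : (c : Fin C) → ι c → Space D → ℂ)
    (l j k : Fin C → ℕ) (x : Space D) :
    ∃ u : 𝒜, (u : Phase ι → ℂ) = lossCoeff φ l j k x ∧
      ρ u = (2 - (-1) ^ (∑ c, j c) - (-1) ^ (∑ c, k c) : ℂ) • listProd fun c =>
        compCoeff (modeSum (fun c n => φ c n x) h.mulCoord)
          (modeSum (fun c n => conj (φ c n x)) h.mulConj)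
          (fun c => ∑ n, conj (φ c n x) * φ c n x) l c (j c) (k c) := by
  set f : Fin C → 𝒜 := modeSum (fun c n => φ c n x) fun i => ⟨_, h.coord_mem i⟩ with hf
  set g : Fin C → 𝒜 := modeSum (fun c n => conj (φ c n x)) fun i => ⟨_, h.conj_mem i⟩ with hg
  refine ⟨(2 - (-1) ^ (∑ c, j c) - (-1) ^ (∑ c, k c) : ℂ) • listProd fun c =>
    compCoeff f g (fun c => ∑ n, conj (φ c n x) * φ c n x) l c (j c) (k c), ?_, ?_⟩
  · funext Ψ
    set ev : 𝒜 →ₐ[ℂ] ℂ := (Pi.evalAlgHom ℂ (fun _ : Phase ι => ℂ) Ψ).comp 𝒜.val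
    have e0 : ∀ u : 𝒜, (u : Phase ι → ℂ) Ψ = ev u := fun _ => rfl
    have ef : ∀ c, ev (f c) = field φ c Ψ x := fun c => by
      simp only [hf, modeSum, map_sum, map_smul, field, smul_eq_mul]
      rfl
    have eg : ∀ c, ev (g c) = conj (field φ c Ψ x) := fun c => by
      simp only [hg, modeSum, map_sum, map_smul, field, smul_eq_mul, map_mul]
      rfl
    rw [e0, map_smul, listProd, List.prod_ofFn, map_prod, lossCoeff, smul_eq_mul]
    simp only [compCoeff, map_sum, map_smul, map_mul, map_pow, ef, eg, smul_eq_mul,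
      restrictedDelta, mul_assoc]
  · have ef : ∀ c, ρ (f c) = modeSum (fun c n => φ c n x) h.mulCoord c := fun c => by
      simp only [hf, modeSum, map_sum, map_smul]
      rfl
    have eg : ∀ c, ρ (g c) = modeSum (fun c n => conj (φ c n x)) h.mulConj c := fun c => by
      simp only [hg, modeSum, map_sum, map_smul]
      rfl
    rw [map_smul, listProd, map_list_prod, List.map_ofFn, listProd]
    congr! 4
    simp only [Function.comp_apply, compCoeff, map_sum, map_smul, map_mul, map_pow, ef, eg]

/-- The loss operator on phase space, with the field operators acting from the left and from the
right as `Ψ_c ± ½ δ/δΨ_c^*` and their adjoints as `Ψ_c^* ∓ ½ δ/δΨ_c`. The values of the mode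
functions at a point are the coefficients `a`. -/
def lossOperator (h : IsDiffRep ρ 𝒟) (a : (c : Fin C) → ι c → ℂ) (l : Fin C → ℕ) :
    Module.End ℂ V :=
  lossAction (modeSum a fun i => h.mulCoord i + (1 / 2 : ℂ) • wirtingerStarOf 𝒟 i)
    (modeSum (fun c n => conj (a c n)) fun i => h.mulConj i - (1 / 2 : ℂ) • wirtingerOf 𝒟 i)
    (modeSum a fun i => h.mulCoord i - (1 / 2 : ℂ) • wirtingerStarOf 𝒟 i)
    (modeSum (fun c n => conj (a c n)) fun i => h.mulConj i + (1 / 2 : ℂ) • wirtingerOf 𝒟 i) l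

open IsWeylFamily in
lemma sum_eq_lossOperator (h : IsDiffRep ρ 𝒟) (a : (c : Fin C) → ι c → ℂ) (l : Fin C → ℕ) :
    ∑ j ∈ indexBox l, ∑ k ∈ indexBox l, listProd (fun c =>
        modeSum a (wirtingerStarOf 𝒟) c ^ j c
          * modeSum (fun c n => conj (a c n)) (wirtingerOf 𝒟) c ^ k c)
        * ((2 - (-1) ^ (∑ c, j c) - (-1) ^ (∑ c, k c) : ℂ) • listProd fun c =>
          compCoeff (modeSum a h.mulCoord) (modeSum (fun c n => conj (a c n)) h.mulConj)
            (fun c => ∑ n, conj (a c n) * a c n) l c (j c) (k c))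
      = h.lossOperator a l := by
  rw [← (h.isWeylFamily a).lossAction_eq, lossOperator]
  congr 1 <;> funext c <;>
    simp only [modeSum, smul_add, smul_sub, Finset.sum_add_distrib, Finset.sum_sub_distrib,
      Finset.smul_sum, smul_comm (1 / 2 : ℂ)]

end IsDiffRep

end DiffRep

/-! ### Operators on tempered distributions -/

section Distribution

variable [∀ c, Fintype (ι c)]

/-- The functions of temperate growth, which act on tempered distributions by multiplication. -/
def temperateGrowth (ι : Fin C → Type*) [∀ c, Fintype (ι c)] : Subalgebra ℂ (Phase ι → ℂ) where
  carrier := {g | g.HasTemperateGrowth}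
  mul_mem' := fun hf hg => hf.mul hg
  add_mem' := fun hf hg => hf.add hg
  algebraMap_mem' := fun c => .const c

/-- Multiplication of tempered distributions by functions of temperate growth. -/
def mulDist : temperateGrowth ι →ₐ[ℂ] Module.End ℂ 𝓢'(Phase ι, ℂ) :=
  AlgHom.ofLinearMap
    { toFun := fun g => (TemperedDistribution.smulLeftCLM ℂ (g : Phase ι → ℂ)).toLinearMap
      map_add' := fun g₁ g₂ => by
        rw [← ContinuousLinearMap.toLinearMap_add,
          ← TemperedDistribution.smulLeftCLM_add g₁.2 g₂.2]
        rfl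
      map_smul' := fun c g => by
        rw [RingHom.id_apply, ← ContinuousLinearMap.toLinearMap_smul,
          ← TemperedDistribution.smulLeftCLM_smul g.2]
        rfl }
    (by
      ext T f
      change T (SchwartzMap.smulLeftCLM ℂ (fun _ => (1 : ℂ)) f) = T f
      rw [SchwartzMap.smulLeftCLM_const]
      simp)
    (fun g₁ g₂ => by
      ext T f
      change T (SchwartzMap.smulLeftCLM ℂ ((g₁ : Phase ι → ℂ) * (g₂ : Phase ι → ℂ)) f) = T
        (SchwartzMap.smulLeftCLM ℂ (g₂ : Phase ι → ℂ)
          (SchwartzMap.smulLeftCLM ℂ (g₁ : Phase ι → ℂ) f))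
      rw [SchwartzMap.smulLeftCLM_smulLeftCLM_apply g₂.2 g₁.2, mul_comm])

lemma mulDist_apply (g : temperateGrowth ι) (T : 𝓢'(Phase ι, ℂ)) :
    mulDist g T = TemperedDistribution.smulLeftCLM ℂ (g : Phase ι → ℂ) T := rfl

/-- Directional derivatives of tempered distributions. -/
def derivDist (v : Phase ι) : Module.End ℂ 𝓢'(Phase ι, ℂ) :=
  (lineDerivOpCLM ℂ 𝓢'(Phase ι, ℂ) v).toLinearMap

lemma derivDist_apply (v : Phase ι) (T : 𝓢'(Phase ι, ℂ)) (f : 𝓢(Phase ι, ℂ)) :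
    derivDist v T f = -T (∂_{v} f) := by
  rw [← map_neg]
  rfl

lemma two_le_infty : (2 : WithTop ℕ∞) ≤ ∞ :=
  WithTop.coe_le_coe.2 (le_top : (2 : ℕ∞) ≤ ⊤)

lemma lineDerivOp_smulLeftCLM (L : Phase ι →L[ℝ] ℂ) (v : Phase ι) (f : 𝓢(Phase ι, ℂ)) :
    ∂_{v} (SchwartzMap.smulLeftCLM ℂ (fun Ψ => L Ψ) f)
      = SchwartzMap.smulLeftCLM ℂ (fun Ψ => L Ψ) (∂_{v} f) + L v • f := by
  ext Ψ
  rw [SchwartzMap.lineDerivOp_apply_eq_fderiv, SchwartzMap.smulLeftCLM_apply L.hasTemperateGrowth,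
    _root_.add_apply, SchwartzMap.smulLeftCLM_apply_apply L.hasTemperateGrowth]
  simp only [smul_eq_mul]
  rw [fderiv_fun_mul L.differentiableAt f.differentiableAt]
  simp [SchwartzMap.lineDerivOp_apply_eq_fderiv, mul_comm]

lemma lineDerivOp_comm (v w : Phase ι) (f : 𝓢(Phase ι, ℂ)) : ∂_{v} (∂_{w} f) = ∂_{w} (∂_{v} f) := by
  ext Ψ
  have h := (f.smooth ⊤).contDiffAt.isSymmSndFDerivAt (x := Ψ) (by simpa using two_le_infty)
  have e : ∀ a b : Phase ι, ∂_{a} (∂_{b} f) Ψ = fderiv ℝ (fderiv ℝ f) Ψ a b := by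
    intro a b
    rw [SchwartzMap.lineDerivOp_apply_eq_fderiv]
    have hd : DifferentiableAt ℝ (fderiv ℝ f) Ψ :=
      ((f.smooth ⊤).fderiv_right (m := 1) (one_add_one_eq_two.trans_le two_le_infty)).differentiable (by simp) Ψ
    have e2 : ((∂_{b} f : 𝓢(Phase ι, ℂ)) : Phase ι → ℂ) = fun Φ => fderiv ℝ f Φ b := rfl
    rw [e2, fderiv_clm_apply hd (differentiableAt_const b)]
    simp
  rw [e, e]
  exact h v w

lemma derivDist_mulDist (L : Phase ι →L[ℝ] ℂ) (hL : (fun Ψ => L Ψ) ∈ temperateGrowth ι)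
    (v : Phase ι) : derivDist v * mulDist ⟨_, hL⟩ - mulDist ⟨_, hL⟩ * derivDist v = L v • 1 := by
  ext T f
  change derivDist v (mulDist ⟨_, hL⟩ T) f
    - (derivDist v T) (SchwartzMap.smulLeftCLM ℂ (fun Ψ => L Ψ) f) = L v • T f
  rw [derivDist_apply, derivDist_apply, lineDerivOp_smulLeftCLM, map_add, map_smul, mulDist_apply,
    TemperedDistribution.smulLeftCLM_apply_apply]
  ring

lemma isDiffRep_dist : IsDiffRep (mulDist (ι := ι)) derivDist where
  coord_mem := hasTemperateGrowth_coord
  conj_mem := hasTemperateGrowth_conj_coord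
  comm v w := by
    ext T f
    change derivDist v (derivDist w T) f = derivDist w (derivDist v T) f
    simp only [derivDist_apply, lineDerivOp_comm v w]
  coord v i := derivDist_mulDist (coordCLM i) _ v
  conj_coord v i := derivDist_mulDist (conjCoordCLM i) _ v

lemma mixedDerivDist_eq (φ : (c : Fin C) → ι c → Space D → ℂ) (j k : Fin C → ℕ) (x : Space D)
    (T : 𝓢'(Phase ι, ℂ)) :
    mixedDerivDist φ j k x T = listProd (fun c =>
      modeSum (fun c n => φ c n x) (wirtingerStarOf derivDist) c ^ j c
        * modeSum (fun c n => conj (φ c n x)) (wirtingerOf derivDist) c ^ k c) T := by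
  set ψ := ContinuousLinearMap.toLinearMapRingHom (R₁ := ℂ) (M₁ := 𝓢'(Phase ι, ℂ)) with hψ
  have h : ψ (mixedDerivDist φ j k x) = listProd (fun c =>
      modeSum (fun c n => φ c n x) (wirtingerStarOf derivDist) c ^ j c
        * modeSum (fun c n => conj (φ c n x)) (wirtingerOf derivDist) c ^ k c) := by
    have e1 : ∀ c, ψ (funcDerivStarDist φ c x)
        = modeSum (fun c n => φ c n x) (wirtingerStarOf derivDist) c := fun c => by
      rw [funcDerivStarDist, map_sum]
      rfl
    have e2 : ∀ c, ψ (funcDerivDist φ c x)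
        = modeSum (fun c n => conj (φ c n x)) (wirtingerOf derivDist) c := fun c => by
      rw [funcDerivDist, map_sum]
      rfl
    rw [mixedDerivDist, map_list_prod, List.map_ofFn, listProd]
    congr! 3
    simp only [Function.comp_apply, map_mul, map_pow, e1, e2]
  rw [← h]
  rfl

/-- The differential form of the loss term on tempered distributions. -/
lemma sum_mixedDerivDist (φ : (c : Fin C) → ι c → Space D → ℂ) (l : Fin C → ℕ) (x : Space D)
    (T : 𝓢'(Phase ι, ℂ)) :
    ∑ j ∈ indexBox l, ∑ k ∈ indexBox l, mixedDerivDist φ j k x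
        (TemperedDistribution.smulLeftCLM ℂ (lossCoeff φ l j k x) T)
      = isDiffRep_dist.lossOperator (fun c n => φ c n x) l T := by
  rw [← isDiffRep_dist.sum_eq_lossOperator]
  simp only [LinearMap.sum_apply]
  refine Finset.sum_congr rfl fun j _ => Finset.sum_congr rfl fun k _ => ?_
  obtain ⟨u, hu, h⟩ := isDiffRep_dist.exists_lossCoeff φ l j k x
  rw [mixedDerivDist_eq, Module.End.mul_apply, ← h, mulDist_apply, hu]

end Distribution

/-! ### Operators on smooth functions -/

section Smooth

variable [∀ c, Fintype (ι c)]

/-- The smooth functions on phase space. -/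
def smoothFunctions (ι : Fin C → Type*) [∀ c, Fintype (ι c)] : Subalgebra ℂ (Phase ι → ℂ) where
  carrier := {g | ContDiff ℝ ∞ g}
  mul_mem' := fun {f g} (hf : ContDiff ℝ ∞ f) (hg : ContDiff ℝ ∞ g) => ContDiff.mul hf hg
  add_mem' := fun {f g} (hf : ContDiff ℝ ∞ f) (hg : ContDiff ℝ ∞ g) => ContDiff.add hf hg
  algebraMap_mem' := fun c => (contDiff_const : ContDiff ℝ ∞ fun _ : Phase ι => c)

lemma lineDeriv_smooth {F : Phase ι → ℂ} (hF : ContDiff ℝ ∞ F) (v : Phase ι) :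
    (fun Ψ => lineDeriv ℝ F Ψ v) = fun Ψ => fderiv ℝ F Ψ v :=
  funext fun Ψ => (hF.differentiable (by simp) Ψ).lineDeriv_eq_fderiv

/-- Directional derivatives of smooth functions. -/
def derivSmooth (v : Phase ι) : Module.End ℂ (smoothFunctions ι) where
  toFun F := ⟨fun Ψ => lineDeriv ℝ (F : Phase ι → ℂ) Ψ v, by
    have hF : ContDiff ℝ ∞ (F : Phase ι → ℂ) := F.2
    rw [lineDeriv_smooth hF]
    exact (hF.fderiv_right (m := ∞) (by simp)).clm_apply contDiff_const⟩
  map_add' F G := by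
    have hF : ContDiff ℝ ∞ (F : Phase ι → ℂ) := F.2
    have hG : ContDiff ℝ ∞ (G : Phase ι → ℂ) := G.2
    ext Ψ
    change lineDeriv ℝ (fun Ψ => (F : Phase ι → ℂ) Ψ + (G : Phase ι → ℂ) Ψ) Ψ v = lineDeriv ℝ (F : Phase ι → ℂ) Ψ v
      + lineDeriv ℝ (G : Phase ι → ℂ) Ψ v
    rw [((hF.add hG).differentiable (by simp) Ψ).lineDeriv_eq_fderiv,
      (hF.differentiable (by simp) Ψ).lineDeriv_eq_fderiv,
      (hG.differentiable (by simp) Ψ).lineDeriv_eq_fderiv,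
      fderiv_fun_add (hF.differentiable (by simp) Ψ) (hG.differentiable (by simp) Ψ)]
    rfl
  map_smul' c F := by
    have hF : ContDiff ℝ ∞ (F : Phase ι → ℂ) := F.2
    ext Ψ
    change lineDeriv ℝ (c • (F : Phase ι → ℂ)) Ψ v = c * lineDeriv ℝ (F : Phase ι → ℂ) Ψ v
    rw [((hF.differentiable (by simp) Ψ).const_smul c).lineDeriv_eq_fderiv,
      (hF.differentiable (by simp) Ψ).lineDeriv_eq_fderiv,
      fderiv_const_smul (hF.differentiable (by simp) Ψ)]
    rfl

lemma derivSmooth_apply (v : Phase ι) (F : smoothFunctions ι) (Ψ : Phase ι) :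
    (derivSmooth v F : Phase ι → ℂ) Ψ = fderiv ℝ (F : Phase ι → ℂ) Ψ v := by
  have hF : ContDiff ℝ ∞ (F : Phase ι → ℂ) := F.2
  exact congr_fun (lineDeriv_smooth hF v) Ψ

lemma derivSmooth_mul (L : Phase ι →L[ℝ] ℂ) (hL : (fun Ψ => L Ψ) ∈ smoothFunctions ι)
    (v : Phase ι) : derivSmooth v * Algebra.lmul ℂ (smoothFunctions ι) ⟨_, hL⟩
      - Algebra.lmul ℂ (smoothFunctions ι) ⟨_, hL⟩ * derivSmooth v = L v • 1 := by
  ext F Ψ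
  have hF : ContDiff ℝ ∞ (F : Phase ι → ℂ) := F.2
  change (derivSmooth v (⟨_, hL⟩ * F) : Phase ι → ℂ) Ψ - L Ψ * (derivSmooth v F : Phase ι → ℂ) Ψ
    = L v * (F : Phase ι → ℂ) Ψ
  rw [derivSmooth_apply, derivSmooth_apply]
  change fderiv ℝ (fun Ψ => L Ψ * (F : Phase ι → ℂ) Ψ) Ψ v - _ = _
  rw [fderiv_fun_mul L.differentiableAt (hF.differentiable (by simp) Ψ)]
  simp [mul_comm]

lemma isDiffRep_smooth : IsDiffRep (Algebra.lmul ℂ (smoothFunctions ι)) derivSmooth where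
  coord_mem i := show ContDiff ℝ ∞ (coordCLM i) from (coordCLM i).contDiff
  conj_mem i := show ContDiff ℝ ∞ (conjCoordCLM i) from (conjCoordCLM i).contDiff
  comm v w := by
    ext F Ψ
    have hF : ContDiff ℝ ∞ (F : Phase ι → ℂ) := F.2
    have h := hF.contDiffAt.isSymmSndFDerivAt (x := Ψ) (by simpa using two_le_infty)
    have e : ∀ a b : Phase ι, (derivSmooth a (derivSmooth b F) : Phase ι → ℂ) Ψ
        = fderiv ℝ (fderiv ℝ (F : Phase ι → ℂ)) Ψ a b := by
      intro a b
      have hd : DifferentiableAt ℝ (fderiv ℝ (F : Phase ι → ℂ)) Ψ :=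
        (hF.fderiv_right (m := 1) (one_add_one_eq_two.trans_le two_le_infty)).differentiable (by simp) Ψ
      rw [derivSmooth_apply, funext (derivSmooth_apply b F),
        fderiv_clm_apply hd (differentiableAt_const b)]
      simp
    change (derivSmooth v (derivSmooth w F) : Phase ι → ℂ) Ψ
      = (derivSmooth w (derivSmooth v F) : Phase ι → ℂ) Ψ
    rw [e, e]
    exact h v w
  coord v i := derivSmooth_mul (coordCLM i) _ v
  conj_coord v i := derivSmooth_mul (conjCoordCLM i) _ v

lemma coe_wirtingerOf_derivSmooth (i : Mode ι) (F : smoothFunctions ι) :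
    (wirtingerOf derivSmooth i F : Phase ι → ℂ) = wirtinger i F := rfl

lemma coe_wirtingerStarOf_derivSmooth (i : Mode ι) (F : smoothFunctions ι) :
    (wirtingerStarOf derivSmooth i F : Phase ι → ℂ) = wirtingerStar i F := rfl

lemma mixedDeriv_eq (φ : (c : Fin C) → ι c → Space D → ℂ) (j k : Fin C → ℕ) (x : Space D)
    (F : smoothFunctions ι) :
    mixedDeriv φ j k x F = (listProd (fun c =>
      modeSum (fun c n => φ c n x) (wirtingerStarOf derivSmooth) c ^ j c
        * modeSum (fun c n => conj (φ c n x)) (wirtingerOf derivSmooth) c ^ k c) F :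
        smoothFunctions ι) := by
  have e1 : ∀ c (G : smoothFunctions ι), funcDerivStar φ c x G
      = (modeSum (fun c n => φ c n x) (wirtingerStarOf derivSmooth) c G : smoothFunctions ι) := by
    intro c G
    funext Ψ
    simp [modeSum, funcDerivStar, ← coe_wirtingerStarOf_derivSmooth]
  have e2 : ∀ c (G : smoothFunctions ι), funcDeriv φ c x G
      = (modeSum (fun c n => conj (φ c n x)) (wirtingerOf derivSmooth) c G :
        smoothFunctions ι) := by
    intro c G
    funext Ψ
    simp [modeSum, funcDeriv, ← coe_wirtingerOf_derivSmooth]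
  have hpow : ∀ (f : (Phase ι → ℂ) → (Phase ι → ℂ)) (T : Module.End ℂ (smoothFunctions ι)),
      (∀ G : smoothFunctions ι, f G = (T G : smoothFunctions ι)) →
      ∀ (a : ℕ) (G : smoothFunctions ι), f^[a] G = ((T ^ a) G : smoothFunctions ι) := by
    intro f T hf a
    induction a with
    | zero => intro G; rfl
    | succ a ih =>
      intro G
      rw [Function.iterate_succ_apply, hf, ih, pow_succ, Module.End.mul_apply]
  have hlist : ∀ L : List (Fin C), (L.map fun c => (funcDerivStar φ c x)^[j c]
        ∘ (funcDeriv φ c x)^[k c]).foldr (· ∘ ·) id (F : Phase ι → ℂ)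
      = ((L.map fun c => modeSum (fun c n => φ c n x) (wirtingerStarOf derivSmooth) c ^ j c
        * modeSum (fun c n => conj (φ c n x)) (wirtingerOf derivSmooth) c ^ k c).prod F :
        smoothFunctions ι) := by
    intro L
    induction L with
    | nil => rfl
    | cons c L ih =>
      rw [List.map_cons, List.foldr_cons, List.map_cons, List.prod_cons, Function.comp_apply, ih,
        Function.comp_apply, hpow _ _ (e2 c), hpow _ _ (e1 c)]
      rfl
  rw [mixedDeriv, listProd, List.ofFn_eq_map, List.ofFn_eq_map]
  exact hlist _

/-- The differential form of the loss term on smooth functions. -/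
lemma sum_mixedDeriv (φ : (c : Fin C) → ι c → Space D → ℂ) (l : Fin C → ℕ) (x : Space D)
    (F : smoothFunctions ι) (Ψ : Phase ι) :
    ∑ j ∈ indexBox l, ∑ k ∈ indexBox l, mixedDeriv φ j k x
        (fun Ψ' => lossCoeff φ l j k x Ψ' * (F : Phase ι → ℂ) Ψ') Ψ
      = (isDiffRep_smooth.lossOperator (fun c n => φ c n x) l F : Phase ι → ℂ) Ψ := by
  rw [← isDiffRep_smooth.sum_eq_lossOperator]
  simp only [LinearMap.sum_apply, AddSubmonoidClass.coe_finsetSum, Finset.sum_apply]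
  refine Finset.sum_congr rfl fun j _ => Finset.sum_congr rfl fun k _ => ?_
  obtain ⟨u, hu, h⟩ := isDiffRep_smooth.exists_lossCoeff φ l j k x
  rw [Module.End.mul_apply, ← h, ← mixedDeriv_eq, ← hu]
  rfl

end Smooth

/-! ### The Wigner transformations as intertwiners -/

section Intertwiner

variable {V : Type*} [AddCommGroup V] [Module ℂ V] {P : Submodule ℂ (FockMatrix ι)}

/-- Pairs of an operation on matrices and an operator on phase space that correspond to each other
under a linear transformation `W`. -/
def intertwiners (W : P →ₗ[ℂ] V) :
    Subalgebra ℂ (Module.End ℂ (FockMatrix ι) × Module.End ℂ V) where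
  carrier := {T | ∀ A : P, ∃ h : T.1 A ∈ P, W ⟨T.1 A, h⟩ = T.2 (W A)}
  mul_mem' := by
    intro S T hS hT A
    obtain ⟨h1, e1⟩ := hT A
    obtain ⟨h2, e2⟩ := hS ⟨_, h1⟩
    refine ⟨h2, ?_⟩
    rw [e1] at e2
    exact e2
  add_mem' := by
    intro S T hS hT A
    obtain ⟨h1, e1⟩ := hT A
    obtain ⟨h2, e2⟩ := hS A
    refine ⟨P.add_mem h2 h1, ?_⟩
    have := W.map_add ⟨_, h2⟩ ⟨_, h1⟩
    rw [e1, e2] at this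
    exact this
  algebraMap_mem' := by
    intro c A
    refine ⟨P.smul_mem c A.2, ?_⟩
    exact W.map_smul c A

variable {𝒜 : Subalgebra ℂ (Phase ι → ℂ)} {ρ : 𝒜 →ₐ[ℂ] Module.End ℂ V}
  {𝒟 : Phase ι → Module.End ℂ V}

/-- The correspondence between ladder operators and differential operators on phase space. -/
structure IsWignerMap (h : IsDiffRep ρ 𝒟) (W : P →ₗ[ℂ] V) : Prop where
  leftAnnihil : ∀ i,
    (leftAnnihil i, h.mulCoord i + (1 / 2 : ℂ) • wirtingerStarOf 𝒟 i) ∈ intertwiners W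
  leftCreate : ∀ i, (leftCreate i, h.mulConj i - (1 / 2 : ℂ) • wirtingerOf 𝒟 i) ∈ intertwiners W
  rightAnnihil : ∀ i,
    (rightAnnihil i, h.mulCoord i - (1 / 2 : ℂ) • wirtingerStarOf 𝒟 i) ∈ intertwiners W
  rightCreate : ∀ i, (rightCreate i, h.mulConj i + (1 / 2 : ℂ) • wirtingerOf 𝒟 i) ∈ intertwiners W

variable [∀ c, Fintype (ι c)]

lemma wignerDist_coord (A : (polyBounded : Submodule ℂ (FockMatrix ι))) (i : Mode ι) :
    isDiffRep_dist.mulCoord i (wignerDist A) = (1 / 2 : ℂ) •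
      (wignerDist ⟨leftAnnihil i A, (isLadder_leftAnnihil i).polyBounded A.2⟩
        + wignerDist ⟨rightAnnihil i A, (isLadder_rightAnnihil i).polyBounded A.2⟩) := by
  ext f
  have hf := testMatrix_mem f
  change pairing (testMatrix (SchwartzMap.smulLeftCLM ℂ (fun Ψ : Phase ι => Ψ i) f)) A.1
    = (1 / 2 : ℂ) * (pairing (testMatrix f) (leftAnnihil i A.1)
      + pairing (testMatrix f) (rightAnnihil i A.1))
  rw [testMatrix_coord, pairing_smul_left, pairing_add_left ((isLadder_leftAnnihil i).rapid hf)
    ((isLadder_rightAnnihil i).rapid hf) A.2, pairing_leftAnnihil, pairing_rightAnnihil, add_comm]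

lemma wignerDist_conj (A : (polyBounded : Submodule ℂ (FockMatrix ι))) (i : Mode ι) :
    isDiffRep_dist.mulConj i (wignerDist A) = (1 / 2 : ℂ) •
      (wignerDist ⟨leftCreate i A, (isLadder_leftCreate i).polyBounded A.2⟩
        + wignerDist ⟨rightCreate i A, (isLadder_rightCreate i).polyBounded A.2⟩) := by
  ext f
  have hf := testMatrix_mem f
  change pairing (testMatrix (SchwartzMap.smulLeftCLM ℂ (fun Ψ : Phase ι => conj (Ψ i)) f)) A.1
    = (1 / 2 : ℂ) * (pairing (testMatrix f) (leftCreate i A.1)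
      + pairing (testMatrix f) (rightCreate i A.1))
  rw [testMatrix_conj_coord, pairing_smul_left, pairing_add_left ((isLadder_leftCreate i).rapid hf)
    ((isLadder_rightCreate i).rapid hf) A.2, pairing_leftCreate, pairing_rightCreate, add_comm]

lemma pairing_sub_left {A A' B : FockMatrix ι} (hA : A ∈ rapid) (hA' : A' ∈ rapid)
    (hB : B ∈ polyBounded) : pairing (A - A') B = pairing A B - pairing A' B := by
  simp only [pairing, Matrix.sub_apply, sub_mul]
  exact (summable_pairing hA hB).tsum_sub (summable_pairing hA' hB)

lemma wignerDist_wirtinger (A : (polyBounded : Submodule ℂ (FockMatrix ι))) (i : Mode ι) :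
    wirtingerOf derivDist i (wignerDist A)
      = wignerDist ⟨rightCreate i A, (isLadder_rightCreate i).polyBounded A.2⟩
        - wignerDist ⟨leftCreate i A, (isLadder_leftCreate i).polyBounded A.2⟩ := by
  classical
  ext f
  have hf := testMatrix_mem f
  have e : wirtingerOf derivDist i (wignerDist A) f
      = -pairing (testMatrix (schwartzWirtinger i f)) A.1 := by
    rw [IsDiffRep.wirtingerOf_eq]
    change (1 / 2 : ℂ) * (derivDist _ (wignerDist A) f
      + -Complex.I * derivDist _ (wignerDist A) f) = -wignerDist A (schwartzWirtinger i f)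
    have h : schwartzWirtinger i f = (1 / 2 : ℂ) • (∂_{(Pi.single i 1 : Phase ι)} f
      - Complex.I • ∂_{(Pi.single i Complex.I : Phase ι)} f) := rfl
    rw [h, map_smul, map_sub, map_smul, derivDist_apply, derivDist_apply]
    simp only [smul_eq_mul]
    ring
  rw [e, testMatrix_wirtinger, pairing_sub_left ((isLadder_rightCreate i).rapid hf)
    ((isLadder_leftCreate i).rapid hf) A.2, pairing_leftCreate, pairing_rightCreate, neg_sub]
  rfl

lemma wignerDist_wirtingerStar (A : (polyBounded : Submodule ℂ (FockMatrix ι))) (i : Mode ι) :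
    wirtingerStarOf derivDist i (wignerDist A)
      = wignerDist ⟨leftAnnihil i A, (isLadder_leftAnnihil i).polyBounded A.2⟩
        - wignerDist ⟨rightAnnihil i A, (isLadder_rightAnnihil i).polyBounded A.2⟩ := by
  classical
  ext f
  have hf := testMatrix_mem f
  have e : wirtingerStarOf derivDist i (wignerDist A) f
      = -pairing (testMatrix (schwartzWirtingerStar i f)) A.1 := by
    rw [IsDiffRep.wirtingerStarOf_eq]
    change (1 / 2 : ℂ) * (derivDist _ (wignerDist A) f
      + Complex.I * derivDist _ (wignerDist A) f) = -wignerDist A (schwartzWirtingerStar i f)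
    have h : schwartzWirtingerStar i f = (1 / 2 : ℂ) • (∂_{(Pi.single i 1 : Phase ι)} f
      + Complex.I • ∂_{(Pi.single i Complex.I : Phase ι)} f) := rfl
    rw [h, map_smul, map_add, map_smul, derivDist_apply, derivDist_apply]
    simp only [smul_eq_mul]
    ring
  rw [e, testMatrix_wirtingerStar, pairing_sub_left ((isLadder_leftAnnihil i).rapid hf)
    ((isLadder_rightAnnihil i).rapid hf) A.2, pairing_leftAnnihil, pairing_rightAnnihil, neg_sub]
  rfl

lemma isWignerMap_dist : IsWignerMap (isDiffRep_dist (ι := ι)) wignerDist where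
  leftAnnihil i A := by
    refine ⟨(isLadder_leftAnnihil i).polyBounded A.2, ?_⟩
    simp only [LinearMap.add_apply, LinearMap.smul_apply, wignerDist_coord,
      wignerDist_wirtingerStar]
    module
  leftCreate i A := by
    refine ⟨(isLadder_leftCreate i).polyBounded A.2, ?_⟩
    simp only [LinearMap.sub_apply, LinearMap.smul_apply, wignerDist_conj, wignerDist_wirtinger]
    module
  rightAnnihil i A := by
    refine ⟨(isLadder_rightAnnihil i).polyBounded A.2, ?_⟩
    simp only [LinearMap.sub_apply, LinearMap.smul_apply, wignerDist_coord,
      wignerDist_wirtingerStar]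
    module
  rightCreate i A := by
    refine ⟨(isLadder_rightCreate i).polyBounded A.2, ?_⟩
    simp only [LinearMap.add_apply, LinearMap.smul_apply, wignerDist_conj, wignerDist_wirtinger]
    module

/-- The Wigner transform of rapidly decreasing matrices, with values in the smooth functions. -/
def wignerSmooth : (rapid : Submodule ℂ (FockMatrix ι)) →ₗ[ℂ] smoothFunctions ι where
  toFun A := ⟨wignerFun A.1, contDiff_wignerFun A.2⟩
  map_add' A B := by
    ext Ψ
    exact pairing_add_left A.2 B.2 (wignerMatrix_mem Ψ)
  map_smul' c A := by
    ext Ψ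
    exact pairing_smul_left c _ _

lemma wignerSmooth_apply (A : (rapid : Submodule ℂ (FockMatrix ι))) (Ψ : Phase ι) :
    (wignerSmooth A : Phase ι → ℂ) Ψ = wignerFun A.1 Ψ := rfl

lemma wignerSmooth_coord (A : (rapid : Submodule ℂ (FockMatrix ι))) (i : Mode ι) (Ψ : Phase ι) :
    (isDiffRep_smooth.mulCoord i (wignerSmooth A) : Phase ι → ℂ) Ψ
      = (1 / 2 : ℂ) * (wignerFun (leftAnnihil i A) Ψ + wignerFun (rightAnnihil i A) Ψ) :=
  coord_mul_wignerFun A.2 i Ψ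

lemma wignerSmooth_conj (A : (rapid : Submodule ℂ (FockMatrix ι))) (i : Mode ι) (Ψ : Phase ι) :
    (isDiffRep_smooth.mulConj i (wignerSmooth A) : Phase ι → ℂ) Ψ
      = (1 / 2 : ℂ) * (wignerFun (leftCreate i A) Ψ + wignerFun (rightCreate i A) Ψ) :=
  conj_coord_mul_wignerFun A.2 i Ψ

lemma wignerSmooth_wirtinger (A : (rapid : Submodule ℂ (FockMatrix ι))) (i : Mode ι)
    (Ψ : Phase ι) : (wirtingerOf derivSmooth i (wignerSmooth A) : Phase ι → ℂ) Ψ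
      = wignerFun (rightCreate i A) Ψ - wignerFun (leftCreate i A) Ψ :=
  wirtinger_wignerFun A.2 i Ψ

lemma wignerSmooth_wirtingerStar (A : (rapid : Submodule ℂ (FockMatrix ι))) (i : Mode ι)
    (Ψ : Phase ι) : (wirtingerStarOf derivSmooth i (wignerSmooth A) : Phase ι → ℂ) Ψ
      = wignerFun (leftAnnihil i A) Ψ - wignerFun (rightAnnihil i A) Ψ :=
  wirtingerStar_wignerFun A.2 i Ψ

lemma isWignerMap_smooth : IsWignerMap (isDiffRep_smooth (ι := ι)) wignerSmooth where
  leftAnnihil i A := by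
    refine ⟨(isLadder_leftAnnihil i).rapid A.2, ?_⟩
    ext Ψ
    have h1 := wignerSmooth_coord A i Ψ
    have h2 := wignerSmooth_wirtingerStar A i Ψ
    simp only [wignerSmooth_apply, LinearMap.add_apply, LinearMap.smul_apply, Subalgebra.coe_add,
      Subalgebra.coe_smul, Pi.add_apply, Pi.smul_apply, smul_eq_mul, h1, h2]
    ring
  leftCreate i A := by
    refine ⟨(isLadder_leftCreate i).rapid A.2, ?_⟩
    ext Ψ
    have h1 := wignerSmooth_conj A i Ψ
    have h2 := wignerSmooth_wirtinger A i Ψ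
    simp only [wignerSmooth_apply, LinearMap.sub_apply, LinearMap.smul_apply, Subalgebra.coe_sub,
      Subalgebra.coe_smul, Pi.sub_apply, Pi.smul_apply, smul_eq_mul, h1, h2]
    ring
  rightAnnihil i A := by
    refine ⟨(isLadder_rightAnnihil i).rapid A.2, ?_⟩
    ext Ψ
    have h1 := wignerSmooth_coord A i Ψ
    have h2 := wignerSmooth_wirtingerStar A i Ψ
    simp only [wignerSmooth_apply, LinearMap.sub_apply, LinearMap.smul_apply, Subalgebra.coe_sub,
      Subalgebra.coe_smul, Pi.sub_apply, Pi.smul_apply, smul_eq_mul, h1, h2]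
    ring
  rightCreate i A := by
    refine ⟨(isLadder_rightCreate i).rapid A.2, ?_⟩
    ext Ψ
    have h1 := wignerSmooth_conj A i Ψ
    have h2 := wignerSmooth_wirtinger A i Ψ
    simp only [wignerSmooth_apply, LinearMap.add_apply, LinearMap.smul_apply, Subalgebra.coe_add,
      Subalgebra.coe_smul, Pi.add_apply, Pi.smul_apply, smul_eq_mul, h1, h2]
    ring

/-- Fubini's theorem exchanges the integrations over the test function and over the displacement. -/
lemma testMatrix_eq_integral (f : 𝓢(Phase ι, ℂ)) (m n : Occ ι) :
    testMatrix f m n = 1 / (Real.pi : ℂ) ^ (2 * Fintype.card (Mode ι)) *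
      ∫ Λ : Phase ι, (∫ Ψ : Phase ι, f Ψ * ∏ i, phaseFactor (Λ i) (Ψ i)) * dispMatrix Λ m n := by
  have hint : Integrable (Function.uncurry fun (Ψ Λ : Phase ι) =>
      f Ψ * ((∏ i, phaseFactor (Λ i) (Ψ i)) * dispMatrix Λ m n)) (volume.prod volume) := by
    refine ((f.integrable (μ := volume)).mul_prod (integrable_dispMatrix m n)).mono ?_
      (.of_forall fun p => ?_)
    · have hc := continuous_prod_phaseFactor (ι := ι)
      refine Continuous.aestronglyMeasurable ?_
      exact (f.continuous.comp continuous_fst).mul ((hc.comp continuous_swap).mul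
        ((continuous_dispMatrix m n).comp continuous_snd))
    · simp only [Function.uncurry, norm_mul, norm_prod_phaseFactor, one_mul, le_refl]
  simp only [testMatrix_apply, wignerMatrix_eq_integral]
  have e : ∀ Ψ : Phase ι, f Ψ * (1 / (Real.pi : ℂ) ^ (2 * Fintype.card (Mode ι)) *
      ∫ Λ : Phase ι, (∏ i, phaseFactor (Λ i) (Ψ i)) * dispMatrix Λ m n)
      = 1 / (Real.pi : ℂ) ^ (2 * Fintype.card (Mode ι)) * ∫ Λ : Phase ι,
        f Ψ * ((∏ i, phaseFactor (Λ i) (Ψ i)) * dispMatrix Λ m n) := by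
    intro Ψ
    rw [integral_const_mul]
    ring
  simp only [e]
  rw [integral_const_mul, integral_integral_swap hint]
  congr 1
  refine integral_congr_ae (.of_forall fun Λ => ?_)
  simp only [← mul_assoc]
  rw [integral_mul_const]

lemma IsOrthonormalModes.isWignerDistribution {region : Set (Space D)}
    {φ : (c : Fin C) → ι c → Space D → ℂ} (hφ : IsOrthonormalModes region φ)
    (A : (polyBounded : Submodule ℂ (FockMatrix ι))) :
    IsWignerDistribution φ region A.1 (wignerDist A) := by
  intro f
  simp only [hφ.displacementFunctional_eq, hφ.totalDisplacementOp_eq, ← testMatrix_eq_integral]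
  rw [wignerDist_apply, pairing_comm, pairing]
  have h := summable_pairing (testMatrix_mem f) A.2
  rw [← (Equiv.prodComm (Occ ι) (Occ ι)).summable_iff] at h
  refine Summable.hasSum (h.congr fun p => ?_)
  simp [mul_comm]

end Intertwiner

/-! ### Products of operators as actions on matrices -/

section Action

lemma opMul_transpose (A B : FockMatrix ι) : (opMul A B)ᵀ = opMul Bᵀ Aᵀ := by
  ext m n
  simp only [opMul, Matrix.transpose_apply, mul_comm]

lemma opMul_conjTranspose (A B : FockMatrix ι) : (opMul A B)ᴴ = opMul Bᴴ Aᴴ := by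
  ext m n
  simp only [opMul, Matrix.conjTranspose_apply, mul_comm, tsum_star, star_mul']

lemma RowFinite.opMul {A B : FockMatrix ι} (hA : RowFinite A) (hB : RowFinite B) :
    RowFinite (opMul A B) := by
  intro m
  refine ((hA m).biUnion fun k _ => hB k).subset fun n hn => ?_
  by_contra h
  refine hn ?_
  rw [BoseWigner.opMul]
  convert tsum_zero with k
  by_contra hk
  exact h (Set.mem_biUnion (x := k) (left_ne_zero_of_mul hk) (right_ne_zero_of_mul hk))

lemma RowFinite.opMul_assoc {A B : FockMatrix ι} (hA : RowFinite A) (hB : RowFinite B)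
    (E : FockMatrix ι) : BoseWigner.opMul (BoseWigner.opMul A B) E
      = BoseWigner.opMul A (BoseWigner.opMul B E) := by
  ext m n
  have h1 : ∀ (F : Occ ι → ℂ), ∑' k, A m k * F k = ∑ k ∈ (hA m).toFinset, A m k * F k := by
    intro F
    refine tsum_eq_sum fun k hk => ?_
    rw [Set.Finite.mem_toFinset] at hk
    rw [not_not.1 hk, zero_mul]
  simp only [BoseWigner.opMul, h1, Finset.sum_mul, mul_assoc]
  rw [Summable.tsum_finsetSum fun k _ => ?_]
  · simp only [tsum_mul_left]
  · exact (hB.summable_mul E k n).mul_left _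

/-- The operator `F` and its adjoint act by multiplication from the left as `L` and `Ld` and from
the right as `R` and `Rd`. Finitely many nonzero entries in each row and column make all products
with `F` finite sums. -/
structure HasAction (F : FockMatrix ι) (L Ld R Rd : Module.End ℂ (FockMatrix ι)) : Prop where
  row : RowFinite F
  col : RowFinite Fᵀ
  left : ∀ B, opMul F B = L B
  leftAdj : ∀ B, opMul Fᴴ B = Ld B
  right : ∀ B, opMul B F = R B
  rightAdj : ∀ B, opMul B Fᴴ = Rd B

variable {F G : FockMatrix ι} {L Ld R Rd L' Ld' R' Rd' : Module.End ℂ (FockMatrix ι)}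

lemma RowFinite.conj {A : FockMatrix ι} (hA : RowFinite Aᵀ) : RowFinite Aᴴ := fun m =>
  (hA m).subset fun n hn => show A n m ≠ 0 from star_ne_zero.1 (show star (A n m) ≠ 0 from hn)

lemma RowFinite.transpose_conj {A : FockMatrix ι} (hA : RowFinite A) : RowFinite Aᴴᵀ := fun m =>
  (hA m).subset fun n hn => show A m n ≠ 0 from star_ne_zero.1 (show star (A m n) ≠ 0 from hn)

lemma opMul_assoc_right {A B : FockMatrix ι} (hA : RowFinite Aᵀ) (hB : RowFinite Bᵀ)
    (E : FockMatrix ι) : opMul E (opMul A B) = opMul (opMul E A) B := by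
  have h := hB.opMul_assoc hA Eᵀ
  rw [← opMul_transpose, ← opMul_transpose, ← opMul_transpose, ← opMul_transpose] at h
  exact Matrix.transpose_injective h

namespace HasAction

lemma zero : HasAction (0 : FockMatrix ι) 0 0 0 0 where
  row := fun m => Set.finite_empty.subset fun n hn => hn rfl
  col := fun m => Set.finite_empty.subset fun n hn => hn rfl
  left := fun B => by ext; simp [opMul]
  leftAdj := fun B => by ext; simp [opMul]
  right := fun B => by ext; simp [opMul]
  rightAdj := fun B => by ext; simp [opMul]

lemma add (h : HasAction F L Ld R Rd) (h' : HasAction G L' Ld' R' Rd') :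
    HasAction (F + G) (L + L') (Ld + Ld') (R + R') (Rd + Rd') where
  row := h.row.add h'.row
  col := by
    rw [Matrix.transpose_add]
    exact h.col.add h'.col
  left := fun B => by rw [h.row.opMul_add_left h'.row, h.left, h'.left, LinearMap.add_apply]
  leftAdj := fun B => by
    rw [Matrix.conjTranspose_add, h.col.conj.opMul_add_left h'.col.conj, h.leftAdj, h'.leftAdj,
      LinearMap.add_apply]
  right := fun B => by
    apply Matrix.transpose_injective
    rw [opMul_transpose, Matrix.transpose_add, h.col.opMul_add_left h'.col, ← opMul_transpose,
      ← opMul_transpose, h.right, h'.right, LinearMap.add_apply, Matrix.transpose_add]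
  rightAdj := fun B => by
    apply Matrix.transpose_injective
    rw [opMul_transpose, Matrix.conjTranspose_add, Matrix.transpose_add,
      h.row.transpose_conj.opMul_add_left h'.row.transpose_conj, ← opMul_transpose,
      ← opMul_transpose, h.rightAdj, h'.rightAdj, LinearMap.add_apply, Matrix.transpose_add]

lemma smul (h : HasAction F L Ld R Rd) (a : ℂ) :
    HasAction (a • F) (a • L) (conj a • Ld) (a • R) (conj a • Rd) where
  row := h.row.smul a
  col := by
    rw [Matrix.transpose_smul]
    exact h.col.smul a
  left := fun B => by rw [opMul_smul_left, h.left, LinearMap.smul_apply]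
  leftAdj := fun B => by
    rw [Matrix.conjTranspose_smul, opMul_smul_left, h.leftAdj, LinearMap.smul_apply]
    rfl
  right := fun B => by
    apply Matrix.transpose_injective
    rw [opMul_transpose, Matrix.transpose_smul, opMul_smul_left, ← opMul_transpose, h.right,
      LinearMap.smul_apply, Matrix.transpose_smul]
  rightAdj := fun B => by
    apply Matrix.transpose_injective
    rw [opMul_transpose, Matrix.conjTranspose_smul, Matrix.transpose_smul, opMul_smul_left,
      ← opMul_transpose, h.rightAdj, LinearMap.smul_apply, Matrix.transpose_smul]
    rfl

lemma sum {α : Type*} (s : Finset α) {F : α → FockMatrix ι}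
    {L Ld R Rd : α → Module.End ℂ (FockMatrix ι)}
    (h : ∀ a, HasAction (F a) (L a) (Ld a) (R a) (Rd a)) :
    HasAction (∑ a ∈ s, F a) (∑ a ∈ s, L a) (∑ a ∈ s, Ld a) (∑ a ∈ s, R a) (∑ a ∈ s, Rd a) := by
  classical
  induction s using Finset.induction_on with
  | empty => simpa using zero
  | insert a s ha ih =>
    simp only [Finset.sum_insert ha]
    exact (h a).add ih

lemma nil : HasAction (opProd [] : FockMatrix ι) 1 1 1 1 := by
  classical
  have e : (opProd [] : FockMatrix ι) = 1 := by
    simp only [opProd, List.foldr_nil]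
  rw [e]
  have hr : RowFinite (1 : FockMatrix ι) := fun m =>
    (Set.finite_singleton m).subset fun n hn => by
      by_contra h
      exact hn (Matrix.one_apply_ne fun h' => h h'.symm)
  have hl : ∀ B : FockMatrix ι, opMul 1 B = B := fun B => by
    ext m n
    rw [opMul, tsum_eq_single m]
    · simp
    · intro k hk
      rw [Matrix.one_apply_ne hk.symm, zero_mul]
  have hr' : ∀ B : FockMatrix ι, opMul B 1 = B := fun B => by
    apply Matrix.transpose_injective
    rw [opMul_transpose, Matrix.transpose_one, hl]
  exact
  { row := hr
    col := by rwa [Matrix.transpose_one]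
    left := hl
    leftAdj := by
      rw [Matrix.conjTranspose_one]
      exact hl
    right := hr'
    rightAdj := by
      rw [Matrix.conjTranspose_one]
      exact hr' }

lemma mul (h : HasAction F L Ld R Rd) (h' : HasAction G L' Ld' R' Rd') :
    HasAction (opMul F G) (L * L') (Ld' * Ld) (R' * R) (Rd * Rd') where
  row := h.row.opMul h'.row
  col := by
    rw [opMul_transpose]
    exact h'.col.opMul h.col
  left := fun B => by rw [h.row.opMul_assoc h'.row, h'.left, h.left, Module.End.mul_apply]
  leftAdj := fun B => by
    rw [opMul_conjTranspose, h'.col.conj.opMul_assoc h.col.conj, h.leftAdj, h'.leftAdj,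
      Module.End.mul_apply]
  right := fun B => by
    rw [opMul_assoc_right h.col h'.col, h.right, h'.right, Module.End.mul_apply]
  rightAdj := fun B => by
    rw [opMul_conjTranspose, opMul_assoc_right h'.row.transpose_conj h.row.transpose_conj,
      h'.rightAdj, h.rightAdj, Module.End.mul_apply]

lemma pow (h : HasAction F L Ld R Rd) (k : ℕ) :
    HasAction (opPow F k) (L ^ k) (Ld ^ k) (R ^ k) (Rd ^ k) := by
  induction k with
  | zero =>
    simp only [pow_zero]
    exact nil
  | succ k ih =>
    have e : opPow F (k + 1) = opMul F (opPow F k) := by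
      simp [opPow, opProd, List.replicate_succ]
    rw [e, pow_succ' L, pow_succ Ld, pow_succ R, pow_succ' Rd]
    exact h.mul ih

/-- Ordered products over components. The adjoint actions appear in the reversed order, which does
not matter if different components commute. -/
lemma listProd {C' : ℕ} {F : Fin C' → FockMatrix ι}
    {L Ld R Rd : Fin C' → Module.End ℂ (FockMatrix ι)}
    (h : ∀ c, HasAction (F c) (L c) (Ld c) (R c) (Rd c))
    (hLd : ∀ c c', c ≠ c' → Commute (Ld c) (Ld c')) (hR : ∀ c c', c ≠ c' → Commute (R c) (R c')) :
    HasAction (opProd (List.ofFn F)) (listProd L) (listProd Ld) (listProd R) (listProd Rd) := by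
  induction C' with
  | zero => simpa [BoseWigner.listProd] using nil
  | succ C' ih =>
    have e : opProd (List.ofFn F) = opMul (F 0) (opProd (List.ofFn fun c : Fin C' => F c.succ)) := by
      simp [opProd, List.ofFn_succ]
    have h1 : Commute (Ld 0) (BoseWigner.listProd fun c : Fin C' => Ld c.succ) :=
      commute_listProd fun c => hLd _ _ (Fin.succ_ne_zero c).symm
    have h2 : Commute (R 0) (BoseWigner.listProd fun c : Fin C' => R c.succ) :=
      commute_listProd fun c => hR _ _ (Fin.succ_ne_zero c).symm
    rw [e, listProd_succ, listProd_succ, listProd_succ, listProd_succ, h1.eq, h2.eq]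
    exact (h 0).mul (ih (fun c => h c.succ)
      (fun c c' hc => hLd _ _ fun e => hc (Fin.succ_injective _ e))
      fun c c' hc => hR _ _ fun e => hc (Fin.succ_injective _ e))

end HasAction

lemma opMul_annihilation_right (i : Mode ι) (B : FockMatrix ι) :
    opMul B (annihilation i) = rightAnnihil i B := by
  classical
  apply Matrix.conjTranspose_injective
  rw [opMul_conjTranspose, opMul_annihilation_conjTranspose]
  ext m n
  simp [leftCreate_apply, rightAnnihil_apply]

lemma opMul_annihilation_conjTranspose_right (i : Mode ι) (B : FockMatrix ι) :
    opMul B (annihilation i)ᴴ = rightCreate i B := by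
  classical
  apply Matrix.conjTranspose_injective
  rw [opMul_conjTranspose, Matrix.conjTranspose_conjTranspose, opMul_annihilation]
  ext m n
  simp [leftAnnihil_apply, rightCreate_apply]

lemma hasAction_annihilation (i : Mode ι) : HasAction (annihilation i) (leftAnnihil i)
    (leftCreate i) (rightAnnihil i) (rightCreate i) where
  row := rowFinite_annihilation i
  col := fun m => (rowFinite_annihilation_conjTranspose i m).subset fun n hn =>
    show star (annihilation i n m) ≠ 0 from star_ne_zero.2 (show annihilation i n m ≠ 0 from hn)
  left := opMul_annihilation i
  leftAdj := opMul_annihilation_conjTranspose i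
  right := opMul_annihilation_right i
  rightAdj := opMul_annihilation_conjTranspose_right i

lemma commute_leftCreate {i j : Mode ι} (h : i ≠ j) : Commute (leftCreate i) (leftCreate j) := by
  classical
  refine LinearMap.ext fun B => ?_
  ext m n
  simp only [Module.End.mul_apply, leftCreate_apply]
  simp [Pi.single_eq_of_ne h, Pi.single_eq_of_ne h.symm, tsub_right_comm]
  ring

lemma commute_rightAnnihil {i j : Mode ι} (h : i ≠ j) :
    Commute (rightAnnihil i) (rightAnnihil j) := by
  classical
  refine LinearMap.ext fun B => ?_
  ext m n
  simp only [Module.End.mul_apply, rightAnnihil_apply]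
  simp [Pi.single_eq_of_ne h, Pi.single_eq_of_ne h.symm, tsub_right_comm]
  ring

variable [∀ c, Fintype (ι c)]

/-- The loss operator acting on matrices by ladder operators from both sides. The values of the
mode functions at a point are the coefficients `a`. -/
def matrixLossOperator (a : (c : Fin C) → ι c → ℂ) (l : Fin C → ℕ) :
    Module.End ℂ (FockMatrix ι) :=
  lossAction (modeSum a leftAnnihil) (modeSum (fun c n => conj (a c n)) leftCreate)
    (modeSum a rightAnnihil) (modeSum (fun c n => conj (a c n)) rightCreate) l

lemma lossTerm_eq (φ : (c : Fin C) → ι c → Space D → ℂ) (l : Fin C → ℕ) (A : FockMatrix ι)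
    (x : Space D) : lossTerm φ l A x = matrixLossOperator (fun c n => φ c n x) l A := by
  have h1 : ∀ c, HasAction (fieldOp φ c x) (modeSum (fun c n => φ c n x) leftAnnihil c)
      (modeSum (fun c n => conj (φ c n x)) leftCreate c)
      (modeSum (fun c n => φ c n x) rightAnnihil c)
      (modeSum (fun c n => conj (φ c n x)) rightCreate c) := fun c =>
    HasAction.sum _ fun n => (hasAction_annihilation ⟨c, n⟩).smul (φ c n x)
  have h : HasAction (couplingOp φ l x) _ _ _ _ := HasAction.listProd (fun c => (h1 c).pow (l c))
    (fun c c' hc => (commute_modeSum _ _ fun n n' => commute_leftCreate fun e =>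
      hc (congrArg Sigma.fst e)).pow_pow _ _)
    (fun c c' hc => (commute_modeSum _ _ fun n n' => commute_rightAnnihil fun e =>
      hc (congrArg Sigma.fst e)).pow_pow _ _)
  rw [lossTerm, h.left, h.rightAdj, h.col.conj.opMul_assoc h.row, h.left, h.leftAdj,
    opMul_assoc_right h.row.transpose_conj h.col, h.rightAdj, h.right]
  rfl

end Action

/-! ### Integration of operator-valued functions -/

section Expansion

variable {α : Type*} [MeasurableSpace α] {R : Type*} [Ring R] [Algebra ℂ R]

/-- Operator-valued functions that are finite combinations of operators from `𝒮`, with measurable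
coefficients bounded by multiples of `w`. -/
def coeffSpan (μ : Measure α) (𝒮 : Subalgebra ℂ R) (w : α → ℝ) : Submodule ℂ (α → R) :=
  Submodule.span ℂ {F | ∃ (g : α → ℂ) (S : R), S ∈ 𝒮 ∧ AEStronglyMeasurable g μ ∧
    (∀ x, ‖g x‖ ≤ w x) ∧ F = fun x => g x • S}

variable {μ : Measure α} {𝒮 : Subalgebra ℂ R} {w w' : α → ℝ} {F G : α → R}

lemma mul_mem_coeffSpan (hF : F ∈ coeffSpan μ 𝒮 w) (hG : G ∈ coeffSpan μ 𝒮 w') :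
    F * G ∈ coeffSpan μ 𝒮 (w * w') := by
  have h := Submodule.mul_mem_mul hF hG
  rw [coeffSpan, coeffSpan, Submodule.span_mul_span] at h
  refine Submodule.span_mono ?_ h
  rintro _ ⟨_, ⟨g, S, hS, hg, hgw, rfl⟩, _, ⟨g', S', hS', hg', hgw', rfl⟩, rfl⟩
  refine ⟨g * g', S * S', 𝒮.mul_mem hS hS', hg.mul hg', fun x => ?_, ?_⟩
  · rw [Pi.mul_apply, norm_mul]
    exact mul_le_mul (hgw x) (hgw' x) (norm_nonneg _) ((norm_nonneg _).trans (hgw x))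
  · funext x
    exact smul_mul_smul_comm _ _ _ _

lemma one_mem_coeffSpan : (1 : α → R) ∈ coeffSpan μ 𝒮 1 :=
  Submodule.subset_span ⟨1, 1, 𝒮.one_mem, aestronglyMeasurable_const, fun x => by simp, by
    funext x
    simp⟩

lemma pow_mem_coeffSpan (hF : F ∈ coeffSpan μ 𝒮 w) (k : ℕ) : F ^ k ∈ coeffSpan μ 𝒮 (w ^ k) := by
  induction k with
  | zero => simpa using one_mem_coeffSpan
  | succ k ih =>
    rw [pow_succ, pow_succ]
    exact mul_mem_coeffSpan ih hF

lemma listProd_mem_coeffSpan {N : ℕ} {F : Fin N → α → R} {w : Fin N → α → ℝ}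
    (h : ∀ c, F c ∈ coeffSpan μ 𝒮 (w c)) : listProd F ∈ coeffSpan μ 𝒮 (∏ c, w c) := by
  induction N with
  | zero => simpa [listProd] using one_mem_coeffSpan
  | succ N ih =>
    rw [listProd_succ, Fin.prod_univ_succ]
    exact mul_mem_coeffSpan (h 0) (ih fun c => h c.succ)

/-- Weak integrals of finite combinations stay in the algebra, since only the coefficients have to
be integrated. -/
lemma exists_weak_integral (hw : Integrable w μ) (hF : F ∈ coeffSpan μ 𝒮 w) :
    ∃ U ∈ 𝒮, ∀ ev : R →ₗ[ℂ] ℂ, Integrable (fun x => ev (F x)) μ ∧ ∫ x, ev (F x) ∂μ = ev U := by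
  induction hF using Submodule.span_induction with
  | mem F hF =>
    obtain ⟨g, S, hS, hg, hgw, rfl⟩ := hF
    refine ⟨(∫ x, g x ∂μ) • S, 𝒮.smul_mem hS _, fun ev => ?_⟩
    simp only [map_smul, smul_eq_mul]
    exact ⟨(hw.mono' hg (.of_forall hgw)).mul_const _, integral_mul_const _ _⟩
  | zero => exact ⟨0, 𝒮.zero_mem, fun ev => by simp⟩
  | add F G _ _ hF hG =>
    obtain ⟨U, hU, h⟩ := hF
    obtain ⟨U', hU', h'⟩ := hG
    refine ⟨U + U', 𝒮.add_mem hU hU', fun ev => ?_⟩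
    simp only [Pi.add_apply, map_add]
    exact ⟨(h ev).1.add (h' ev).1, by rw [integral_add (h ev).1 (h' ev).1, (h ev).2, (h' ev).2]⟩
  | smul a F _ hF =>
    obtain ⟨U, hU, h⟩ := hF
    refine ⟨a • U, 𝒮.smul_mem hU _, fun ev => ?_⟩
    simp only [Pi.smul_apply, map_smul, smul_eq_mul]
    exact ⟨(h ev).1.const_mul a, by rw [integral_const_mul, (h ev).2]⟩

/-- The loss operator is integrable if the weights of the field operators are. Without any field
operator the three terms cancel. -/
lemma exists_lossAction_mem_coeffSpan {Lo Ld Ro Rd : Fin C → α → R} {w : Fin C → α → ℝ}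
    (hLo : ∀ c, Lo c ∈ coeffSpan μ 𝒮 (w c)) (hLd : ∀ c, Ld c ∈ coeffSpan μ 𝒮 (w c))
    (hRo : ∀ c, Ro c ∈ coeffSpan μ 𝒮 (w c)) (hRd : ∀ c, Rd c ∈ coeffSpan μ 𝒮 (w c))
    (l : Fin C → ℕ) (hw : l ≠ 0 → Integrable (∏ c, (w c ^ 2) ^ l c) μ) :
    ∃ v, Integrable v μ ∧ lossAction Lo Ld Ro Rd l ∈ coeffSpan μ 𝒮 v := by
  by_cases hl : l = 0
  · refine ⟨0, integrable_zero _ _ _, ?_⟩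
    have h1 : listProd (fun _ : Fin C => (1 : α → R)) = 1 := by simp [listProd]
    have h0 : lossAction Lo Ld Ro Rd l = 0 := by
      simp only [lossAction, hl, Pi.zero_apply, pow_zero, h1]
      module
    rw [h0]
    exact Submodule.zero_mem _
  · refine ⟨_, hw hl, ?_⟩
    have e : (∏ c, (w c ^ 2) ^ l c) = (∏ c, w c ^ l c) * ∏ c, w c ^ l c := by
      rw [← Finset.prod_mul_distrib]
      refine Finset.prod_congr rfl fun c _ => ?_
      rw [← pow_mul, mul_comm 2, pow_mul, sq]
    rw [e]
    have h := fun {G : Fin C → α → R} (hG : ∀ c, G c ∈ coeffSpan μ 𝒮 (w c)) =>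
      listProd_mem_coeffSpan fun c => pow_mem_coeffSpan (hG c) (l c)
    exact Submodule.sub_mem _ (Submodule.sub_mem _
      (Submodule.smul_mem _ _ (mul_mem_coeffSpan (h hRd) (h hLo)))
      (mul_mem_coeffSpan (h hLd) (h hLo))) (mul_mem_coeffSpan (h hRo) (h hRd))

end Expansion

/-! ### The integrated loss term -/

section Loss

lemma norm_toMatrix_le (A : Fock ι →L[ℂ] Fock ι) (m n : Occ ι) : ‖toMatrix A m n‖ ≤ ‖A‖ := by
  classical
  have h1 : ∀ n : Occ ι, ‖numberState n‖ = 1 := fun n => by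
    rw [numberState, lp.norm_single (by norm_num)]
    simp
  calc ‖toMatrix A m n‖ ≤ ‖numberState m‖ * ‖A (numberState n)‖ := norm_inner_le_norm _ _
    _ ≤ 1 * (‖A‖ * 1) := by
        rw [h1]
        gcongr
        exact (A.le_opNorm _).trans_eq (by rw [h1])
    _ = ‖A‖ := by ring

variable [∀ c, Fintype (ι c)] {V : Type*} [AddCommGroup V] [Module ℂ V]
  {P : Submodule ℂ (FockMatrix ι)} {𝒜 : Subalgebra ℂ (Phase ι → ℂ)}
  {ρ : 𝒜 →ₐ[ℂ] Module.End ℂ V} {𝒟 : Phase ι → Module.End ℂ V}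

lemma modeSum_mem_coeffSpan {R : Type*} [Ring R] [Algebra ℂ R] {μ : Measure (Space D)}
    {𝒮 : Subalgebra ℂ R} {a : (c : Fin C) → ι c → Space D → ℂ} {T : Mode ι → R}
    (ha : ∀ c n, AEStronglyMeasurable (a c n) μ) (hT : ∀ i, T i ∈ 𝒮) (c : Fin C) :
    (fun x => modeSum (fun c n => a c n x) T c)
      ∈ coeffSpan μ 𝒮 fun x => √(∑ n, ‖a c n x‖ ^ 2) := by
  have e : (fun x => modeSum (fun c n => a c n x) T c) = ∑ n, fun x => a c n x • T ⟨c, n⟩ := by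
    funext x
    rw [Finset.sum_apply]
    rfl
  rw [e]
  refine Submodule.sum_mem _ fun n _ => Submodule.subset_span
    ⟨a c n, T ⟨c, n⟩, hT _, ha c n, fun x => Real.le_sqrt_of_sq_le ?_, rfl⟩
  exact Finset.single_le_sum (f := fun n => ‖a c n x‖ ^ 2) (fun _ _ => by positivity)
    (Finset.mem_univ n)

lemma norm_restrictedDelta (φ : (c : Fin C) → ι c → Space D → ℂ) (c : Fin C) (x : Space D) :
    ‖restrictedDelta φ c x x‖ = ∑ n, ‖φ c n x‖ ^ 2 := by
  have : restrictedDelta φ c x x = ((∑ n, ‖φ c n x‖ ^ 2 : ℝ) : ℂ) := by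
    simp only [restrictedDelta, Complex.ofReal_sum, Complex.ofReal_pow, Complex.conj_mul']
  rw [this, Complex.norm_real, Real.norm_of_nonneg (by positivity)]

/-- Integrating the loss term over the region corresponds to integrating the differential operator
on phase space, tested against an arbitrary linear functional. -/
theorem IsWignerMap.integral_lossTerm {h : IsDiffRep ρ 𝒟} {W : P →ₗ[ℂ] V} (hW : IsWignerMap h W)
    {region : Set (Space D)} {φ : (c : Fin C) → ι c → Space D → ℂ}
    (hφ : ∀ c n, AEStronglyMeasurable (φ c n) (volume.restrict region)) {l : Fin C → ℕ}
    (hl : l ≠ 0 → IntegrableOn (fun x => ∏ c, restrictedDelta φ c x x ^ l c) region) (A : P) :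
    (∀ m n, IntegrableOn (fun x => lossTerm φ l A x m n) region) ∧
    ∃ hA : opIntegral region (lossTerm φ l A) ∈ P, ∀ ev : V →ₗ[ℂ] ℂ,
      IntegrableOn (fun x => ev (h.lossOperator (fun c n => φ c n x) l (W A))) region ∧
      ev (W ⟨_, hA⟩) = ∫ x in region, ev (h.lossOperator (fun c n => φ c n x) l (W A)) := by
  have hφ' : ∀ c n, AEStronglyMeasurable (fun x => conj (φ c n x)) (volume.restrict region) :=
    fun c n => Complex.continuous_conj.comp_aestronglyMeasurable (hφ c n)
  have hconj : ∀ c, (fun x => √(∑ n, ‖conj (φ c n x)‖ ^ 2)) = fun x => √(∑ n, ‖φ c n x‖ ^ 2) := by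
    simp
  have m1 := fun c => modeSum_mem_coeffSpan hφ hW.leftAnnihil c
  have m2 := fun c => modeSum_mem_coeffSpan hφ' hW.leftCreate c
  have m3 := fun c => modeSum_mem_coeffSpan hφ hW.rightAnnihil c
  have m4 := fun c => modeSum_mem_coeffSpan hφ' hW.rightCreate c
  simp only [hconj] at m2 m4
  obtain ⟨v, hv, hmem⟩ := exists_lossAction_mem_coeffSpan m1 m2 m3 m4 l (fun hl0 => by
    refine (hl hl0).norm.congr (.of_forall fun x => ?_)
    simp only [norm_prod, norm_pow, norm_restrictedDelta, Finset.prod_apply, Pi.pow_apply]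
    refine Finset.prod_congr rfl fun c _ => ?_
    rw [Real.sq_sqrt (by positivity)])
  have hmem' : (fun x => (matrixLossOperator (fun c n => φ c n x) l,
      h.lossOperator (fun c n => φ c n x) l))
      ∈ coeffSpan (volume.restrict region) (intertwiners W) v := by
    convert hmem using 1
    funext x
    refine Prod.ext ?_ ?_
    · rw [lossAction_apply]
      refine Eq.trans ?_ (map_lossAction
        (AlgHom.fst ℂ (Module.End ℂ (FockMatrix ι)) (Module.End ℂ V)) _ _ _ _ l).symm
      change matrixLossOperator _ l = _
      rw [matrixLossOperator]
      congr 1 <;> funext c <;> rw [map_modeSum] <;> rfl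
    · rw [lossAction_apply]
      refine Eq.trans ?_ (map_lossAction
        (AlgHom.snd ℂ (Module.End ℂ (FockMatrix ι)) (Module.End ℂ V)) _ _ _ _ l).symm
      change h.lossOperator _ l = _
      rw [IsDiffRep.lossOperator]
      congr 1 <;> funext c <;> rw [map_modeSum] <;> rfl
  obtain ⟨U, hU, hint⟩ := exists_weak_integral hv hmem'
  have h1 := fun m n => hint
    { toFun := fun T => T.1 A m n
      map_add' := fun _ _ => rfl
      map_smul' := fun _ _ => rfl }
  have h2 := fun ev : V →ₗ[ℂ] ℂ => hint
    { toFun := fun T => ev (T.2 (W A))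
      map_add' := fun _ _ => map_add ev _ _
      map_smul' := fun _ _ => map_smul ev _ _ }
  have hloss : opIntegral region (lossTerm φ l A) = U.1 A := by
    ext m n
    simp only [opIntegral, lossTerm_eq]
    exact (h1 m n).2
  obtain ⟨hA, hWA⟩ := hU A
  refine ⟨fun m n => ?_, hloss ▸ hA, fun ev => ⟨(h2 ev).1, ?_⟩⟩
  · simp only [lossTerm_eq]
    exact (h1 m n).1
  · have e : W ⟨opIntegral region (lossTerm φ l A), hloss ▸ hA⟩ = U.2 (W A) := by
      rw [← hWA]
      congr 2
    rw [e]
    exact (h2 ev).2.symm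

lemma toMatrix_mem_polyBounded (A : Fock ι →L[ℂ] Fock ι) : toMatrix A ∈ polyBounded :=
  ⟨0, ‖A‖, norm_nonneg _, fun m n => by simpa using norm_toMatrix_le A m n⟩

end Loss

end BoseWigner

end

open BoseWigner in
theorem mainTheorem3 {D C : ℕ} {ι : Fin C → Type*} [∀ c, Fintype (ι c)]
    (region : Set (Space D)) (φ : (c : Fin C) → ι c → Space D → ℂ)
    (hφ : IsOrthonormalModes region φ)
    (l : Fin C → ℕ)
    (hl : l ≠ 0 → IntegrableOn (fun x => ∏ c, restrictedDelta φ c x x ^ l c) region)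
    (A : Fock ι →L[ℂ] Fock ι) :
    (∀ m n, IntegrableOn (fun x => lossTerm φ l (toMatrix A) x m n) region) ∧
    (∃ W WL : 𝓢'(Phase ι, ℂ),
      IsWignerDistribution φ region (toMatrix A) W ∧
      IsWignerDistribution φ region (opIntegral region (lossTerm φ l (toMatrix A))) WL ∧
      ∀ f : 𝓢(Phase ι, ℂ),
        IntegrableOn (fun x => (∑ j ∈ indexBox l, ∑ k ∈ indexBox l, mixedDerivDist φ j k x
          (TemperedDistribution.smulLeftCLM ℂ (lossCoeff φ l j k x) W)) f) region ∧
        WL f = ∫ x in region, (∑ j ∈ indexBox l, ∑ k ∈ indexBox l, mixedDerivDist φ j k x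
          (TemperedDistribution.smulLeftCLM ℂ (lossCoeff φ l j k x) W)) f) ∧
    (RapidlyDecreasing (toMatrix A) →
      WignerConverges φ region (toMatrix A) ∧
      WignerConverges φ region (opIntegral region (lossTerm φ l (toMatrix A))) ∧
      ContDiff ℝ ∞ (wigner φ region (toMatrix A)) ∧
      ∀ Ψ : Phase ι,
        IntegrableOn (fun x => ∑ j ∈ indexBox l, ∑ k ∈ indexBox l, mixedDeriv φ j k x
          (fun Ψ' => lossCoeff φ l j k x Ψ' * wigner φ region (toMatrix A) Ψ') Ψ) region ∧
        wigner φ region (opIntegral region (lossTerm φ l (toMatrix A))) Ψ =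
          ∫ x in region, ∑ j ∈ indexBox l, ∑ k ∈ indexBox l, mixedDeriv φ j k x
            (fun Ψ' => lossCoeff φ l j k x Ψ' * wigner φ region (toMatrix A) Ψ') Ψ) := by
  have hmeas := fun c n => (hφ.1 c n).aestronglyMeasurable
  have hA0 := toMatrix_mem_polyBounded A
  obtain ⟨hint, hmem, hdist⟩ := isWignerMap_dist.integral_lossTerm hmeas hl ⟨toMatrix A, hA0⟩
  refine ⟨hint, ⟨wignerDist ⟨toMatrix A, hA0⟩, wignerDist ⟨_, hmem⟩,
    hφ.isWignerDistribution ⟨toMatrix A, hA0⟩, hφ.isWignerDistribution ⟨_, hmem⟩, fun f => ?_⟩,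
    fun hA => ?_⟩
  · have h := hdist
      { toFun := fun T => T f
        map_add' := fun _ _ => rfl
        map_smul' := fun _ _ => rfl }
    simp only [sum_mixedDerivDist]
    exact h
  · have hA' : toMatrix A ∈ rapid := hA
    obtain ⟨-, hmem', hsmooth⟩ := isWignerMap_smooth.integral_lossTerm hmeas hl ⟨toMatrix A, hA'⟩
    refine ⟨hφ.wignerConverges hA', hφ.wignerConverges hmem', ?_, fun Ψ => ?_⟩
    · rw [hφ.wigner_eq hA']
      exact contDiff_wignerFun hA'
    rw [hφ.wigner_eq hA', hφ.wigner_eq hmem']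
    have h := hsmooth
      { toFun := fun F => (F : Phase ι → ℂ) Ψ
        map_add' := fun _ _ => rfl
        map_smul' := fun _ _ => rfl }
    have e := fun x => sum_mixedDeriv φ l x (wignerSmooth ⟨toMatrix A, hA'⟩) Ψ
    simp only [wignerSmooth_apply] at e
    simp only [e]
    exact h
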